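/- **Definitions.** An overpartition $\lambda$ is a partition $d_1\ge d_2\ge\cdots\ge d_s\ge 1$ in which the first occurrence of each part may be overlined; $l(\lambda)$ is its number of parts, $|\lambda|$ the sum of its parts, and $f_t(\lambda)$, $f_{\overline t}(\lambda)$ are the numbers of occurrences of the non-overlined part $t$ and of the overlined part $\overline t$. The empty overpartition is allowed. The Gordon marking of $\lambda$ assigns positive integers (marks) to the parts, one after the other in the order $\overline 1<1<\overline 2<2<\cdots$, each as small as possible, so that a part $j$ or $\overline j$ gets a mark different from the marks of all other parts of size $j$ and from the marks of all parts of size $j-1$; except that, if $\overline j$ is a part of $\lambda$, the smallest mark of the parts of size $j-1$ is allowed. Let $k\ge 2$, $1\le i\le k$ and let $N_1\ge N_2\ge\cdots\ge N_{k-1}\ge 0$ be integers. Let $P_{N_1,\ldots,N_{k-1};i}$ be the set of overpartitions $\lambda=(d_1,\ldots,d_s)$ such that * $f_1(\lambda)\le i-1$, and, for $1\le j\le s-k+1$, $d_j-d_{j+k-1}\ge 1$ if $d_j$ is overlined and $d_j-d_{j+k-1}\ge 2$ otherwise; * the smallest part of $\lambda$ (in the order above), if $\lambda$ is not empty, is overlined;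 * $\lambda$ has $N_1+\cdots+N_{k-1}$ parts, exactly $N_r$ of which have mark $r$, for $1\le r\le k-1$; * all $1$-marked parts of $\lambda$ are overlined. Let $Q_{N_1,\ldots,N_{k-1};i}$ be the set of those $\lambda\in P_{N_1,\ldots,N_{k-1};i}$ such that $$f_t(\lambda)+f_{\overline t}(\lambda)+f_{t+1}(\lambda)=k-1$$ for every positive integer $t$ smaller than the greatest $(k-1)$-marked part of $\lambda$, and such that, if $\lambda$ has a $(k-1)$-marked part (i.e. $N_{k-1}>0$), also $f_1(\lambda)=\min(i-1,k-2)$. (If there is no $(k-1)$-marked part, then $Q_{N_1,\ldots,N_{k-1};i}=P_{N_1,\ldots,N_{k-1};i}$.) **Theorem.** For $k\ge 2$, $1\le i\le k$ and $N_1\ge\cdots\ge N_{k-1}\ge 0$, as formal power series in $x$ and $q$, $$\sum_{\gamma\in Q_{N_1,\ldots,N_{k-1};i}}x^{l(\gamma)}q^{|\gamma|}=\frac{q^{\frac{N_1(N_1+1)}2+N_2^2+\cdots+N_{k-1}^2+N_{i+1}+\cdots+N_{k-1}}\;x^{N_1+\cdots+N_{k-1}}}{(q)_{N_1-N_2}(q)_{N_2-N_3}\cdots(q)_{N_{k-2}-N_{k-1}}},$$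 where $(q)_n=(1-q)(1-q^2)\cdots(1-q^n)$, the sum $N_{i+1}+\cdots+N_{k-1}$ is $0$ if $i\ge k-1$, and the denominator is $1$ if $k=2$. -/

import Mathlib

open scoped MvPowerSeries.WithPiTopology

/-- A part of an overpartition: `(j, false)` is the non-overlined part `j`, and `(j, true)` is the
overlined part `j`.  The first component is the underlying part. -/
abbrev OPart := ℕ × Bool

/-- An overpartition, given by the list of its parts in the order
`1̅ ≤ 1 ≤ 2̅ ≤ 2 ≤ ⋯`.  The relation imposed on `p` and any later `p'` says that the underlying parts
increase weakly and that only the first occurrence of a part may be overlined. -/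
@[ext]
structure Overpartition where
  parts : List OPart
  pos : ∀ p ∈ parts, 0 < p.1
  sorted : parts.Pairwise (fun p p' => p.1 < p'.1 ∨ (p.1 = p'.1 ∧ p'.2 = false))

namespace Overpartition

/-- The number of parts. -/
def length (l : Overpartition) : ℕ := l.parts.length

/-- The sum of the (underlying) parts. -/
def size (l : Overpartition) : ℕ := (l.parts.map Prod.fst).sum

/-- The number of occurrences of the non-overlined part `t`. -/
def f (l : Overpartition) (t : ℕ) : ℕ := l.parts.count (t, false)

/-- The number of occurrences of the overlined part `t`. -/
def fbar (l : Overpartition) (t : ℕ) : ℕ := l.parts.count (t, true)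

/-- The parts `d_1 ≥ d_2 ≥ ⋯ ≥ d_s` in the usual decreasing writing, in which an overlined part
stands before the non-overlined parts of the same size, as in `(7̅, 7, 6, 5̅, 2, 1̅)`. -/
def decreasing (l : Overpartition) : List OPart :=
  l.parts.mergeSort (fun p p' => decide (p'.1 < p.1 ∨ (p'.1 = p.1 ∧ (p'.2 = true → p.2 = true))))

/-- The smallest positive integer that is not in `F`. -/
def leastMark (F : Finset ℕ) : ℕ := Nat.find (Infinite.exists_notMem_finset (insert 0 F))

/-- The set of marks given to parts of size `j` in a list of marked parts. -/
def marksAt (done : List (OPart × ℕ)) (j : ℕ) : Finset ℕ :=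
  ((done.filter (fun pm => pm.1.1 = j)).map Prod.snd).toFinset

/-- The marks that the part `p` may not receive when the parts in `done` have been marked: those
of the parts of the same size, and those of the parts of size one less, where the smallest mark
of the latter is allowed if the overlined part of the size of `p` occurs in `all`. -/
def forbiddenMarks (all : List OPart) (done : List (OPart × ℕ)) (p : OPart) : Finset ℕ :=
  marksAt done p.1 ∪
    if (p.1, true) ∈ all then
      (marksAt done (p.1 - 1)).filter
        (fun m => ((marksAt done (p.1 - 1)).filter (fun m' => m' < m)).Nonempty)
    else marksAt done (p.1 - 1)

/-- Go through the remaining parts in order, giving to each the smallest mark that is allowed. -/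
def markFrom (all : List OPart) : List (OPart × ℕ) → List OPart → List (OPart × ℕ)
  | done, [] => done
  | done, p :: ps => markFrom all (done ++ [(p, leastMark (forbiddenMarks all done p))]) ps

/-- The Gordon marking of an overpartition: the list of its parts together with their marks. -/
def gordonMarking (l : Overpartition) : List (OPart × ℕ) := markFrom l.parts [] l.parts

/-- The number of `r`-marked parts. -/
def numMarked (l : Overpartition) (r : ℕ) : ℕ := l.gordonMarking.countP (fun pm => pm.2 = r)

end Overpartition

open Overpartition in
/-- The overpartitions counted by `D_{k,i}`: the non-overlined part `1` occurs at most `i - 1`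
times, and `d_j - d_{j+k-1} ≥ 1` if `d_j` is overlined, `d_j - d_{j+k-1} ≥ 2` otherwise. -/
def setT (k i : ℕ) : Set Overpartition :=
  {l | l.f 1 ≤ i - 1 ∧
    ∀ (j : ℕ) (a b : OPart), l.decreasing[j]? = some a → l.decreasing[j + (k - 1)]? = some b →
      b.1 + (if a.2 = true then 1 else 2) ≤ a.1}

/-- The members of `setT k i` whose smallest part, if there is a part, is overlined. -/
def setU (k i : ℕ) : Set Overpartition :=
  {l | l ∈ setT k i ∧ ∀ p : OPart, l.parts.head? = some p → p.2 = true}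

/-- The members of `setU k i` with `N r` parts of mark `r` for `1 ≤ r ≤ k - 1`, and
`N 1 + ⋯ + N (k - 1)` parts in all. -/
def setUN (k i : ℕ) (N : ℕ → ℕ) : Set Overpartition :=
  {l | l ∈ setU k i ∧ l.length = ∑ r ∈ Finset.Icc 1 (k - 1), N r ∧
    ∀ r ∈ Finset.Icc 1 (k - 1), l.numMarked r = N r}

/-- The members of `setUN k i N` all of whose `1`-marked parts are overlined. -/
def setP (k i : ℕ) (N : ℕ → ℕ) : Set Overpartition :=
  {l | l ∈ setUN k i N ∧ ∀ pm ∈ l.gordonMarking, pm.2 = 1 → pm.1.2 = true}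

/-- The members of `setP k i N` for which
`f_t + f_{t̅} + f_{t+1} = k - 1` for every positive integer `t` below the greatest
`(k-1)`-marked part, and for which, if there is a `(k-1)`-marked part, the non-overlined part `1`
occurs as often as possible, namely `min (i - 1) (k - 2)` times (the boundary case `t = 0`). -/
def setQ (k i : ℕ) (N : ℕ → ℕ) : Set Overpartition :=
  {l | l ∈ setP k i N ∧
    (∀ t : ℕ, 0 < t → (∃ pm ∈ l.gordonMarking, pm.2 = k - 1 ∧ t < pm.1.1) →
      l.f t + l.fbar t + l.f (t + 1) = k - 1) ∧
    ((∃ pm ∈ l.gordonMarking, pm.2 = k - 1) → l.f 1 = min (i - 1) (k - 2))}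

/-- The variable `x` of the ring of formal power series in `x` and `q`. -/
noncomputable def xVar : MvPowerSeries (Fin 2) ℚ := MvPowerSeries.X 0

/-- The variable `q` of the ring of formal power series in `x` and `q`. -/
noncomputable def qVar : MvPowerSeries (Fin 2) ℚ := MvPowerSeries.X 1

/-- `(q)_n = (1 - q)(1 - q²)⋯(1 - qⁿ)`. -/
noncomputable def qFactorial (n : ℕ) : MvPowerSeries (Fin 2) ℚ :=
  ∏ j ∈ Finset.Icc 1 n, (1 - qVar ^ j)

/-! Read the parts in increasing order. The mark of a part `t` depends only on the marks already
given at the sizes `t` and `t - 1`, so the marking is a left-to-right scan, and an automaton,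
`Accepts`, decides membership in `setQ k i N`. An overlined part always receives mark `1`. The
non-overlined parts `t` then receive, in increasing order, the least marks of `{2, …, k - 1}` not
blocked by the size `t - 1`; their marks form an initial segment of the complement of the blocked
set. An overlined `t` blocks one mark fewer, the least one of the size `t - 1`. Hence the equation
`f_(t-1) + f̅_(t-1) + f_t = k - 1` says that at the size `t` each of the marks `2, …, k - 1` is
blocked or used. The bound on `f_1` is simulated by fictitious parts `0` with the marks `i, …, k -
1`. All this is `mem_setQ_iff`.

Suppose first that no `(k-1)`-marked part is left. Lowering all remaining parts by one, and summing
over the contents of the next size, gives the recursion `PositionRec`. It is solved explicitly: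
`layer` builds a pair of functions one mark at a time, and induction on the number of marks gives
two short identities, `layer_fst` and `layer_snd`. In the form `genPlain_rec` and `genOver_rec` they
change the blocked set by a single mark; summed over initial segments they telescope to
`positionRec`. A coefficient argument, `counts_tailsAbove`, then shows that these functions count
the lists.

As long as `(k-1)`-marked parts are to come, the filling of each size is forced, and the only
freedom is whether a size is overlined. For every such part, each of the marks `1, …, k - 1` is used
up once, and the remaining alternatives are exactly the terms of `genPlain_rec` and `genOver_rec`.
So the count is a power of `q` times the same functions at the numbers `N r - N (k - 1)`
(`countedBy_tailsAbove`).

For the initial blocked set `{i + 1, …, k - 1}` the function is a product (`layer_fst_closed`), in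
which the squares come from `tri a + tri (a - 1) = a ^ 2`. Adding the exponents (`exponent_eq`)
gives the formula. -/

namespace GordonMarking

open Finset

/-! ### Triangular numbers and removal of a least element. -/

/-- The triangular number `n (n + 1) / 2`, for an integer `n`. -/
def tri (n : ℤ) : ℤ := n * (n + 1) / 2

lemma two_mul_tri (n : ℤ) : 2 * tri n = n * (n + 1) :=
  Int.mul_ediv_cancel' (Int.even_mul_succ_self n).two_dvd

lemma tri_sub_one (n : ℤ) : tri (n - 1) = tri n - n := by
  have h1 := two_mul_tri n
  have h2 := two_mul_tri (n - 1)
  have : 2 * tri (n - 1) = 2 * (tri n - n) := by rw [mul_sub, h1, h2]; ring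
  omega

lemma tri_add_one (n : ℤ) : tri (n + 1) = tri n + n + 1 := by
  have := tri_sub_one (n + 1)
  rw [add_sub_cancel_right] at this
  omega

lemma tri_zero : tri 0 = 0 := rfl

lemma tri_nonneg (n : ℤ) : 0 ≤ tri n := by
  have h1 := two_mul_tri n
  have : 0 ≤ n * (n + 1) := by
    rcases le_or_gt 0 n with h | h
    · positivity
    · nlinarith
  omega

lemma tri_natCast (n : ℕ) : tri n = ((n * (n + 1) / 2 : ℕ) : ℤ) := by
  simp [tri]

/-- `T` without its least element. -/
def eraseMin (T : Finset ℕ) : Finset ℕ := if h : T.Nonempty then T.erase (T.min' h) else ∅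

@[simp] lemma eraseMin_empty : eraseMin ∅ = ∅ := by simp [eraseMin]

lemma eraseMin_subset (T : Finset ℕ) : eraseMin T ⊆ T := by
  unfold eraseMin; split_ifs
  · exact erase_subset _ _
  · simp

lemma eraseMin_eq {T : Finset ℕ} {u : ℕ} (hu : u ∈ T) (h : ∀ x ∈ T, u ≤ x) :
    eraseMin T = T.erase u := by
  have hT : T.Nonempty := ⟨u, hu⟩
  have : T.min' hT = u := le_antisymm (min'_le _ _ hu) (le_min' _ _ _ h)
  simp [eraseMin, hT, this]

lemma eraseMin_insert {T : Finset ℕ} {u : ℕ} (h : ∀ x ∈ T, u < x) :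
    eraseMin (insert u T) = T := by
  rw [eraseMin_eq (mem_insert_self _ _)]
  · exact erase_insert fun hu => lt_irrefl _ (h u hu)
  · intro x hx
    rcases mem_insert.1 hx with rfl | hx
    · exact le_rfl
    · exact (h x hx).le

lemma exists_eraseMin {T : Finset ℕ} (hT : T.Nonempty) :
    ∃ u ∈ T, (∀ x ∈ T, u ≤ x) ∧ eraseMin T = T.erase u :=
  ⟨T.min' hT, T.min'_mem hT, fun _ hx => T.min'_le _ hx, by simp [eraseMin, hT]⟩

/-! ### Generating functions built mark by mark. -/

section Field

variable {K : Type*} [Field K] (q : K)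

/-- `1 / (q)_D`, with the value `0` for `D < 0`. -/
noncomputable def invQ (D : ℤ) : K :=
  if 0 ≤ D then (∏ j ∈ range D.toNat, (1 - q ^ (j + 1)))⁻¹ else 0

lemma invQ_neg {D : ℤ} (h : D < 0) : invQ q D = 0 := by simp [invQ, not_le.2 h]

lemma invQ_zero : invQ q 0 = 1 := by simp [invQ]

/-- The value `0` at negative arguments makes this hold for every integer: at `D = 0` the factor `1
- q ^ 0` vanishes. The recursions below therefore need no boundary cases. -/
lemma invQ_sub_one (hq : ∀ n : ℕ, 0 < n → q ^ n ≠ 1) (D : ℤ) :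
    invQ q (D - 1) = (1 - q ^ D) * invQ q D := by
  rcases lt_trichotomy D 0 with h | rfl | h
  · rw [invQ_neg q h, invQ_neg q (by omega), mul_zero]
  · rw [invQ_neg q (by omega)]; simp
  · obtain ⟨n, rfl⟩ : ∃ n : ℕ, D = (n + 1 : ℕ) := ⟨(D - 1).toNat, by omega⟩
    have h1 : ((n + 1 : ℕ) : ℤ) - 1 = (n : ℤ) := by push_cast; ring
    rw [h1, invQ, invQ, if_pos (by omega), if_pos (by omega), Int.toNat_natCast,
      Int.toNat_natCast, prod_range_succ, mul_inv, zpow_natCast]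
    have : (1 - q ^ (n + 1)) ≠ 0 := sub_ne_zero.2 (hq _ (by omega)).symm
    field_simp

/-- The generating functions of the layered description of overpartitions, as a pair: the first
component for a path that may go down, the second one for a path that has to go up next.
The first number is `N m`, and the marks are those in `(m, m + d]`. -/
noncomputable def layer : ℕ → ℕ → Finset ℕ → (ℕ → ℤ) → K × K
  | 0, m, _, N => (q ^ tri (N m) * invQ q (N m), (1 - q ^ N m) * (q ^ tri (N m) * invQ q (N m)))
  | d + 1, m, U, N =>
    let c := q ^ (tri (N m) + tri (N (m + 1) - 1))
    let D := N m - N (m + 1)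
    if m + 1 ∈ U then
      let y := c * q⁻¹ * invQ q (D - 1) * (layer d (m + 1) U (N + Pi.single (m + 1) 1)).2
      (y + q ^ N m * c * invQ q D * (layer d (m + 1) U N).1, y)
    else
      (c * invQ q D * (layer d (m + 1) U N).1,
        c * (invQ q (D - 1) * (layer d (m + 1) U N).1
          + q ^ D * invQ q D * (layer d (m + 1) U N).2))

/-- The least mark in `(m, m + d]` that is not in `U`. -/
def leastFree : ℕ → ℕ → Finset ℕ → Option ℕ
  | 0, _, _ => none
  | d + 1, m, U => if m + 1 ∈ U then leastFree d (m + 1) U else some (m + 1)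

/-- `U` without its least element in `(m, m + d]`. -/
def dropLeast : ℕ → ℕ → Finset ℕ → Finset ℕ
  | 0, _, U => U
  | d + 1, m, U => if m + 1 ∈ U then U.erase (m + 1) else dropLeast d (m + 1) U

lemma leastFree_mem {d m : ℕ} {U : Finset ℕ} {r : ℕ} (h : leastFree d m U = some r) :
    r ∉ U ∧ m < r ∧ r ≤ m + d ∧ ∀ x, m < x → x < r → x ∈ U := by
  induction d generalizing m with
  | zero => simp [leastFree] at h
  | succ d ih =>
    rw [leastFree] at h
    split_ifs at h with hm
    · obtain ⟨h1, h2, h3, h4⟩ := ih h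
      refine ⟨h1, by omega, by omega, fun x hx hxr => ?_⟩
      rcases Nat.lt_or_ge (m + 1) x with h5 | h5
      · exact h4 x h5 hxr
      · obtain rfl : x = m + 1 := by omega
        exact hm
    · obtain rfl : m + 1 = r := by simpa using h
      exact ⟨hm, by omega, by omega, fun x hx hxr => by omega⟩

lemma leastFree_eq_some {d m : ℕ} {U : Finset ℕ} {r : ℕ} (h1 : r ∉ U) (h2 : m < r)
    (h3 : r ≤ m + d) (h4 : ∀ x, m < x → x < r → x ∈ U) : leastFree d m U = some r := by
  induction d generalizing m with
  | zero => omega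
  | succ d ih =>
    rw [leastFree]
    split_ifs with hm
    · have : r ≠ m + 1 := fun h => h1 (h ▸ hm)
      exact ih (by omega) (by omega) fun x hx => h4 x (by omega)
    · by_contra hne
      exact hm (h4 _ (by omega) (by have : r ≠ m + 1 := fun h => hne (by rw [h])
                                    omega))

lemma leastFree_eq_none {d m : ℕ} {U : Finset ℕ} (h : ∀ x, m < x → x ≤ m + d → x ∈ U) :
    leastFree d m U = none := by
  induction d generalizing m with
  | zero => rfl
  | succ d ih =>
    rw [leastFree, if_pos (h _ (by omega) (by omega))]
    exact ih fun x hx hx' => h x (by omega) (by omega)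

lemma dropLeast_eq_erase {d m : ℕ} {U : Finset ℕ} {u : ℕ} (h1 : u ∈ U) (h2 : m < u)
    (h3 : u ≤ m + d) (h4 : ∀ x, m < x → x < u → x ∉ U) : dropLeast d m U = U.erase u := by
  induction d generalizing m with
  | zero => omega
  | succ d ih =>
    rw [dropLeast]
    split_ifs with hm
    · obtain rfl : u = m + 1 := by
        by_contra hne
        exact h4 _ (by omega) (by omega) hm
      rfl
    · have : u ≠ m + 1 := fun h => hm (h ▸ h1)
      exact ih (by omega) (by omega) fun x hx => h4 x (by omega)

lemma dropLeast_eq_self {d m : ℕ} {U : Finset ℕ} (h : ∀ x, m < x → x ≤ m + d → x ∉ U) :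
    dropLeast d m U = U := by
  induction d generalizing m with
  | zero => rfl
  | succ d ih =>
    rw [dropLeast, if_neg (h _ (by omega) (by omega))]
    exact ih fun x hx hx' => h x (by omega) (by omega)

lemma notMem_dropLeast {d m x : ℕ} {U : Finset ℕ} (h : x ∉ U) : x ∉ dropLeast d m U := by
  induction d generalizing m with
  | zero => exact h
  | succ d ih =>
    rw [dropLeast]
    split_ifs
    · exact fun hx => h (mem_of_mem_erase hx)
    · exact ih

lemma layer_congr {d m : ℕ} {U U' : Finset ℕ} {N N' : ℕ → ℤ}
    (hU : ∀ x, m < x → x ≤ m + d → (x ∈ U ↔ x ∈ U'))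
    (hN : ∀ x, m ≤ x → x ≤ m + d → N x = N' x) : layer q d m U N = layer q d m U' N' := by
  induction d generalizing m N N' with
  | zero => simp [layer, hN m le_rfl le_rfl]
  | succ d ih =>
    have e1 : layer q d (m + 1) U N = layer q d (m + 1) U' N' :=
      ih (fun x h1 h2 => hU x (by omega) (by omega)) (fun x h1 h2 => hN x (by omega) (by omega))
    have e2 : layer q d (m + 1) U (N + Pi.single (m + 1) 1)
        = layer q d (m + 1) U' (N' + Pi.single (m + 1) 1) :=
      ih (fun x h1 h2 => hU x (by omega) (by omega))
        (fun x h1 h2 => by simp [hN x (by omega) (by omega)])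
    simp only [layer, e1, e2, hN m le_rfl (by omega), hN (m + 1) (by omega) (by omega),
      hU (m + 1) (by omega) (by omega)]

/-- Induction on the number of marks. If `m + 1` is blocked, the definition of the first component
is already of this form. If it is free, the identity is carried over from the next layer, with
`invQ_sub_one` bringing everything over the same denominator. -/
lemma layer_fst (hq0 : q ≠ 0) (hq : ∀ n : ℕ, 0 < n → q ^ n ≠ 1) (d m : ℕ) (U : Finset ℕ)
    (N : ℕ → ℤ) : (layer q d m U N).1
      = (layer q d m U N).2 + q ^ N m * (layer q d m (dropLeast d m U) N).1 := by
  induction d generalizing m N with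
  | zero => simp only [layer]; ring
  | succ d ih =>
    by_cases hm : m + 1 ∈ U
    · have hc : layer q d (m + 1) (U.erase (m + 1)) N = layer q d (m + 1) U N :=
        layer_congr q (fun x h1 h2 => by simp; omega) fun _ _ _ => rfl
      simp only [layer, dropLeast, if_pos hm, notMem_erase, if_false, hc]
      ring
    · have hm' : m + 1 ∉ dropLeast d (m + 1) U := notMem_dropLeast hm
      have h1 := ih (m + 1) N
      have h2 : q ^ N m = q ^ (N m - N (m + 1)) * q ^ N (m + 1) := by
        rw [← zpow_add₀ hq0]; congr 1; ring
      simp only [layer, dropLeast, if_neg hm, if_neg hm', invQ_sub_one q hq]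
      rw [h2]
      generalize q ^ (N m - N (m + 1)) = z at *
      linear_combination
        q ^ (tri (N m) + tri (N (m + 1) - 1)) * invQ q (N m - N (m + 1)) * z * h1

/-- If `m + 1` is free, it is the least free mark and both terms are visible in the definition. If
it is blocked, the least free mark lies further on, and the induction hypothesis is applied at `N +
Pi.single (m + 1) 1`, the argument that occurs in the definition. -/
lemma layer_snd (hq0 : q ≠ 0) (hq : ∀ n : ℕ, 0 < n → q ^ n ≠ 1) (d m : ℕ) (U : Finset ℕ)
    (N : ℕ → ℤ) : (layer q d m U N).2
      = q ^ N m * ((layer q d m U (N - Pi.single m 1)).1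
        + (leastFree d m U).elim 0 fun r => (layer q d m (insert r U) (N - Pi.single r 1)).2) := by
  induction d generalizing m N with
  | zero =>
    simp only [layer, leastFree, Option.elim, Pi.sub_apply, Pi.single_eq_same, tri_sub_one,
      invQ_sub_one q hq, zpow_sub₀ hq0]
    field_simp
    ring
  | succ d ih =>
    have hX : (layer q d (m + 1) U (N - Pi.single m 1)) = layer q d (m + 1) U N :=
      layer_congr q (fun _ _ _ => Iff.rfl) fun x h1 h2 => by
        simp [Pi.single_eq_of_ne (show x ≠ m by omega)]
    by_cases hm : m + 1 ∈ U
    · have hX2 : (layer q d (m + 1) U (N - Pi.single m 1 + Pi.single (m + 1) 1))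
          = layer q d (m + 1) U (N + Pi.single (m + 1) 1) :=
        layer_congr q (fun _ _ _ => Iff.rfl) fun x h1 h2 => by
          simp [Pi.single_eq_of_ne (show x ≠ m by omega)]
      have h1 := ih (m + 1) (N + Pi.single (m + 1) 1)
      rw [add_sub_cancel_right] at h1
      -- The least free mark exceeds `m + 1`, so inserting it changes neither the case of the
      -- definition nor the prefactor, which depends on `N m` and `N (m + 1)` only.
      have h2 : ((leastFree (d + 1) m U).elim 0 fun r =>
            (layer q (d + 1) m (insert r U) (N - Pi.single r 1)).2)
          = q ^ (tri (N m) + tri (N (m + 1) - 1)) * q⁻¹ * invQ q (N m - N (m + 1) - 1)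
            * ((leastFree d (m + 1) U).elim 0 fun r => (layer q d (m + 1) (insert r U)
              (N + Pi.single (m + 1) 1 - Pi.single r 1)).2) := by
        rw [leastFree, if_pos hm]
        cases hr : leastFree d (m + 1) U with
        | none => simp
        | some r =>
          obtain ⟨_, h4, _, _⟩ := leastFree_mem hr
          have e1 : (Pi.single r 1 : ℕ → ℤ) m = 0 := Pi.single_eq_of_ne (by omega) _
          have e2 : (Pi.single r 1 : ℕ → ℤ) (m + 1) = 0 := Pi.single_eq_of_ne (by omega) _
          simp only [Option.elim, layer, mem_insert, hm, or_true, if_true, Pi.sub_apply, e1, e2,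
            sub_zero]
          rw [show N - Pi.single r 1 + Pi.single (m + 1) 1
            = N + Pi.single (m + 1) 1 - Pi.single r 1 by abel]
      rw [h2]
      have e1 : (Pi.single m 1 : ℕ → ℤ) (m + 1) = 0 := Pi.single_eq_of_ne (by omega) _
      simp only [layer, if_pos hm, hX, hX2, Pi.sub_apply, Pi.single_eq_same, e1, sub_zero,
        tri_sub_one]
      generalize ((leastFree d (m + 1) U).elim 0 fun r => (layer q d (m + 1) (insert r U)
              (N + Pi.single (m + 1) 1 - Pi.single r 1)).2) = W at *
      simp only [Pi.add_apply, Pi.single_eq_same] at h1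
      rw [show N m - 1 - N (m + 1) - 1 = N m - N (m + 1) - 1 - 1 by ring,
        show N m - 1 - N (m + 1) = N m - N (m + 1) - 1 by ring]
      rw [invQ_sub_one q hq (N m - N (m + 1) - 1)]
      set Y := (layer q d (m + 1) U (N + Pi.single (m + 1) 1)).2
      set X := (layer q d (m + 1) U N).1
      rw [zpow_add₀ hq0, zpow_one] at h1
      have z1 : q ^ (tri (N m) + (tri (N (m + 1)) - N (m + 1)))
        = q ^ (tri (N m) - N m + (tri (N (m + 1)) - N (m + 1))) * q ^ N m := by
        rw [← zpow_add₀ hq0]; congr 1; ring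
      have z2 : q ^ N m = q ^ (N m - N (m + 1) - 1) * (q ^ N (m + 1) * q) := by
        rw [← zpow_add_one₀ hq0, ← zpow_add₀ hq0]; congr 1; ring
      have z3 : q ^ (N m - 1) * q = q ^ N m := by
        rw [← zpow_add_one₀ hq0]; congr 1; ring
      rw [z1]
      have z4 : q ^ (N m - 1) = q ^ N m * q⁻¹ := by rw [← z3]; field_simp
      rw [z4]
      generalize q ^ (tri (N m) - N m + (tri (N (m + 1)) - N (m + 1))) = c at *
      generalize invQ q (N m - N (m + 1) - 1) = p at *
      generalize q ^ (N m - N (m + 1) - 1) = z at *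
      rw [z2]
      linear_combination c * p * z * z * (q ^ N (m + 1) * q) * q⁻¹  * h1
    · have e1 : (Pi.single m 1 : ℕ → ℤ) (m + 1) = 0 := Pi.single_eq_of_ne (by omega) _
      have e2 : (Pi.single (m + 1) 1 : ℕ → ℤ) m = 0 := Pi.single_eq_of_ne (by omega) _
      have hc : layer q d (m + 1) (insert (m + 1) U) N = layer q d (m + 1) U N :=
        layer_congr q (fun x h1 h2 => by simp; omega) fun _ _ _ => rfl
      simp only [layer, leastFree, if_neg hm, Option.elim, mem_insert, true_or, if_true, hX,
        Pi.sub_apply, Pi.single_eq_same, e1, e2, sub_zero, tri_sub_one, sub_add_cancel, hc]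
      rw [show N m - 1 - N (m + 1) = N m - N (m + 1) - 1 by ring,
        show N m - (N (m + 1) - 1) - 1 = N m - N (m + 1) by ring]
      have z1 : q ^ (tri (N m) + (tri (N (m + 1)) - N (m + 1)))
        = q ^ (tri (N m) - N m + (tri (N (m + 1)) - N (m + 1))) * q ^ N m := by
        rw [← zpow_add₀ hq0]; congr 1; ring
      have z2 : q ^ (tri (N m) + (tri (N (m + 1)) - N (m + 1) - (N (m + 1) - 1)))
        = q ^ (tri (N m) - N m + (tri (N (m + 1)) - N (m + 1)))
          * (q ^ (N m - N (m + 1)) * q) := by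
        rw [← zpow_add_one₀ hq0, ← zpow_add₀ hq0]; congr 1; ring
      rw [z1, z2]
      field_simp

end Field

/-! ### Vanishing and closed forms of the layers. -/

section Field

variable {K : Type*} [Field K] (q : K)

/-- Either some `invQ` has a negative argument or the next layer vanishes. This lets the recursions
subtract a part without first checking that one is left. -/
lemma layer_vanish (d m : ℕ) (U : Finset ℕ) (N : ℕ → ℤ) :
    (N m ≤ 0 → (layer q d m U N).2 = 0) ∧
      ∀ r, m ≤ r → r ≤ m + d → N r < 0 → layer q d m U N = 0 := by
  induction d generalizing m N with
  | zero =>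
    have h : N m ≤ 0 → (layer q 0 m U N).2 = 0 := by
      intro h
      rcases h.lt_or_eq with h | h
      · simp [layer, invQ_neg q h]
      · simp [layer, h]
    refine ⟨h, fun r h1 h2 h3 => ?_⟩
    obtain rfl : r = m := by omega
    exact Prod.ext (by simp [layer, invQ_neg q h3]) (h h3.le)
  | succ d ih =>
    obtain ⟨ih1, ih2⟩ := ih (m + 1) N
    obtain ⟨ih3, ih4⟩ := ih (m + 1) (N + Pi.single (m + 1) 1)
    simp only [Pi.add_apply, Pi.single_eq_same] at ih3
    have hY : N m ≤ 0 → (layer q (d + 1) m U N).2 = 0 := by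
      intro h
      by_cases hm : m + 1 ∈ U
      · rcases lt_or_ge (N m - N (m + 1) - 1) 0 with h1 | h1
        · simp [layer, hm, invQ_neg q h1]
        · simp [layer, hm, ih3 (by omega)]
      · rcases lt_or_ge (N m - N (m + 1) - 1) 0 with h1 | h1
        · rcases lt_or_ge (N m - N (m + 1)) 0 with h2 | h2
          · simp [layer, hm, invQ_neg q h1, invQ_neg q h2]
          · simp [layer, hm, invQ_neg q h1, ih1 (by omega)]
        · simp [layer, hm, ih2 (m + 1) le_rfl (by omega) (by omega)]
    refine ⟨hY, fun r h1 h2 h3 => ?_⟩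
    rcases h1.eq_or_lt with rfl | h1
    · refine Prod.ext ?_ (hY h3.le)
      have hY' := hY h3.le
      by_cases hm : m + 1 ∈ U
      · simp only [layer, hm, if_true] at hY' ⊢
        rw [hY', zero_add]
        rcases lt_or_ge (N m - N (m + 1)) 0 with h2 | h2
        · simp [invQ_neg q h2]
        · simp [ih2 (m + 1) le_rfl (by omega) (by omega)]
      · simp only [layer, hm, if_false]
        rcases lt_or_ge (N m - N (m + 1)) 0 with h2 | h2
        · simp [invQ_neg q h2]
        · simp [ih2 (m + 1) le_rfl (by omega) (by omega)]
    · have h5 := ih2 r h1 (by omega) h3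
      have h6 : (layer q d (m + 1) U (N + Pi.single (m + 1) 1)).2 = 0 := by
        rcases eq_or_lt_of_le (show m + 1 ≤ r from h1) with rfl | h1
        · exact ih3 (by omega)
        · rw [ih4 r (by omega) (by omega) (by
            simpa [Pi.single_eq_of_ne (show r ≠ m + 1 by omega)] using h3)]
          rfl
      by_cases hm : m + 1 ∈ U
      · ext <;> simp [layer, hm, h5, h6]
      · ext <;> simp [layer, hm, h5]

/-- With nothing blocked, the factors `invQ` force `N m ≥ N (m + 1) ≥ ⋯`, so a sequence starting at
or below `0` contributes only if it is identically `0`. -/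
lemma layer_fst_eq_zero {d m : ℕ} {U : Finset ℕ} {N : ℕ → ℤ} (hm : N m ≤ 0)
    (hU : ∀ x, m < x → x ≤ m + d → x ∉ U) {r : ℕ} (h1 : m ≤ r) (h2 : r ≤ m + d) (hr : N r ≠ 0) :
    (layer q d m U N).1 = 0 := by
  induction d generalizing m with
  | zero =>
    obtain rfl : r = m := by omega
    rw [(layer_vanish q 0 r U N).2 r le_rfl le_rfl (by omega)]; rfl
  | succ d ih =>
    rcases h1.eq_or_lt with rfl | h1
    · rw [(layer_vanish q (d + 1) m U N).2 m le_rfl (by omega) (by omega)]; rfl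
    · simp only [layer, hU (m + 1) (by omega) (by omega), if_false]
      rcases lt_or_ge (N m - N (m + 1)) 0 with h2 | h2
      · simp [invQ_neg q h2]
      · rw [ih (by omega) (fun x h1 h2 => hU x (by omega) (by omega)) (by omega) (by omega),
          mul_zero]

/-- No mark is free, so `layer_snd` has a single term and turns the second component into a first
component. In the definition the terms with `q ^ N m` then cancel, leaving the factor `q ^ N (m +
1)` for the mark `m + 1`. -/
lemma layer_fst_full (hq0 : q ≠ 0) (hq : ∀ n : ℕ, 0 < n → q ^ n ≠ 1) {d m : ℕ} {U : Finset ℕ}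
    (hU : ∀ x, m < x → x ≤ m + d → x ∈ U) (N : ℕ → ℤ) :
    (layer q d m U N).1 = q ^ (∑ r ∈ Ioc m (m + d), N r) * (layer q d m ∅ N).1 := by
  induction d generalizing m with
  | zero => simp [layer]
  | succ d ih =>
    have hU' : ∀ x, m + 1 < x → x ≤ m + 1 + d → x ∈ U :=
      fun x h1 h2 => hU x (by omega) (by omega)
    have h1 := ih hU'
    have h2 := layer_snd q hq0 hq d (m + 1) U (N + Pi.single (m + 1) 1)
    rw [leastFree_eq_none hU', add_sub_cancel_right] at h2
    simp only [Pi.add_apply, Pi.single_eq_same, Option.elim, add_zero] at h2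
    have h3 : ∑ r ∈ Ioc m (m + (d + 1)), N r = N (m + 1) + ∑ r ∈ Ioc (m + 1) (m + 1 + d), N r := by
      have : Ioc m (m + (d + 1)) = insert (m + 1) (Ioc (m + 1) (m + 1 + d)) := by
        ext x; simp; omega
      rw [this, sum_insert (by simp)]
    simp only [layer, hU (m + 1) (by omega) (by omega), if_true, notMem_empty, if_false, h2, h1, h3,
      zpow_add₀ hq0, invQ_sub_one q hq, zpow_one]
    have h4 : q ^ N m = q ^ (N m - N (m + 1)) * q ^ N (m + 1) := by
      rw [← zpow_add₀ hq0]; congr 1; ring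
    rw [h4]
    field_simp
    ring

/-- Only first components occur in the definition, which thus multiplies out; `tri a + tri (a - 1) =
a ^ 2` produces the squares. -/
lemma layer_fst_closed_empty (hq0 : q ≠ 0) (d m : ℕ) (N : ℕ → ℤ) :
    (layer q d m ∅ N).1 = q ^ (tri (N m) + ∑ r ∈ Ioc m (m + d), N r ^ 2)
      * ((∏ r ∈ Ico m (m + d), invQ q (N r - N (r + 1))) * invQ q (N (m + d))) := by
  induction d generalizing m with
  | zero => simp [layer]
  | succ d ih =>
    have h3 : Ioc m (m + (d + 1)) = insert (m + 1) (Ioc (m + 1) (m + 1 + d)) := by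
      ext x; simp; omega
    have h4 : Ico m (m + (d + 1)) = insert m (Ico (m + 1) (m + 1 + d)) := by
      ext x; simp; omega
    rw [h3, h4, sum_insert (by simp), prod_insert (by simp)]
    simp only [layer, notMem_empty, if_false, ih]
    rw [show m + 1 + d = m + (d + 1) by omega]
    have h5 : q ^ (tri (N m) + (N (m + 1) ^ 2 + ∑ r ∈ Ioc (m + 1) (m + (d + 1)), N r ^ 2))
        = q ^ (tri (N m) + tri (N (m + 1) - 1))
          * q ^ (tri (N (m + 1)) + ∑ r ∈ Ioc (m + 1) (m + (d + 1)), N r ^ 2) := by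
      rw [← zpow_add₀ hq0]
      congr 1
      have := two_mul_tri (N (m + 1))
      rw [tri_sub_one]
      linear_combination -this
    rw [h5]
    ring

/-- Free marks up to `i` are split off one at a time; beyond `i` all marks are blocked, and
`layer_fst_full` supplies the linear terms of the exponent. -/
lemma layer_fst_closed (hq0 : q ≠ 0) (hq : ∀ n : ℕ, 0 < n → q ^ n ≠ 1) {d m : ℕ} {i : ℕ}
    {U : Finset ℕ} (hU : ∀ x, m < x → x ≤ m + d → (x ∈ U ↔ i < x)) (N : ℕ → ℤ) :
    (layer q d m U N).1
      = q ^ (tri (N m) + ∑ r ∈ Ioc m (m + d), N r ^ 2 + ∑ r ∈ Ioc m (m + d) with i < r, N r)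
      * ((∏ r ∈ Ico m (m + d), invQ q (N r - N (r + 1))) * invQ q (N (m + d))) := by
  rcases le_or_gt i m with him | him
  · rw [layer_fst_full q hq0 hq (fun x h1 h2 => (hU x h1 h2).2 (by omega)),
      layer_fst_closed_empty q hq0, filter_true_of_mem (fun x hx => by simp at hx; omega),
      zpow_add₀ hq0 (_ + _)]
    ring
  · induction d generalizing m with
    | zero => simp [layer]
    | succ d ih =>
      have h3 : Ioc m (m + (d + 1)) = insert (m + 1) (Ioc (m + 1) (m + 1 + d)) := by
        ext x; simp; omega
      have h4 : Ico m (m + (d + 1)) = insert m (Ico (m + 1) (m + 1 + d)) := by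
        ext x; simp; omega
      have hm : m + 1 ∉ U := by rw [hU _ (by omega) (by omega)]; omega
      have h6 : (layer q d (m + 1) U N).1
        = q ^ (tri (N (m + 1)) + ∑ r ∈ Ioc (m + 1) (m + (d + 1)), N r ^ 2
            + ∑ r ∈ Ioc (m + 1) (m + (d + 1)) with i < r, N r)
          * ((∏ r ∈ Ico (m + 1) (m + (d + 1)), invQ q (N r - N (r + 1)))
            * invQ q (N (m + (d + 1)))) := by
        have hU' : ∀ x, m + 1 < x → x ≤ m + 1 + d → (x ∈ U ↔ i < x) :=
          fun x h1 h2 => hU x (by omega) (by omega)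
        rw [show m + (d + 1) = m + 1 + d by omega]
        rcases le_or_gt i (m + 1) with h | h
        · rw [layer_fst_full q hq0 hq (fun x h1 h2 => (hU' x h1 h2).2 (by omega)),
            layer_fst_closed_empty q hq0, filter_true_of_mem (fun x hx => by simp at hx; omega),
            zpow_add₀ hq0 (_ + _)]
          ring
        · exact ih hU' h
      rw [h3, h4, filter_insert, if_neg (by omega), sum_insert (by simp), prod_insert (by simp)]
      simp only [layer, hm, if_false, h6]
      rw [show m + 1 + d = m + (d + 1) by omega]
      have h5 : q ^ (tri (N m) + (N (m + 1) ^ 2 + ∑ r ∈ Ioc (m + 1) (m + (d + 1)), N r ^ 2)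
            + ∑ r ∈ Ioc (m + 1) (m + (d + 1)) with i < r, N r)
          = q ^ (tri (N m) + tri (N (m + 1) - 1))
            * q ^ (tri (N (m + 1)) + ∑ r ∈ Ioc (m + 1) (m + (d + 1)), N r ^ 2
              + ∑ r ∈ Ioc (m + 1) (m + (d + 1)) with i < r, N r) := by
        rw [← zpow_add₀ hq0]
        congr 1
        have := two_mul_tri (N (m + 1))
        rw [tri_sub_one]
        linear_combination -this
      rw [h5]
      ring

/-! ### The two generating functions and their one-mark recursions. -/

/-- The generating function after a position without overlined part, if `U` is the set of marks
that are then forbidden.  The marks are those up to `d + 1`. -/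
noncomputable def genPlain (d : ℕ) (U : Finset ℕ) (N : ℕ → ℤ) : K := (layer q d 1 U N).1

/-- The generating function after a position with an overlined part and non-overlined parts with
the set `U` of marks.  The marks are those up to `d + 1`. -/
noncomputable def genOver (d : ℕ) (U : Finset ℕ) (N : ℕ → ℤ) : K :=
  q ^ (-N 1 - 1) * (layer q d 1 U (N + Pi.single 1 1)).2

variable {q}

lemma genPlain_congr {d : ℕ} {U U' : Finset ℕ} {N N' : ℕ → ℤ}
    (hU : ∀ x, 2 ≤ x → x ≤ d + 1 → (x ∈ U ↔ x ∈ U'))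
    (hN : ∀ x, 1 ≤ x → x ≤ d + 1 → N x = N' x) : genPlain q d U N = genPlain q d U' N' := by
  rw [genPlain, genPlain, layer_congr q (fun x h1 h2 => hU x (by omega) (by omega))
    (fun x h1 h2 => hN x h1 (by omega))]

lemma genOver_congr {d : ℕ} {U U' : Finset ℕ} {N N' : ℕ → ℤ}
    (hU : ∀ x, 2 ≤ x → x ≤ d + 1 → (x ∈ U ↔ x ∈ U'))
    (hN : ∀ x, 1 ≤ x → x ≤ d + 1 → N x = N' x) : genOver q d U N = genOver q d U' N' := by
  rw [genOver, genOver, hN 1 le_rfl (by omega),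
    layer_congr q (fun x h1 h2 => hU x (by omega) (by omega))
      (N' := N' + Pi.single 1 1) (fun x h1 h2 => by simp [hN x h1 (by omega)])]

lemma genPlain_vanish {d : ℕ} {U : Finset ℕ} {N : ℕ → ℤ} {r : ℕ} (h1 : 1 ≤ r) (h2 : r ≤ d + 1)
    (h : N r < 0) : genPlain q d U N = 0 := by
  rw [genPlain, (layer_vanish q d 1 U N).2 r h1 (by omega) h]; rfl

lemma genOver_vanish {d : ℕ} {U : Finset ℕ} {N : ℕ → ℤ} {r : ℕ} (h1 : 1 ≤ r) (h2 : r ≤ d + 1)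
    (h : N r < 0) : genOver q d U N = 0 := by
  have h3 := layer_vanish q d 1 U (N + Pi.single 1 1)
  rcases h1.eq_or_lt with rfl | h1
  · rw [genOver, h3.1 (by simp; omega), mul_zero]
  · rw [genOver, h3.2 r h1.le (by omega)
      (by simpa [Pi.single_eq_of_ne (show r ≠ 1 by omega)] using h)]
    simp

/-- This is `layer_fst` at the mark `1`; the factor `q ^ (-N 1 - 1)` and the shift by `Pi.single 1
1` in `genOver` are chosen so that both terms carry the same power of `q`. -/
lemma genPlain_rec (hq0 : q ≠ 0) (hq : ∀ n : ℕ, 0 < n → q ^ n ≠ 1) {d : ℕ} {U : Finset ℕ}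
    (hU : ∀ x ∈ U, 2 ≤ x ∧ x ≤ d + 1) (N : ℕ → ℤ) :
    genPlain q d U N
      = q ^ N 1 * (genOver q d U (N - Pi.single 1 1) + genPlain q d (eraseMin U) N) := by
  have h1 : dropLeast d 1 U = eraseMin U := by
    rcases U.eq_empty_or_nonempty with rfl | hne
    · rw [eraseMin_empty]; exact dropLeast_eq_self (by simp)
    · obtain ⟨u, hu, hmin, he⟩ := exists_eraseMin hne
      rw [he]
      refine dropLeast_eq_erase hu (hU u hu).1 (by have := (hU u hu).2; omega) ?_
      intro x _ h hx
      exact absurd (hmin x hx) (by omega)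
  rw [genPlain, layer_fst q hq0 hq, h1, genOver, sub_add_cancel, mul_add, ← mul_assoc,
    ← zpow_add₀ hq0, genPlain]
  simp

lemma genOver_full (hq0 : q ≠ 0) (hq : ∀ n : ℕ, 0 < n → q ^ n ≠ 1) {d : ℕ} {U : Finset ℕ}
    (hU : ∀ x, 2 ≤ x → x ≤ d + 1 → x ∈ U) (N : ℕ → ℤ) : genOver q d U N = genPlain q d U N := by
  rw [genOver, layer_snd q hq0 hq, leastFree_eq_none (fun x h1 h2 => hU x h1 (by omega)),
    add_sub_cancel_right, ← mul_assoc, ← zpow_add₀ hq0, genPlain]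
  simp

lemma genOver_rec (hq0 : q ≠ 0) (hq : ∀ n : ℕ, 0 < n → q ^ n ≠ 1) {d : ℕ} {U : Finset ℕ} {r : ℕ}
    (hr : r ∉ U) (h1 : 2 ≤ r) (h2 : r ≤ d + 1) (h : ∀ x, 2 ≤ x → x < r → x ∈ U) (N : ℕ → ℤ) :
    genOver q d U N = genPlain q d U N
      + q ^ (N 1 + 1) * genOver q d (insert r U) (N - Pi.single r 1) := by
  have e1 : (Pi.single r 1 : ℕ → ℤ) 1 = 0 := Pi.single_eq_of_ne (by omega) _
  rw [genOver, layer_snd q hq0 hq, leastFree_eq_some hr h1 (by omega) (fun x h1 h2 => h x h1 h2),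
    add_sub_cancel_right, ← mul_assoc, ← zpow_add₀ hq0, genPlain, genOver, ← mul_assoc,
    ← zpow_add₀ hq0,
    show N - Pi.single r 1 + Pi.single 1 1 = N + Pi.single 1 1 - Pi.single r 1 by abel]
  simp [e1]

lemma genPlain_full (hq0 : q ≠ 0) (hq : ∀ n : ℕ, 0 < n → q ^ n ≠ 1) {d : ℕ} {U : Finset ℕ}
    (hU : ∀ x, 2 ≤ x → x ≤ d + 1 → x ∈ U) (N : ℕ → ℤ) :
    genPlain q d U N = q ^ (∑ r ∈ Icc 2 (d + 1), N r) * genPlain q d ∅ N := by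
  rw [genPlain, layer_fst_full q hq0 hq (fun x h1 h2 => hU x h1 (by omega)), genPlain,
    show Ioc 1 (1 + d) = Icc 2 (d + 1) by ext; simp; omega]

lemma genPlain_empty_eq_zero {d : ℕ} {N : ℕ → ℤ} (h1 : N 1 ≤ 0) {r : ℕ} (hr1 : 1 ≤ r)
    (hr2 : r ≤ d + 1) (hr : N r ≠ 0) : genPlain q d ∅ N = 0 :=
  layer_fst_eq_zero q h1 (by simp) hr1 (by omega) hr

/-! ### Sums over initial segments of the free marks. -/

/-- The sum of `g T (N - 1_T)` over the initial segments `T` of the complement of `U`, where the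
choices for the marks less than `r` have been made, and `d` marks are still to be considered. -/
def initSum (g : Finset ℕ → (ℕ → ℤ) → K) : ℕ → ℕ → Finset ℕ → (ℕ → ℤ) → K
  | 0, r, U, N => g (U.filter (· < r)) N
  | d + 1, r, U, N =>
    if r ∈ U then initSum g d (r + 1) (U.erase r) N
    else initSum g d (r + 1) (insert r U) (N - Pi.single r 1) + g (U.filter (· < r)) N

lemma initSum_congr {g g' : Finset ℕ → (ℕ → ℤ) → K} {d r : ℕ} {U : Finset ℕ} {N : ℕ → ℤ}
    (hr : 1 < r) (h : ∀ (T : Finset ℕ) (N' : ℕ → ℤ), (∀ x < r, (x ∈ T ↔ x ∈ U)) →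
      (∀ x ∈ T, x < r + d) → N' 1 = N 1 → g T N' = g' T N') :
    initSum g d r U N = initSum g' d r U N := by
  induction d generalizing r U N with
  | zero => exact h _ _ (by simp +contextual) (by simp) rfl
  | succ d ih =>
    have h1 : g (U.filter (· < r)) N = g' (U.filter (· < r)) N :=
      h _ _ (by simp +contextual) (fun x hx => by simp at hx; omega) rfl
    simp only [initSum]
    split_ifs
    · refine ih (by omega) fun T N' hT hT' hN => h T N' ?_ (fun x hx => by
        have := hT' x hx; omega) hN
      intro x hx
      rw [hT x (by omega)]; simp; omega
    · congr 1
      refine ih (by omega) fun T N' hT hT' hN => h T N' ?_ (fun x hx => by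
        have := hT' x hx; omega) ?_
      · intro x hx
        rw [hT x (by omega)]; simp; omega
      · rw [hN]; simp [Pi.single_eq_of_ne (show 1 ≠ r by omega)]

lemma initSum_add (g g' : Finset ℕ → (ℕ → ℤ) → K) (d r : ℕ) (U : Finset ℕ) (N : ℕ → ℤ) :
    initSum (fun T N => g T N + g' T N) d r U N = initSum g d r U N + initSum g' d r U N := by
  induction d generalizing r U N with
  | zero => rfl
  | succ d ih =>
    simp only [initSum, ih]
    split_ifs
    · rfl
    · ring

lemma initSum_mul (c : K) (g : Finset ℕ → (ℕ → ℤ) → K) (d r : ℕ) (U : Finset ℕ) (N : ℕ → ℤ) :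
    initSum (fun T N => c * g T N) d r U N = c * initSum g d r U N := by
  induction d generalizing r U N with
  | zero => rfl
  | succ d ih =>
    simp only [initSum, ih]
    split_ifs
    · rfl
    · ring

lemma initSum_shift (g : Finset ℕ → (ℕ → ℤ) → K) (d r : ℕ) (U : Finset ℕ) (N M : ℕ → ℤ) :
    initSum g d r U (N - M) = initSum (fun T N => g T (N - M)) d r U N := by
  induction d generalizing r U N with
  | zero => rfl
  | succ d ih =>
    simp only [initSum, ← ih]
    split_ifs
    · rfl
    · rw [sub_right_comm]

lemma initSum_insert (g : Finset ℕ → (ℕ → ℤ) → K) (d : ℕ) {r s : ℕ} (hrs : s < r) (U : Finset ℕ)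
    (N : ℕ → ℤ) : initSum g d r (insert s U) N = initSum (fun T N => g (insert s T) N) d r U N := by
  induction d generalizing r U N with
  | zero => simp [initSum, filter_insert, hrs]
  | succ d ih =>
    have h1 : (r ∈ insert s U) ↔ r ∈ U := by simp; omega
    simp only [initSum, h1, filter_insert, hrs, if_true]
    split_ifs
    · rw [erase_insert_of_ne (by omega), ih (by omega)]
    · rw [Finset.insert_comm, ih (by omega)]

lemma initSum_full (g : Finset ℕ → (ℕ → ℤ) → K) {d r : ℕ} {U : Finset ℕ}
    (hU : ∀ x, r ≤ x → x < r + d → x ∈ U) (N : ℕ → ℤ) :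
    initSum g d r U N = g (U.filter (· < r)) N := by
  induction d generalizing r U with
  | zero => rfl
  | succ d ih =>
    rw [initSum, if_pos (hU r le_rfl (by omega)), ih]
    · congr 1; ext x; simp only [mem_filter, mem_erase]; grind
    · intro x h1 h2
      exact mem_erase.2 ⟨by omega, hU x (by omega) (by omega)⟩

end Field

/-! ### The recursion by the contents of the next size. -/

section Field

variable {K : Type*} [Field K] {q : K}

/-- The value of `g` after the least free mark among `2, …, d + 1` has been added. -/
def fillLeast (d : ℕ) (g : Finset ℕ → (ℕ → ℤ) → K) (T : Finset ℕ) (N : ℕ → ℤ) : K :=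
  (leastFree d 1 T).elim 0 fun r => g (insert r T) (N - Pi.single r 1)

/-- Every nonempty initial segment of the complement of `U` begins with the least free mark `r`.
Deleting `r` leaves an initial segment of the complement of `insert r U`; the empty segment gives
the separate term. -/
lemma initSum_comp_eraseMin (g : Finset ℕ → (ℕ → ℤ) → K) {d s r : ℕ} {U : Finset ℕ} {N : ℕ → ℤ}
    (hs : 1 < s) (hr : r ∉ U) (h1 : s ≤ r) (h2 : r < s + d) (h3 : ∀ x, s ≤ x → x < r → x ∈ U)
    (h4 : ∀ x ∈ U, s ≤ x) :
    initSum (fun T N => g (eraseMin T) N) d s U N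
      = initSum g d s (insert r U) (N - Pi.single r 1) + g ∅ N := by
  induction d generalizing s U with
  | zero => omega
  | succ d ih =>
    have hf : U.filter (· < s) = ∅ := by
      ext x; simp only [mem_filter, notMem_empty, iff_false, not_and]
      intro hx; have := h4 x hx; omega
    rcases h1.eq_or_lt with rfl | h1
    · rw [initSum, if_neg hr, initSum, if_pos (mem_insert_self _ _), erase_insert hr,
        initSum_insert _ _ (by omega), hf, eraseMin_empty]
      congr 1
      refine initSum_congr (by omega) fun T N' hT hT' hN => ?_
      rw [eraseMin_insert]
      intro x hx
      by_contra hc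
      have := (hT x (by omega)).1 hx
      have := h4 x this
      obtain rfl : x = s := by omega
      exact hr ‹_›
    · rw [initSum, if_pos (h3 s le_rfl h1), initSum, if_pos (mem_insert_of_mem (h3 s le_rfl h1)),
        erase_insert_of_ne (by omega)]
      refine ih (by omega) (fun h => hr (mem_of_mem_erase h)) (by omega) (by omega) ?_ ?_
      · exact fun x h5 h6 => mem_erase.2 ⟨by omega, h3 x (by omega) h6⟩
      · intro x hx
        have := h4 x (mem_of_mem_erase hx)
        have := ne_of_mem_erase hx
        omega

/-- Adding the least free mark sends each segment `Ico 2 s` to its successor; the full segment has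
none and contributes `0`. So only the first term is lost. -/
lemma initSum_fillLeast_empty (g : Finset ℕ → (ℕ → ℤ) → K) {d e s : ℕ} (hs : 2 ≤ s)
    (hd : s + e = d + 2) (N : ℕ → ℤ) :
    initSum (fillLeast d g) e s (Ico 2 s) N = initSum g e s (Ico 2 s) N - g (Ico 2 s) N := by
  induction e generalizing s N with
  | zero =>
    have hf : (Ico 2 s).filter (· < s) = Ico 2 s := by ext; simp
    rw [initSum, initSum, hf, sub_self, fillLeast, leastFree_eq_none]
    · rfl
    · intro x h1 h2; simp; omega
  | succ e ih =>
    have hf : (Ico 2 s).filter (· < s) = Ico 2 s := by ext; simp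
    have hi : insert s (Ico 2 s) = Ico 2 (s + 1) := by ext; simp; omega
    rw [initSum, initSum, if_neg (by simp), if_neg (by simp), hf, hi, ih (by omega) (by omega),
      fillLeast, leastFree_eq_some (r := s) (by simp) (by omega) (by omega)
        (fun x h1 h2 => by simp; omega)]
    simp only [Option.elim, hi]
    ring

/-- With `u` the least blocked mark, adding the least free mark sends `Ico 2 s` to `Ico 2 (s + 1)`
below `u` and fills the gap `u` in longer segments. The images are the initial segments of the
complement of `U.erase u`, except for the first one. -/
lemma initSum_fillLeast (g : Finset ℕ → (ℕ → ℤ) → K) {d e s u : ℕ} {U : Finset ℕ} (hs : 2 ≤ s)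
    (hd : s + e = d + 2) (hu : u ∈ U) (hsu : s ≤ u) (hud : u < d + 2)
    (hU : ∀ x < u, (x ∈ U ↔ 2 ≤ x ∧ x < s)) (N : ℕ → ℤ) :
    initSum (fillLeast d g) e s U N = initSum g e s (U.erase u) N - g (Ico 2 s) N := by
  induction e generalizing s U N with
  | zero => omega
  | succ e ih =>
    have hf : U.filter (· < s) = Ico 2 s := by
      ext x; simp only [mem_filter, mem_Ico]
      constructor
      · rintro ⟨h1, h2⟩; exact (hU x (by omega)).1 h1
      · rintro ⟨h1, h2⟩; exact ⟨(hU x (by omega)).2 ⟨h1, h2⟩, h2⟩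
    have hf' : (U.erase u).filter (· < s) = Ico 2 s := by
      rw [← hf]; ext x; simp only [mem_filter, mem_erase]
      constructor
      · rintro ⟨⟨_, h⟩, h'⟩; exact ⟨h, h'⟩
      · rintro ⟨h, h'⟩; exact ⟨⟨by omega, h⟩, h'⟩
    rcases hsu.eq_or_lt with rfl | hsu
    · rw [initSum, initSum, if_pos hu, if_neg (by simp), hf', insert_erase hu, add_sub_cancel_right]
      conv_rhs => rw [← insert_erase hu]
      rw [initSum_insert _ _ (by omega), initSum_shift]
      refine initSum_congr (by omega) fun T N' hT hT' hN => ?_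
      rw [fillLeast, leastFree_eq_some (r := s)]
      · rfl
      · simp [hT s (by omega)]
      · omega
      · omega
      · intro x h1 h2
        rw [hT x (by omega), mem_erase, hU x h2]
        omega
    · have hsU : s ∉ U := by rw [hU s hsu]; omega
      have hi : insert s (Ico 2 s) = Ico 2 (s + 1) := by ext; simp; omega
      rw [initSum, initSum, if_neg hsU, if_neg (fun h => hsU (mem_of_mem_erase h)), hf, hf',
        ih (by omega) (by omega) (mem_insert_of_mem hu) (by omega), fillLeast,
        leastFree_eq_some (r := s) (by simp) (by omega) (by omega)
        (fun x h1 h2 => by simp; omega), erase_insert_of_ne (by omega)]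
      · simp only [Option.elim, hi]
        ring
      · intro x hx
        rw [mem_insert, hU x hx]
        omega

lemma sum_sub_single {s : Finset ℕ} {r : ℕ} (hr : r ∈ s) (N : ℕ → ℤ) :
    ∑ x ∈ s, (N - Pi.single r 1 : ℕ → ℤ) x = ∑ x ∈ s, N x - 1 := by
  simp [Finset.sum_sub_distrib, hr]

/-- The recursions by the contents of the next position. -/
def PositionRec (q : K) (d : ℕ) (N : ℕ → ℤ) (U : Finset ℕ) : Prop :=
  genPlain q d U N = q ^ (∑ r ∈ Icc 1 (d + 1), N r)
      * (genPlain q d ∅ N + initSum (genOver q d) d 2 U (N - Pi.single 1 1)) ∧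
  genOver q d U N = q ^ (∑ r ∈ Icc 1 (d + 1), N r)
      * (initSum (genOver q d) d 2 U (N - Pi.single 1 1)
        + initSum (fun T N => genPlain q d (eraseMin T) N) d 2 U N)

lemma initSum_eq_zero {g : Finset ℕ → (ℕ → ℤ) → K} {d s r : ℕ} {U : Finset ℕ} {N : ℕ → ℤ}
    (hN : N r < 0) (hg : ∀ T N, N r < 0 → g T N = 0) : initSum g d s U N = 0 := by
  induction d generalizing s U N with
  | zero => exact hg _ _ hN
  | succ d ih =>
    rw [initSum]
    split_ifs
    · exact ih hN
    · rw [ih, hg _ _ hN, add_zero]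
      have : 0 ≤ (Pi.single s 1 : ℕ → ℤ) r := by
        by_cases h : r = s
        · subst h; simp
        · simp [Pi.single_eq_of_ne h]
      simp only [Pi.sub_apply]; omega

lemma positionRec_of_neg {d : ℕ} {N : ℕ → ℤ} {r : ℕ} (h1 : 1 ≤ r) (h2 : r ≤ d + 1)
    (hN : N r < 0) (U : Finset ℕ) : PositionRec q d N U := by
  have h3 : (N - Pi.single 1 1 : ℕ → ℤ) r < 0 := by
    have : 0 ≤ (Pi.single 1 1 : ℕ → ℤ) r := by
      by_cases h : r = 1
      · subst h; simp
      · simp [Pi.single_eq_of_ne h]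
    simp only [Pi.sub_apply]; omega
  have h4 := initSum_eq_zero (d := d) (s := 2) (U := U) h3
    (g := genOver q d) fun T N h => genOver_vanish h1 h2 h
  have h5 := initSum_eq_zero (d := d) (s := 2) (U := U) hN
    (g := fun T N => genPlain q d (eraseMin T) N) fun T N h => genPlain_vanish h1 h2 h
  constructor
  · rw [genPlain_vanish h1 h2 hN, genPlain_vanish h1 h2 hN, h4]; simp
  · rw [genOver_vanish h1 h2 hN, h4, h5]; simp

/-- A summed form of `genPlain_rec`: the power of `q` is common to all terms, since the segments
contain only marks at least `2` and leave `N 1` unchanged. -/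
lemma initSum_genPlain (hq0 : q ≠ 0) (hq : ∀ n : ℕ, 0 < n → q ^ n ≠ 1) {d : ℕ} {U : Finset ℕ}
    (hU : ∀ x ∈ U, 2 ≤ x) (M : ℕ → ℤ) :
    initSum (genPlain q d) d 2 U M = q ^ M 1 * (initSum (genOver q d) d 2 U (M - Pi.single 1 1)
      + initSum (fun T N => genPlain q d (eraseMin T) N) d 2 U M) := by
  rw [initSum_shift, ← initSum_add, ← initSum_mul]
  refine initSum_congr (by omega) fun T N' hT hT' hN => ?_
  rw [genPlain_rec hq0 hq (fun x hx => ?_), hN]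
  refine ⟨?_, by have := hT' x hx; omega⟩
  by_contra h
  exact h (hU x ((hT x (by omega)).1 hx))

/-- A summed form of `genOver_rec`; where no mark is free, the default `0` of `fillLeast` turns it
into `genOver_full`. -/
lemma initSum_genPlain' (hq0 : q ≠ 0) (hq : ∀ n : ℕ, 0 < n → q ^ n ≠ 1) {d : ℕ} (U : Finset ℕ)
    (M : ℕ → ℤ) :
    initSum (genPlain q d) d 2 U M = initSum (genOver q d) d 2 U M
      - q ^ (M 1 + 1) * initSum (fillLeast d (genOver q d)) d 2 U M := by
  rw [sub_eq_add_neg, ← neg_mul, ← initSum_mul, ← initSum_add]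
  refine initSum_congr (by omega) fun T N' hT hT' hN => ?_
  rw [fillLeast]
  cases hr : leastFree d 1 T with
  | none =>
    rw [genOver_full hq0 hq]
    · simp
    · intro x h1 h2
      by_contra hx
      have h3 : ∃ y, y ∉ T ∧ 2 ≤ y ∧ y ≤ d + 1 := ⟨x, hx, h1, h2⟩
      have h4 := Nat.find_spec h3
      rw [leastFree_eq_some (r := Nat.find h3) h4.1 h4.2.1 (by omega)] at hr
      · simp at hr
      · intro y h5 h6
        have := Nat.find_min h3 h6
        by_contra h7
        exact this ⟨h7, h5, by omega⟩
  | some r =>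
    obtain ⟨h1, h2, h3, h4⟩ := leastFree_mem hr
    rw [genOver_rec hq0 hq h1 h2 (by omega) (fun x h5 h6 => h4 x h5 h6), hN]
    simp

/-- Induction on the number of remaining parts. The second identity at `N - Pi.single 1 1` gives
`key`; with `genPlain_rec` this yields the first identity by induction on the size of `U`. The
second identity follows from `genOver_rec`, the first identity at `N`, and the second one after a
part with the least free mark is removed. -/
theorem positionRec (hq0 : q ≠ 0) (hq : ∀ n : ℕ, 0 < n → q ^ n ≠ 1) {d : ℕ} (N : ℕ → ℤ)
    {U : Finset ℕ} (hU : ∀ x ∈ U, 2 ≤ x ∧ x ≤ d + 1) : PositionRec q d N U := by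
  induction hn : (∑ r ∈ Icc 1 (d + 1), N r).toNat using Nat.strong_induction_on
    generalizing N U with
  | _ n ihn =>
  by_cases hneg : ∃ r, 1 ≤ r ∧ r ≤ d + 1 ∧ N r < 0
  · obtain ⟨r, h1, h2, h3⟩ := hneg
    exact positionRec_of_neg h1 h2 h3 U
  push Not at hneg
  have hsub : ∀ r, 1 ≤ r → r ≤ d + 1 → ∀ {U : Finset ℕ}, (∀ x ∈ U, 2 ≤ x ∧ x ≤ d + 1) →
      PositionRec q d (N - Pi.single r 1) U := by
    intro r h1 h2 U hU
    rcases (hneg r h1 h2).eq_or_lt with h3 | h3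
    · exact positionRec_of_neg h1 h2 (by simp [← h3]) U
    · refine ihn _ ?_ _ hU rfl
      have hr : r ∈ Icc 1 (d + 1) := mem_Icc.2 ⟨h1, h2⟩
      have := single_le_sum (f := N) (fun x hx => hneg x (mem_Icc.1 hx).1 (mem_Icc.1 hx).2) hr
      rw [sum_sub_single hr]
      omega
  set S := ∑ r ∈ Icc 1 (d + 1), N r with hS
  have hS1 : ∑ r ∈ Icc 1 (d + 1), (N - Pi.single 1 1 : ℕ → ℤ) r = S - 1 := sum_sub_single (by simp) N
  -- the first identity
  have key : ∀ {U : Finset ℕ}, (∀ x ∈ U, 2 ≤ x ∧ x ≤ d + 1) →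
      q ^ N 1 * genOver q d U (N - Pi.single 1 1)
        = q ^ S * (initSum (genOver q d) d 2 U (N - Pi.single 1 1)
          - q ^ N 1 * initSum (fillLeast d (genOver q d)) d 2 U (N - Pi.single 1 1)) := by
    intro U hU
    have h1 := (hsub 1 le_rfl (by omega) hU).2
    rw [hS1] at h1
    have h2 := initSum_genPlain hq0 hq (d := d) (fun x hx => (hU x hx).1) (N - Pi.single 1 1)
    have h3 := initSum_genPlain' hq0 hq (d := d) U (N - Pi.single 1 1)
    simp only [Pi.sub_apply, Pi.single_eq_same, sub_add_cancel] at h2 h3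
    rw [← h3, h2, h1, ← mul_assoc, ← mul_assoc, ← zpow_add₀ hq0, ← zpow_add₀ hq0]
    congr 2
    ring
  have plain : ∀ U : Finset ℕ, (∀ x ∈ U, 2 ≤ x ∧ x ≤ d + 1) → genPlain q d U N = q ^ S
      * (genPlain q d ∅ N + initSum (genOver q d) d 2 U (N - Pi.single 1 1)) := by
    intro U
    induction hc : U.card generalizing U with
    | zero =>
      intro hU
      obtain rfl := card_eq_zero.1 hc
      have h1 := genPlain_rec hq0 hq hU N
      have h2 := initSum_fillLeast_empty (d := d) (e := d) (genOver q d) le_rfl (by omega)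
        (N - Pi.single 1 1)
      rw [Ico_self] at h2
      rw [eraseMin_empty, mul_add, key hU, h2] at h1
      have h3 : genPlain q d ∅ N - q ^ N 1 * genPlain q d ∅ N
        = q ^ N 1 * genOver q d ∅ (N - Pi.single 1 1) := by
        have := genPlain_rec hq0 hq hU N
        rw [eraseMin_empty] at this
        linear_combination this
      -- For `U = ∅` the recursion has the same function on both sides and determines it only after
      -- division by `1 - q ^ N 1`; so `N 1 = 0` is treated apart.
      rcases eq_or_ne (N 1) 0 with hN | hN
      · have h4 : ∀ T N', N' 1 < 0 → genOver q d T N' = 0 :=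
          fun T N' h => genOver_vanish le_rfl (by omega) h
        rw [initSum_eq_zero (r := 1) (by simp [hN]) h4, add_zero]
        by_cases h5 : ∃ r, 1 ≤ r ∧ r ≤ d + 1 ∧ N r ≠ 0
        · obtain ⟨r, h6, h7, h8⟩ := h5
          rw [genPlain_empty_eq_zero hN.le h6 h7 h8, mul_zero]
        · push Not at h5
          have : S = 0 := sum_eq_zero fun r hr => h5 r (mem_Icc.1 hr).1 (mem_Icc.1 hr).2
          simp [this]
      · have h5 : (1 - q ^ N 1) ≠ 0 := by
          obtain ⟨a, ha⟩ : ∃ a : ℕ, N 1 = a :=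
            ⟨(N 1).toNat, by have := hneg 1 le_rfl (by omega); omega⟩
          rw [ha, zpow_natCast]
          exact sub_ne_zero.2 (hq a (by omega)).symm
        apply mul_left_cancel₀ h5
        linear_combination h1 - q ^ S * h3
    | succ c ihc =>
      intro hU
      have hne : U.Nonempty := card_pos.1 (by omega)
      obtain ⟨u, hu, hmin, he⟩ := exists_eraseMin hne
      have h1 := genPlain_rec hq0 hq hU N
      have hU' : ∀ x ∈ eraseMin U, 2 ≤ x ∧ x ≤ d + 1 := fun x hx => hU x (eraseMin_subset U hx)
      have h2 := ihc (eraseMin U) (by rw [he, card_erase_of_mem hu, hc]; rfl) hU'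
      have h3 := initSum_fillLeast (d := d) (e := d) (genOver q d) le_rfl (by omega) hu
        (hU u hu).1 (by have := (hU u hu).2; omega) (fun x hx => by
          constructor
          · intro h; have := hmin x h; omega
          · omega) (N - Pi.single 1 1)
      rw [Ico_self, ← he] at h3
      -- The sums over `eraseMin U` cancel in `h1`; what remains is the recursion for the empty
      -- blocked set.
      have h4 := genPlain_rec (U := ∅) hq0 hq (d := d) (by simp) N
      rw [eraseMin_empty] at h4
      rw [mul_add, key hU, h2, h3] at h1
      linear_combination h1 - q ^ S * h4
  refine ⟨plain U hU, ?_⟩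
  by_cases hfull : ∀ x, 2 ≤ x → x ≤ d + 1 → x ∈ U
  · rw [genOver_full hq0 hq hfull, plain U hU,
      initSum_full (fun T N => genPlain q d (eraseMin T) N) (fun x h1 h2 => hfull x h1 (by omega))]
    have : U.filter (· < 2) = ∅ := by
      ext x; simp only [mem_filter, notMem_empty, iff_false, not_and]
      intro hx; have := hU x hx; omega
    rw [this, eraseMin_empty]
    ring
  · push Not at hfull
    have h3 : ∃ y, 2 ≤ y ∧ y ≤ d + 1 ∧ y ∉ U := hfull
    obtain ⟨h5, h6, h7⟩ := Nat.find_spec h3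
    have h8 : ∀ x, 2 ≤ x → x < Nat.find h3 → x ∈ U := by
      intro y h5 h6
      have := Nat.find_min h3 h6
      by_contra h7
      exact this ⟨h5, by omega, h7⟩
    set r := Nat.find h3
    have hU' : ∀ x ∈ insert r U, 2 ≤ x ∧ x ≤ d + 1 := by
      intro x hx
      rcases mem_insert.1 hx with rfl | hx
      · exact ⟨h5, h6⟩
      · exact hU x hx
    have e1 : (Pi.single r 1 : ℕ → ℤ) 1 = 0 := Pi.single_eq_of_ne (by omega) _
    rw [genOver_rec hq0 hq h7 h5 h6 h8, plain U hU, (hsub r (by omega) h6 hU').2,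
      sum_sub_single (mem_Icc.2 ⟨by omega, h6⟩), ← hS,
      initSum_comp_eraseMin (genPlain q d) (by omega) h7 h5 (by omega) h8 (fun x hx => (hU x hx).1),
      initSum_genPlain hq0 hq (fun x hx => (hU' x hx).1)]
    simp only [Pi.sub_apply, e1, sub_zero]
    have : q ^ (N 1 + 1) * q ^ (S - 1) = q ^ S * q ^ N 1 := by
      rw [← zpow_add₀ hq0, ← zpow_add₀ hq0]; congr 1; ring
    rw [← mul_assoc, this]
    ring

end Field

/-! ### The automaton and its languages. -/

/-- All marks `2, …, k - 1` belong to `W`. -/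
def Filled (k : ℕ) (W : Finset ℕ) : Prop := ∀ x, 2 ≤ x → x ≤ k - 1 → x ∈ W

/-- `r` is the least mark among `2, …, k - 1` that is not in `W`. -/
def IsNext (k : ℕ) (W : Finset ℕ) (r : ℕ) : Prop :=
  2 ≤ r ∧ r ≤ k - 1 ∧ r ∉ W ∧ ∀ x, 2 ≤ x → x < r → x ∈ W

lemma IsNext.unique {k : ℕ} {W : Finset ℕ} {r s : ℕ} (hr : IsNext k W r) (hs : IsNext k W s) :
    r = s := by
  rcases lt_trichotomy r s with h | h | h
  · exact absurd (hs.2.2.2 r hr.1 h) hr.2.2.1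
  · exact h
  · exact absurd (hr.2.2.2 s hs.1 h) hs.2.2.1

lemma IsNext.not_filled {k : ℕ} {W : Finset ℕ} {r : ℕ} (hr : IsNext k W r) : ¬ Filled k W :=
  fun h => hr.2.2.1 (h r hr.1 hr.2.1)

lemma filled_or_isNext (k : ℕ) (W : Finset ℕ) : Filled k W ∨ ∃ r, IsNext k W r := by
  by_cases h : Filled k W
  · exact .inl h
  · right
    unfold Filled at h
    push Not at h
    obtain ⟨h1, h2, h3⟩ := Nat.find_spec h
    refine ⟨Nat.find h, h1, h2, h3, fun x h4 h5 => ?_⟩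
    by_contra h6
    exact Nat.find_min h h5 ⟨h4, by omega, h6⟩

/-- The automaton reading the parts of an overpartition in increasing order.  The part `t` is being
processed: `b` tells whether `t` is overlined, `a` whether non-overlined parts `t` are allowed,
`U` is the set of marks that they may not receive because of the parts `t - 1`, and `T` is the set
of the marks of those read so far.  The number of `r`-marked parts that are still to come
is `N r`. -/
def Accepts (k : ℕ) :
    List OPart → ℕ → Bool → Bool → Finset ℕ → Finset ℕ → (ℕ → ℤ) → Prop
  | [], _, _, _, _, _, N => ∀ r, 1 ≤ r → r ≤ k - 1 → N r = 0
  | p :: ps, t, b, a, U, T, N =>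
    (p = (t, false) ∧ a = true ∧ ∃ r, IsNext k (U ∪ T) r ∧
      Accepts k ps t b a U (insert r T) (N - Pi.single r 1)) ∨
    ((N (k - 1) ≠ 0 → Filled k (U ∪ T)) ∧
      ((p = (t + 1, true) ∧ (N (k - 1) ≠ 0 → b = true ∨ T.Nonempty) ∧
          Accepts k ps (t + 1) true true (if b = true then T else eraseMin T) ∅
            (N - Pi.single 1 1)) ∨
        (p = (t + 1, false) ∧ b = true ∧ ∃ r, IsNext k T r ∧
          Accepts k ps (t + 1) false true T {r} (N - Pi.single r 1)) ∨
        (t + 1 < p.1 ∧ p.2 = true ∧ N (k - 1) = 0 ∧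
          Accepts k ps p.1 true true ∅ ∅ (N - Pi.single 1 1))))

/-- The lists that may follow while the part `t` is being processed. -/
def tails (k t : ℕ) (b : Bool) (U T : Finset ℕ) (N : ℕ → ℤ) : Set (List OPart) :=
  {L | Accepts k L t b true U T N}

/-- The lists that may follow when the parts `t` are complete. -/
def tailsAbove (k t : ℕ) (b : Bool) (T : Finset ℕ) (N : ℕ → ℤ) : Set (List OPart) :=
  {L | Accepts k L t b false (Icc 2 (k - 1)) T N}

lemma filled_Icc_union (k : ℕ) (T : Finset ℕ) : Filled k (Icc 2 (k - 1) ∪ T) :=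
  fun _ h1 h2 => mem_union_left _ (mem_Icc.2 ⟨h1, h2⟩)

lemma not_accepts_of_neg {k : ℕ} {L : List OPart} {t : ℕ} {b a : Bool} {U T : Finset ℕ}
    {N : ℕ → ℤ} {r : ℕ} (h1 : 1 ≤ r) (h2 : r ≤ k - 1) (hN : N r < 0) :
    ¬ Accepts k L t b a U T N := by
  induction L generalizing t b a U T N with
  | nil => exact fun h => hN.ne (h r h1 h2)
  | cons p ps ih =>
    have h3 : ∀ s, (N - Pi.single s 1 : ℕ → ℤ) r < 0 := by
      intro s
      have : 0 ≤ (Pi.single s 1 : ℕ → ℤ) r := by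
        by_cases h : r = s
        · subst h; simp
        · simp [Pi.single_eq_of_ne h]
      simp only [Pi.sub_apply]; omega
    rintro (⟨-, -, s, -, h⟩ | ⟨-, ⟨-, -, h⟩ | ⟨-, -, s, -, h⟩ | ⟨-, -, -, h⟩⟩)
    all_goals exact ih (h3 _) h

lemma eq_nil_of_accepts {k : ℕ} (hk : 2 ≤ k) {L : List OPart} {t : ℕ} {b a : Bool}
    {U T : Finset ℕ} {N : ℕ → ℤ} (hN : ∀ r, 1 ≤ r → r ≤ k - 1 → N r = 0)
    (h : Accepts k L t b a U T N) : L = [] := by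
  cases L with
  | nil => rfl
  | cons p ps =>
    exfalso
    have h3 : ∀ s, 1 ≤ s → s ≤ k - 1 → (N - Pi.single s 1 : ℕ → ℤ) s < 0 := by
      intro s h1 h2; simp [hN s h1 h2]
    rcases h with (⟨-, -, s, hs, h⟩ | ⟨-, ⟨-, -, h⟩ | ⟨-, -, s, hs, h⟩ | ⟨-, -, -, h⟩⟩)
    · exact not_accepts_of_neg (by have := hs.1; omega) hs.2.1 (h3 s (by have := hs.1; omega) hs.2.1) h
    · exact not_accepts_of_neg le_rfl (by omega) (h3 1 le_rfl (by omega)) h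
    · exact not_accepts_of_neg (by have := hs.1; omega) hs.2.1 (h3 s (by have := hs.1; omega) hs.2.1) h
    · exact not_accepts_of_neg le_rfl (by omega) (h3 1 le_rfl (by omega)) h

/-- No mark is left for another part `t`, so neither the permission to read one nor the blocked set
matters any more. -/
lemma tails_of_filled {k t : ℕ} {b : Bool} {U T : Finset ℕ} {N : ℕ → ℤ}
    (h : Filled k (U ∪ T)) : tails k t b U T N = tailsAbove k t b T N := by
  ext L
  cases L with
  | nil => rfl
  | cons p ps =>
    have h1 : ∀ r, ¬ IsNext k (U ∪ T) r := fun r hr => hr.not_filled h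
    simp [tails, tailsAbove, Accepts, h, h1, filled_Icc_union]

lemma tails_of_isNext {k t : ℕ} {b : Bool} {U T : Finset ℕ} {N : ℕ → ℤ} {r : ℕ}
    (hr : IsNext k (U ∪ T) r) (hN : N (k - 1) = 0) :
    tails k t b U T N = (((t, false) : OPart) :: ·) '' tails k t b U (insert r T) (N - Pi.single r 1)
      ∪ tailsAbove k t b T N := by
  ext L
  cases L with
  | nil => simp [tails, tailsAbove, Accepts]
  | cons p ps =>
    have h1 : ∀ s, IsNext k (U ∪ T) s ↔ s = r := fun s =>
      ⟨fun h => h.unique hr, fun h => h ▸ hr⟩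
    simp only [tails, tailsAbove, Accepts, h1, hN, ne_eq, not_true_eq_false, false_imp_iff,
      true_and, exists_eq_left, Set.mem_union, Set.mem_image, Set.mem_ofPred_eq, List.cons.injEq,
      Bool.false_eq_true, false_and, and_false, false_or]
    refine or_congr ⟨?_, ?_⟩ Iff.rfl
    · rintro ⟨rfl, h⟩; exact ⟨ps, h, rfl, rfl⟩
    · rintro ⟨x, h, rfl, rfl⟩; exact ⟨rfl, h⟩

lemma tails_of_isNext_of_ne {k t : ℕ} (hk : 2 ≤ k) {b : Bool} {U T : Finset ℕ} {N : ℕ → ℤ} {r : ℕ}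
    (hr : IsNext k (U ∪ T) r) (hN : N (k - 1) ≠ 0) :
    tails k t b U T N
      = (((t, false) : OPart) :: ·) '' tails k t b U (insert r T) (N - Pi.single r 1) := by
  ext L
  cases L with
  | nil =>
    simp only [tails, Accepts, Set.mem_ofPred_eq, Set.mem_image, reduceCtorEq, and_false,
      exists_false, iff_false]
    exact fun h => hN (h _ (by omega) le_rfl)
  | cons p ps =>
    have h1 : ∀ s, IsNext k (U ∪ T) s ↔ s = r := fun s =>
      ⟨fun h => h.unique hr, fun h => h ▸ hr⟩
    simp only [tails, Accepts, h1, ne_eq, hN, not_false_eq_true, hr.not_filled, false_and,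
      exists_eq_left, Set.mem_image, Set.mem_ofPred_eq, List.cons.injEq, true_and, imp_false]
    constructor
    · rintro (⟨rfl, h⟩ | h)
      · exact ⟨ps, h, rfl, rfl⟩
      · exact absurd trivial h.1
    · rintro ⟨x, h, rfl, rfl⟩; exact .inl ⟨rfl, h⟩

/-- If `t + 1` is not overlined, the state at `t + 1` without any parts read covers at once
non-overlined parts `t + 1`, a jump over this size, and the end of the list. -/
lemma tailsAbove_true {k t : ℕ} (T : Finset ℕ) (N : ℕ → ℤ) :
    tailsAbove k t true T N
      = (((t + 1, true) : OPart) :: ·) '' tails k (t + 1) true T ∅ (N - Pi.single 1 1)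
        ∪ tails k (t + 1) false T ∅ N := by
  ext L
  cases L with
  | nil => simp [tails, tailsAbove, Accepts]
  | cons p ps =>
    obtain ⟨s, c⟩ := p
    by_cases hN : N (k - 1) = 0 <;>
    simp only [tails, tailsAbove, Accepts, filled_Icc_union, hN, ne_eq, not_true_eq_false,
      not_false_eq_true, forall_const, false_imp_iff, true_and, Set.mem_union,
      Set.mem_image, Set.mem_ofPred_eq, List.cons.injEq, Bool.false_eq_true, false_and, and_false,
      false_or, or_false, union_empty, if_true, if_false, eraseMin_empty, Finset.not_nonempty_empty,
      insert_empty, imp_true_iff, true_or, Prod.mk.injEq]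
    · constructor
      · rintro (⟨⟨rfl, rfl⟩, h⟩ | ⟨⟨rfl, rfl⟩, h⟩ | ⟨h1, rfl, h⟩)
        · exact .inl ⟨ps, h, ⟨rfl, rfl⟩, rfl⟩
        · exact .inr (.inl ⟨⟨rfl, rfl⟩, h⟩)
        · rcases eq_or_lt_of_le (show t + 1 + 1 ≤ s from h1) with rfl | h1
          · exact .inr (.inr (.inl ⟨⟨rfl, rfl⟩, h⟩))
          · exact .inr (.inr (.inr ⟨h1, rfl, h⟩))
      · rintro (⟨x, h, ⟨rfl, rfl⟩, rfl⟩ | ⟨⟨rfl, rfl⟩, h⟩ | ⟨⟨rfl, rfl⟩, h⟩ | ⟨h1, rfl, h⟩)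
        · exact .inl ⟨⟨rfl, rfl⟩, h⟩
        · exact .inr (.inl ⟨⟨rfl, rfl⟩, h⟩)
        · exact .inr (.inr ⟨by omega, rfl, h⟩)
        · exact .inr (.inr ⟨by omega, rfl, h⟩)
    · constructor
      · rintro (⟨⟨rfl, rfl⟩, h⟩ | ⟨⟨rfl, rfl⟩, h⟩)
        · exact .inl ⟨ps, h, ⟨rfl, rfl⟩, rfl⟩
        · exact .inr ⟨⟨rfl, rfl⟩, h⟩
      · rintro (⟨x, h, ⟨rfl, rfl⟩, rfl⟩ | ⟨⟨rfl, rfl⟩, h⟩)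
        · exact .inl ⟨⟨rfl, rfl⟩, h⟩
        · exact .inr ⟨⟨rfl, rfl⟩, h⟩

/-- Without an overlined `t`, a non-overlined `t + 1` would receive the mark `1`. So `t + 1` is
overlined or absent, and in the latter case nothing is blocked afterwards. -/
lemma tailsAbove_false {k t : ℕ} (T : Finset ℕ) {N : ℕ → ℤ} (hN : N (k - 1) = 0) :
    tailsAbove k t false T N
      = (((t + 1, true) : OPart) :: ·) '' tails k (t + 1) true (eraseMin T) ∅ (N - Pi.single 1 1)
        ∪ tailsAbove k (t + 1) false ∅ N := by
  ext L
  cases L with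
  | nil => simp [tailsAbove, Accepts]
  | cons p ps =>
    obtain ⟨s, c⟩ := p
    simp only [tails, tailsAbove, Accepts, filled_Icc_union, hN, ne_eq, not_true_eq_false,
      false_imp_iff, true_and, Set.mem_union,
      Set.mem_image, Set.mem_ofPred_eq, List.cons.injEq, Bool.false_eq_true, false_and, and_false,
      false_or, if_false, eraseMin_empty, imp_true_iff, Prod.mk.injEq]
    constructor
    · rintro (⟨⟨rfl, rfl⟩, h⟩ | ⟨h1, rfl, h⟩)
      · exact .inl ⟨ps, h, ⟨rfl, rfl⟩, rfl⟩
      · rcases eq_or_lt_of_le (show t + 1 + 1 ≤ s from h1) with rfl | h1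
        · exact .inr (.inl ⟨⟨rfl, rfl⟩, h⟩)
        · exact .inr (.inr ⟨h1, rfl, h⟩)
    · rintro (⟨x, h, ⟨rfl, rfl⟩, rfl⟩ | ⟨⟨rfl, rfl⟩, h⟩ | ⟨h1, rfl, h⟩)
      · exact .inl ⟨⟨rfl, rfl⟩, h⟩
      · exact .inr ⟨by omega, rfl, h⟩
      · exact .inr ⟨by omega, rfl, h⟩

lemma tailsAbove_false_of_ne {k t : ℕ} (hk : 2 ≤ k) {T : Finset ℕ} (hT : T.Nonempty) {N : ℕ → ℤ}
    (hN : N (k - 1) ≠ 0) :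
    tailsAbove k t false T N
      = (((t + 1, true) : OPart) :: ·) '' tails k (t + 1) true (eraseMin T) ∅
        (N - Pi.single 1 1) := by
  ext L
  cases L with
  | nil =>
    simp only [tailsAbove, Accepts, Set.mem_ofPred_eq, Set.mem_image, reduceCtorEq, and_false,
      exists_false, iff_false]
    exact fun h => hN (h _ (by omega) le_rfl)
  | cons p ps =>
    obtain ⟨s, c⟩ := p
    simp only [tails, tailsAbove, Accepts, filled_Icc_union, hN, ne_eq,
      not_false_eq_true, forall_const, true_and,
      Set.mem_image, Set.mem_ofPred_eq, List.cons.injEq, Bool.false_eq_true, false_and, and_false,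
      false_or, or_false, if_false, hT, or_true, Prod.mk.injEq]
    constructor
    · rintro ⟨⟨rfl, rfl⟩, h⟩
      exact ⟨ps, h, ⟨rfl, rfl⟩, rfl⟩
    · rintro ⟨x, h, ⟨rfl, rfl⟩, rfl⟩
      exact ⟨⟨rfl, rfl⟩, h⟩

lemma tailsAbove_false_empty {k t : ℕ} (hk : 2 ≤ k) {N : ℕ → ℤ} (hN : N (k - 1) ≠ 0) :
    tailsAbove k t false ∅ N = ∅ := by
  ext L
  cases L with
  | nil =>
    simp only [tailsAbove, Accepts, Set.mem_ofPred_eq, Set.mem_empty_iff_false, iff_false]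
    exact fun h => hN (h _ (by omega) le_rfl)
  | cons p ps => simp [tailsAbove, Accepts, hN]

lemma lt_of_mem_tailsAbove {k t : ℕ} {b : Bool} {T : Finset ℕ} {N : ℕ → ℤ} {p : OPart}
    {ps : List OPart} (h : p :: ps ∈ tailsAbove k t b T N) : t < p.1 := by
  rcases h with (⟨-, h, -⟩ | ⟨-, ⟨rfl, -⟩ | ⟨rfl, -⟩ | ⟨h, -⟩⟩)
  · cases h
  all_goals first | exact Nat.lt_succ_self t | omega

lemma head_of_mem_tails {k t : ℕ} {b : Bool} {U T : Finset ℕ} {N : ℕ → ℤ} {p : OPart}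
    {ps : List OPart} (h : p :: ps ∈ tails k t b U T N) : p = (t, false) ∨ t < p.1 := by
  rcases h with (⟨h, -⟩ | ⟨-, ⟨rfl, -⟩ | ⟨rfl, -⟩ | ⟨h, -⟩⟩)
  · exact .inl h
  all_goals first | exact .inr (Nat.lt_succ_self t) | (right; omega)

lemma tailsAbove_of_neg {k t : ℕ} {b : Bool} {T : Finset ℕ} {N : ℕ → ℤ} {r : ℕ} (h1 : 1 ≤ r)
    (h2 : r ≤ k - 1) (hN : N r < 0) : tailsAbove k t b T N = ∅ :=
  Set.eq_empty_of_forall_notMem fun _ h => not_accepts_of_neg h1 h2 hN h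

lemma tails_of_neg {k t : ℕ} {b : Bool} {U T : Finset ℕ} {N : ℕ → ℤ} {r : ℕ} (h1 : 1 ≤ r)
    (h2 : r ≤ k - 1) (hN : N r < 0) : tails k t b U T N = ∅ :=
  Set.eq_empty_of_forall_notMem fun _ h => not_accepts_of_neg h1 h2 hN h

lemma tailsAbove_zero {k t : ℕ} (hk : 2 ≤ k) {b : Bool} {T : Finset ℕ} {N : ℕ → ℤ}
    (hN : ∀ r, 1 ≤ r → r ≤ k - 1 → N r = 0) : tailsAbove k t b T N = {[]} := by
  ext L
  constructor
  · exact fun h => eq_nil_of_accepts hk hN h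
  · rintro rfl; exact hN

/-! ### Sums of lists and formal Laurent series in `q`. -/

/-- The sum of the underlying parts. -/
def partSum (L : List OPart) : ℤ := ((L.map Prod.fst).sum : ℕ)

@[simp] lemma partSum_nil : partSum [] = 0 := rfl

@[simp] lemma partSum_cons (p : OPart) (L : List OPart) : partSum (p :: L) = p.1 + partSum L := by
  simp [partSum]

lemma partSum_nonneg (L : List OPart) : 0 ≤ partSum L := Int.natCast_nonneg _

/-- The variable of the field of formal Laurent series. -/
noncomputable def qL : LaurentSeries ℚ := HahnSeries.single 1 1

lemma qL_zpow (z : ℤ) : qL ^ z = HahnSeries.single z 1 := (RatFunc.single_zpow z).symm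

lemma coeff_qL_zpow_mul (z j : ℤ) (f : LaurentSeries ℚ) :
    (qL ^ z * f).coeff j = f.coeff (j - z) := by
  rw [qL_zpow, HahnSeries.coeff_single_mul, one_mul]

lemma qL_ne_zero : qL ≠ 0 := HahnSeries.single_ne_zero one_ne_zero

lemma qL_pow_ne_one (n : ℕ) (hn : 0 < n) : qL ^ n ≠ 1 := by
  intro h
  have h1 : qL ^ (n : ℤ) = 1 := by rw [zpow_natCast, h]
  rw [qL_zpow] at h1
  have := congrArg (fun f => HahnSeries.coeff f 0) h1
  simp [HahnSeries.coeff_single_of_ne (show (0 : ℤ) ≠ n by omega)] at this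

/-- The Laurent series without negative powers. -/
def IsPowerSeries (f : LaurentSeries ℚ) : Prop := f ∈ (HahnSeries.ofPowerSeries ℤ ℚ).range

lemma IsPowerSeries.coeff_eq_zero {f : LaurentSeries ℚ} (hf : IsPowerSeries f) {j : ℤ}
    (hj : j < 0) : f.coeff j = 0 := by
  obtain ⟨p, rfl⟩ := hf
  rw [PowerSeries.coeff_coe, if_pos hj]

lemma isPowerSeries_zero : IsPowerSeries 0 := zero_mem _

lemma IsPowerSeries.add {f g : LaurentSeries ℚ} (hf : IsPowerSeries f) (hg : IsPowerSeries g) :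
    IsPowerSeries (f + g) := add_mem hf hg

lemma IsPowerSeries.mul {f g : LaurentSeries ℚ} (hf : IsPowerSeries f) (hg : IsPowerSeries g) :
    IsPowerSeries (f * g) := mul_mem hf hg

lemma qL_eq_coe : qL = HahnSeries.ofPowerSeries ℤ ℚ PowerSeries.X := (PowerSeries.coe_X).symm

lemma isPowerSeries_zpow {z : ℤ} (hz : 0 ≤ z) : IsPowerSeries (qL ^ z) := by
  lift z to ℕ using hz
  rw [zpow_natCast, qL_eq_coe, ← map_pow]
  exact ⟨_, rfl⟩

lemma isPowerSeries_invQ (D : ℤ) : IsPowerSeries (invQ qL D) := by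
  unfold invQ
  split_ifs
  · set u : PowerSeries ℚ := ∏ j ∈ range D.toNat, (1 - PowerSeries.X ^ (j + 1)) with hu
    have h1 : ∏ j ∈ range D.toNat, (1 - qL ^ (j + 1)) = HahnSeries.ofPowerSeries ℤ ℚ u := by
      rw [hu, map_prod]
      simp [qL_eq_coe]
    have h2 : PowerSeries.constantCoeff u ≠ 0 := by
      rw [hu, map_prod]
      exact prod_ne_zero_iff.2 fun j _ => by simp
    refine ⟨u⁻¹, ?_⟩
    rw [h1]
    refine eq_inv_of_mul_eq_one_left ?_
    rw [← map_mul, PowerSeries.inv_mul_cancel _ h2, map_one]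
  · exact isPowerSeries_zero

lemma isPowerSeries_layer_empty (d m : ℕ) (N : ℕ → ℤ) :
    IsPowerSeries (layer qL d m ∅ N).1 := by
  induction d generalizing m with
  | zero => exact (isPowerSeries_zpow (tri_nonneg _)).mul (isPowerSeries_invQ _)
  | succ d ih =>
    simp only [layer, notMem_empty, if_false]
    exact ((isPowerSeries_zpow (add_nonneg (tri_nonneg _) (tri_nonneg _))).mul
      (isPowerSeries_invQ _)).mul (ih _)

lemma exists_isNext_of_not_full {d : ℕ} {U : Finset ℕ} (h : ¬ ∀ x, 2 ≤ x → x ≤ d + 1 → x ∈ U) :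
    ∃ r, r ∉ U ∧ 2 ≤ r ∧ r ≤ d + 1 ∧ ∀ x, 2 ≤ x → x < r → x ∈ U := by
  rcases filled_or_isNext (d + 2) U with h1 | ⟨r, h1, h2, h3, h4⟩
  · exact absurd h1 h
  · exact ⟨r, h3, h1, by omega, h4⟩

/-- The definition of `genOver` has a negative power of `q`, so this is not read off from it. It
follows by induction on the number of parts from `genPlain_rec` and `genOver_rec`, whose
coefficients are nonnegative powers. -/
lemma isPowerSeries_gen (d : ℕ) (N : ℕ → ℤ) {U : Finset ℕ} (hU : ∀ x ∈ U, 2 ≤ x ∧ x ≤ d + 1) :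
    IsPowerSeries (genPlain qL d U N) ∧ IsPowerSeries (genOver qL d U N) := by
  induction hn : (∑ r ∈ Icc 1 (d + 1), N r).toNat using Nat.strong_induction_on
    generalizing N U with
  | _ n ihn =>
  by_cases hneg : ∃ r, 1 ≤ r ∧ r ≤ d + 1 ∧ N r < 0
  · obtain ⟨r, h1, h2, h3⟩ := hneg
    rw [genPlain_vanish h1 h2 h3, genOver_vanish h1 h2 h3]
    exact ⟨isPowerSeries_zero, isPowerSeries_zero⟩
  push Not at hneg
  have hsub : ∀ r, 1 ≤ r → r ≤ d + 1 → ∀ {U : Finset ℕ}, (∀ x ∈ U, 2 ≤ x ∧ x ≤ d + 1) →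
      IsPowerSeries (genOver qL d U (N - Pi.single r 1)) := by
    intro r h1 h2 U hU
    rcases (hneg r h1 h2).eq_or_lt with h3 | h3
    · rw [genOver_vanish h1 h2 (by simp [← h3])]; exact isPowerSeries_zero
    · refine (ihn _ ?_ _ hU rfl).2
      have hr : r ∈ Icc 1 (d + 1) := mem_Icc.2 ⟨h1, h2⟩
      have := single_le_sum (f := N) (fun x hx => hneg x (mem_Icc.1 hx).1 (mem_Icc.1 hx).2) hr
      rw [sum_sub_single hr]
      omega
  have plain : ∀ U : Finset ℕ, (∀ x ∈ U, 2 ≤ x ∧ x ≤ d + 1) →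
      IsPowerSeries (genPlain qL d U N) := by
    intro U
    induction hc : U.card generalizing U with
    | zero =>
      obtain rfl := card_eq_zero.1 hc
      exact fun _ => isPowerSeries_layer_empty _ _ _
    | succ c ihc =>
      intro hU
      have hne : U.Nonempty := card_pos.1 (by omega)
      obtain ⟨u, hu, hmin, he⟩ := exists_eraseMin hne
      rw [genPlain_rec qL_ne_zero qL_pow_ne_one hU]
      exact (isPowerSeries_zpow (hneg 1 le_rfl (by omega))).mul
        ((hsub 1 le_rfl (by omega) hU).add
        (ihc _ (by rw [he, card_erase_of_mem hu, hc]; rfl)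
          (fun x hx => hU x (eraseMin_subset U hx))))
  refine ⟨plain U hU, ?_⟩
  by_cases hfull : ∀ x, 2 ≤ x → x ≤ d + 1 → x ∈ U
  · rw [genOver_full qL_ne_zero qL_pow_ne_one hfull]
    exact plain U hU
  · obtain ⟨r, h7, h5, h6, h8⟩ := exists_isNext_of_not_full hfull
    rw [genOver_rec qL_ne_zero qL_pow_ne_one h7 h5 h6 h8]
    refine (plain U hU).add ((isPowerSeries_zpow ?_).mul (hsub r (by omega) h6 ?_))
    · have := hneg 1 le_rfl (by omega); omega
    · intro x hx
      rcases mem_insert.1 hx with rfl | hx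
      · exact ⟨h5, h6⟩
      · exact hU x hx

lemma IsPowerSeries.initSum {g : Finset ℕ → (ℕ → ℤ) → LaurentSeries ℚ} {e s : ℕ} {U : Finset ℕ}
    (hs : 2 ≤ s) (hU : ∀ x ∈ U, 2 ≤ x)
    (hg : ∀ T N, (∀ x ∈ T, 2 ≤ x ∧ x < s + e) → IsPowerSeries (g T N)) (N : ℕ → ℤ) :
    IsPowerSeries (initSum g e s U N) := by
  induction e generalizing s U N with
  | zero => exact hg _ _ fun x hx => ⟨hU x (mem_filter.1 hx).1, (mem_filter.1 hx).2⟩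
  | succ e ih =>
    have h1 : IsPowerSeries (g (U.filter (· < s)) N) :=
      hg _ _ fun x hx => ⟨hU x (mem_filter.1 hx).1, by have := (mem_filter.1 hx).2; omega⟩
    rw [GordonMarking.initSum]
    split_ifs
    · refine ih (by omega) (fun x hx => hU x (mem_of_mem_erase hx)) (fun T N hT => hg T N ?_) N
      exact fun x hx => ⟨(hT x hx).1, by have := (hT x hx).2; omega⟩
    · refine (ih (by omega) (fun x hx => ?_) (fun T N hT => hg T N ?_) _).add h1
      · rcases mem_insert.1 hx with rfl | hx
        · exact hs
        · exact hU x hx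
      · exact fun x hx => ⟨(hT x hx).1, by have := (hT x hx).2; omega⟩

lemma gen_zero (d : ℕ) {N : ℕ → ℤ} (hN : ∀ r, 1 ≤ r → r ≤ d + 1 → N r = 0) {U : Finset ℕ}
    (hU : ∀ x ∈ U, 2 ≤ x ∧ x ≤ d + 1) : genPlain qL d U N = 1 ∧ genOver qL d U N = 1 := by
  have hsub : ∀ r, 1 ≤ r → r ≤ d + 1 → ∀ U, genOver qL d U (N - Pi.single r 1) = 0 :=
    fun r h1 h2 U => genOver_vanish h1 h2 (by simp [hN r h1 h2])
  have plain : ∀ U : Finset ℕ, (∀ x ∈ U, 2 ≤ x ∧ x ≤ d + 1) → genPlain qL d U N = 1 := by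
    intro U
    induction hc : U.card generalizing U with
    | zero =>
      obtain rfl := card_eq_zero.1 hc
      intro _
      rw [genPlain, layer_fst_closed_empty qL qL_ne_zero, hN 1 le_rfl (by omega),
        hN (1 + d) (by omega) (by omega), invQ_zero, sum_eq_zero, prod_eq_one]
      · simp [tri_zero]
      · intro r hr
        rw [mem_Ico] at hr
        rw [hN r (by omega) (by omega), hN (r + 1) (by omega) (by omega), sub_zero, invQ_zero]
      · intro r hr
        rw [mem_Ioc] at hr
        rw [hN r (by omega) (by omega)]; rfl
    | succ c ihc =>
      intro hU
      have hne : U.Nonempty := card_pos.1 (by omega)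
      obtain ⟨u, hu, hmin, he⟩ := exists_eraseMin hne
      rw [genPlain_rec qL_ne_zero qL_pow_ne_one hU, hsub 1 le_rfl (by omega),
        ihc _ (by rw [he, card_erase_of_mem hu, hc]; rfl)
          (fun x hx => hU x (eraseMin_subset U hx)), hN 1 le_rfl (by omega)]
      simp
  refine ⟨plain U hU, ?_⟩
  by_cases hfull : ∀ x, 2 ≤ x → x ≤ d + 1 → x ∈ U
  · rw [genOver_full qL_ne_zero qL_pow_ne_one hfull, plain U hU]
  · obtain ⟨r, h7, h5, h6, h8⟩ := exists_isNext_of_not_full hfull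
    rw [genOver_rec qL_ne_zero qL_pow_ne_one h7 h5 h6 h8, hsub r (by omega) h6, plain U hU]
    simp

/-! ### Counting lists by coefficients. -/

/-- The lists in `s` with sum `j` are counted by the coefficient of `q ^ j` in `f`. -/
def Counts (s : Set (List OPart)) (f : LaurentSeries ℚ) (j : ℤ) : Prop :=
  {L | L ∈ s ∧ partSum L = j}.Finite ∧ ({L | L ∈ s ∧ partSum L = j}.ncard : ℚ) = f.coeff j

lemma counts_of_empty {s : Set (List OPart)} {f : LaurentSeries ℚ} {j : ℤ}
    (hs : ∀ L ∈ s, partSum L ≠ j) (hf : f.coeff j = 0) : Counts s f j := by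
  have : {L | L ∈ s ∧ partSum L = j} = ∅ :=
    Set.eq_empty_of_forall_notMem fun L hL => hs L hL.1 hL.2
  simp [Counts, this, hf]

lemma counts_nil (j : ℤ) : Counts {[]} 1 j := by
  by_cases hj : j = 0
  · subst hj
    have : {L | L ∈ ({[]} : Set (List OPart)) ∧ partSum L = 0} = {[]} := by
      ext L; simp +contextual
    rw [Counts, this]
    simp
  · refine counts_of_empty ?_ ?_
    · rintro L rfl; exact Ne.symm hj
    · rw [HahnSeries.coeff_one, if_neg hj]

lemma Counts.union {s s' : Set (List OPart)} {f f' : LaurentSeries ℚ} {j : ℤ} (h : Counts s f j)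
    (h' : Counts s' f' j) (hd : ∀ L ∈ s, L ∉ s') : Counts (s ∪ s') (f + f') j := by
  have h1 : {L | L ∈ s ∪ s' ∧ partSum L = j}
      = {L | L ∈ s ∧ partSum L = j} ∪ {L | L ∈ s' ∧ partSum L = j} := by
    ext L; simp [or_and_right]
  refine ⟨h1 ▸ h.1.union h'.1, ?_⟩
  rw [h1, Set.ncard_union_eq _ h.1 h'.1]
  · rw [HahnSeries.coeff_add, ← h.2, ← h'.2]; push_cast; rfl
  · exact Set.disjoint_left.2 fun L hL hL' => hd L hL.1 hL'.1

lemma Counts.cons {s : Set (List OPart)} {f : LaurentSeries ℚ} {j : ℤ} (p : OPart)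
    (h : Counts s f (j - p.1)) : Counts ((p :: ·) '' s) (qL ^ (p.1 : ℤ) * f) j := by
  have h1 : {L | L ∈ (p :: ·) '' s ∧ partSum L = j}
      = (p :: ·) '' {L | L ∈ s ∧ partSum L = j - p.1} := by
    ext L
    constructor
    · rintro ⟨⟨L, hL, rfl⟩, h⟩
      simp only [partSum_cons] at h
      exact ⟨L, ⟨hL, by omega⟩, rfl⟩
    · rintro ⟨L, ⟨hL, h⟩, rfl⟩
      exact ⟨⟨L, hL, rfl⟩, by simp [h]⟩
  refine ⟨h1 ▸ h.1.image _, ?_⟩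
  rw [h1, Set.ncard_image_of_injective _ (List.cons_injective), h.2, coeff_qL_zpow_mul]

lemma Counts.congr {s : Set (List OPart)} {f f' : LaurentSeries ℚ} {j : ℤ} (h : Counts s f j)
    (hf : f = f') : Counts s f' j := hf ▸ h

/-! ### Lists without further `(k-1)`-marked parts. -/

/-- The generating function above a complete position, when no `(k - 1)`-marked part is left;
the marks are those up to `d + 1`. -/
noncomputable def genAbove (d : ℕ) (b : Bool) (T : Finset ℕ) (N : ℕ → ℤ) : LaurentSeries ℚ :=
  if b = true then genOver qL d T N else genPlain qL d (eraseMin T) N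

/-- The marks from `r` on are still to be considered, `e` of them; `W` records `T` below `r` and `U`
from `r` on. The choice between a further part `t` with mark `r` and leaving the size `t` is the
recursion of `initSum`. The mark `d + 2` cannot occur, as `N (d + 2) = 0`. `H` is asked only for
fewer parts or for unchanged data, so that inductions can supply it. -/
lemma counts_tails {d t : ℕ} {b : Bool} {j : ℤ} {g : Finset ℕ → (ℕ → ℤ) → LaurentSeries ℚ}
    {e r : ℕ} {U T W : Finset ℕ} {N : ℕ → ℤ} (hr : 2 ≤ r) (hre : r + e = d + 2)
    (hN : N (d + 2) = 0)
    (hT : ∀ x ∈ T, 2 ≤ x ∧ x < r) (hUT : ∀ x, 2 ≤ x → x < r → x ∈ U ∪ T)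
    (hW1 : ∀ x, r ≤ x → (x ∈ W ↔ x ∈ U)) (hW2 : ∀ x < r, (x ∈ W ↔ x ∈ T))
    (H : ∀ T N' j', (∀ x ∈ T, 2 ≤ x ∧ x ≤ d + 1) → N' (d + 2) = 0 →
      (∑ x ∈ Icc 1 (d + 1), N' x < ∑ x ∈ Icc 1 (d + 1), N x ∨ N' = N ∧ j' = j) →
      Counts (tailsAbove (d + 3) t b T N')
        (qL ^ (t * ∑ x ∈ Icc 1 (d + 1), N' x) * g T N') j') :
    Counts (tails (d + 3) t b U T N)
      (qL ^ (t * ∑ x ∈ Icc 1 (d + 1), N x) * initSum g e r W N) j := by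
  induction e generalizing r T W N j with
  | zero =>
    have hf : W.filter (· < r) = T := by
      ext x
      simp only [mem_filter]
      constructor
      · rintro ⟨h1, h2⟩; exact (hW2 x h2).1 h1
      · intro h; have := (hT x h).2; exact ⟨(hW2 x this).2 h, this⟩
    have hV := H T N j (fun x hx => ⟨(hT x hx).1, by have := (hT x hx).2; omega⟩) hN
      (.inr ⟨rfl, rfl⟩)
    rw [initSum, hf]
    rcases filled_or_isNext (d + 3) (U ∪ T) with h | ⟨s, hs⟩
    · rwa [tails_of_filled h]
    · rw [tails_of_isNext hs (by simpa using hN)]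
      have : s = d + 2 := by
        by_contra hne
        exact hs.2.2.1 (hUT s hs.1 (by have := hs.2.1; omega))
      rw [tails_of_neg (r := d + 2) (by omega) (by omega) (by simp [this, hN])]
      simpa using hV
  | succ e ih =>
    have hf : W.filter (· < r) = T := by
      ext x
      simp only [mem_filter]
      constructor
      · rintro ⟨h1, h2⟩; exact (hW2 x h2).1 h1
      · intro h; have := (hT x h).2; exact ⟨(hW2 x this).2 h, this⟩
    have hrT : r ∉ T := fun h => lt_irrefl _ (hT r h).2
    by_cases hrU : r ∈ U
    · rw [initSum, if_pos ((hW1 r le_rfl).2 hrU)]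
      refine ih (by omega) (by omega) hN (fun x hx => ⟨(hT x hx).1, by
        have := (hT x hx).2; omega⟩) ?_ ?_ ?_ H
      · intro x h1 h2
        rcases eq_or_lt_of_le (Nat.lt_succ_iff.1 h2) with rfl | h2
        · exact mem_union_left _ hrU
        · exact hUT x h1 h2
      · intro x hx
        rw [mem_erase, hW1 x (by omega)]
        exact ⟨fun h => h.2, fun h => ⟨by omega, h⟩⟩
      · intro x hx
        rw [mem_erase]
        rcases eq_or_lt_of_le (Nat.lt_succ_iff.1 hx) with rfl | h2
        · simp [hrT]
        · rw [hW2 x h2]; exact ⟨fun h => h.2, fun h => ⟨by omega, h⟩⟩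
    · have hnext : IsNext (d + 3) (U ∪ T) r :=
        ⟨hr, by omega, by simp [hrU, hrT], hUT⟩
      rw [initSum, if_neg (fun h => hrU ((hW1 r le_rfl).1 h)), tails_of_isNext hnext (by simpa),
        hf, mul_add]
      have hrI : r ∈ Icc 1 (d + 1) := mem_Icc.2 ⟨by omega, by omega⟩
      have hN' : (N - Pi.single r 1 : ℕ → ℤ) (d + 2) = 0 := by
        simp [hN, Pi.single_eq_of_ne (show d + 2 ≠ r by omega)]
      refine Counts.union ?_ ?_ ?_
      · have h1 := ih (r := r + 1) (T := insert r T) (W := insert r W) (N := N - Pi.single r 1)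
          (j := j - t) (by omega) (by omega) hN' ?_ ?_ ?_ ?_ ?_
        · refine (Counts.cons ((t, false) : OPart) h1).congr ?_
          rw [← mul_assoc, ← zpow_add₀ qL_ne_zero, sum_sub_single hrI]
          congr 2
          ring
        · intro x hx
          rcases mem_insert.1 hx with rfl | hx
          · omega
          · have := hT x hx; omega
        · intro x h1 h2
          rcases eq_or_lt_of_le (Nat.lt_succ_iff.1 h2) with rfl | h2
          · simp
          · have := hUT x h1 h2
            rw [mem_union] at this ⊢
            exact this.imp id (mem_insert_of_mem)
        · intro x hx
          rw [mem_insert, hW1 x (by omega)]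
          exact ⟨fun h => h.resolve_left (by omega), .inr⟩
        · intro x hx
          rw [mem_insert, mem_insert]
          rcases eq_or_lt_of_le (Nat.lt_succ_iff.1 hx) with rfl | h2
          · simp
          · rw [hW2 x h2]
        · intro T N' j' h1 h2 h3
          refine H T N' j' h1 h2 (.inl ?_)
          rcases h3 with h3 | ⟨rfl, -⟩
          · rw [sum_sub_single hrI] at h3; omega
          · rw [sum_sub_single hrI]; omega
      · exact H T N j (fun x hx => ⟨(hT x hx).1, by have := (hT x hx).2; omega⟩) hN
          (.inr ⟨rfl, rfl⟩)
      · rintro L ⟨L, -, rfl⟩ h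
        exact absurd (lt_of_mem_tailsAbove h) (by simp)

lemma positionRec_genAbove {d : ℕ} {b : Bool} {T : Finset ℕ} (N : ℕ → ℤ)
    (hT : ∀ x ∈ (if b = true then T else eraseMin T), 2 ≤ x ∧ x ≤ d + 1) :
    genAbove d b T N = qL ^ (∑ r ∈ Icc 1 (d + 1), N r)
      * (initSum (genAbove d true) d 2 (if b = true then T else eraseMin T) (N - Pi.single 1 1)
        + if b = true then initSum (genAbove d false) d 2 T N else genAbove d false ∅ N) := by
  have h := positionRec qL_ne_zero qL_pow_ne_one N hT
  have h1 : genAbove d true = genOver qL d := by ext; simp [genAbove]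
  have h2 : genAbove d false = fun T N => genPlain qL d (eraseMin T) N := by ext; simp [genAbove]
  rw [h1, h2]
  cases b
  · simp only [genAbove, Bool.false_eq_true, if_false, eraseMin_empty] at h ⊢
    rw [h.1, add_comm (genPlain qL d ∅ N)]
  · simp only [genAbove, if_true] at h ⊢
    exact h.2

lemma isPowerSeries_genAbove {d : ℕ} {b : Bool} {T : Finset ℕ} (N : ℕ → ℤ)
    (hT : ∀ x ∈ (if b = true then T else eraseMin T), 2 ≤ x ∧ x ≤ d + 1) :
    IsPowerSeries (genAbove d b T N) := by
  cases b
  · exact (isPowerSeries_gen d N hT).1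
  · exact (isPowerSeries_gen d N hT).2

lemma genAbove_congr {d : ℕ} {b : Bool} {T T' : Finset ℕ} {N N' : ℕ → ℤ}
    (hT : ∀ x, 2 ≤ x → x ≤ d + 1 → (x ∈ (if b = true then T else eraseMin T) ↔
      x ∈ (if b = true then T' else eraseMin T')))
    (hN : ∀ x, 1 ≤ x → x ≤ d + 1 → N x = N' x) : genAbove d b T N = genAbove d b T' N' := by
  cases b
  · exact genPlain_congr hT hN
  · exact genOver_congr hT hN

lemma initSum_congr_set {K : Type*} [Field K] {g : Finset ℕ → (ℕ → ℤ) → K} {e r : ℕ}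
    {U U' : Finset ℕ} (N : ℕ → ℤ) (h : ∀ x < r + e, (x ∈ U ↔ x ∈ U')) :
    initSum g e r U N = initSum g e r U' N := by
  induction e generalizing r U U' N with
  | zero =>
    rw [initSum, initSum]
    congr 1
    ext x
    simp only [mem_filter]
    constructor
    · rintro ⟨h1, h2⟩; exact ⟨(h x h2).1 h1, h2⟩
    · rintro ⟨h1, h2⟩; exact ⟨(h x h2).2 h1, h2⟩
  | succ e ih =>
    have hf : U.filter (· < r) = U'.filter (· < r) := by
      ext x
      simp only [mem_filter]
      constructor
      · rintro ⟨h1, h2⟩; exact ⟨(h x (by omega)).1 h1, h2⟩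
      · rintro ⟨h1, h2⟩; exact ⟨(h x (by omega)).2 h1, h2⟩
    have h1 := ih (r := r + 1) (U := U.erase r) (U' := U'.erase r) N fun x hx => by
      rw [mem_erase, mem_erase, h x (by omega)]
    have h2 := ih (r := r + 1) (U := insert r U) (U' := insert r U') (N - Pi.single r 1) fun x hx => by
      rw [mem_insert, mem_insert, h x (by omega)]
    simp only [initSum, hf, h1, h2, h r (by omega)]

/-- The set `T` may contain the mark `d + 2`, which `genAbove` does not see; the recursion was
proved for sets without it. -/
lemma exists_restrict (d : ℕ) {b : Bool} {T : Finset ℕ}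
    (hT : ∀ x ∈ (if b = true then T else eraseMin T), 2 ≤ x) :
    ∃ T' : Finset ℕ, (∀ x ∈ (if b = true then T' else eraseMin T'), 2 ≤ x ∧ x ≤ d + 1) ∧
      (∀ x ≤ d + 1, (x ∈ (if b = true then T else eraseMin T) ↔
        x ∈ (if b = true then T' else eraseMin T'))) := by
  cases b
  · simp only [Bool.false_eq_true, if_false] at hT ⊢
    have h : ∀ x ∈ (eraseMin T).filter (· ≤ d + 1), 2 ≤ x ∧ x ≤ d + 1 := fun x hx =>
      ⟨hT x (mem_filter.1 hx).1, (mem_filter.1 hx).2⟩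
    -- The dummy element `0` is the one that `eraseMin` removes.
    refine ⟨insert 0 ((eraseMin T).filter (· ≤ d + 1)), ?_⟩
    rw [eraseMin_insert fun x hx => by have := (h x hx).1; omega]
    exact ⟨h, fun x hx => by simp [hx]⟩
  · simp only [if_true] at hT ⊢
    exact ⟨T.filter (· ≤ d + 1), fun x hx => ⟨hT x (mem_filter.1 hx).1, (mem_filter.1 hx).2⟩,
      fun x hx => by simp [hx]⟩

/-- The count when no `(k - 1)`-marked part is left. -/
theorem counts_tailsAbove {d t : ℕ} {b : Bool} {T : Finset ℕ} {N : ℕ → ℤ} {j : ℤ}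
    (hN : N (d + 2) = 0)
    (hT : ∀ x ∈ (if b = true then T else eraseMin T), 2 ≤ x) :
    Counts (tailsAbove (d + 3) t b T N)
      (qL ^ (t * ∑ x ∈ Icc 1 (d + 1), N x) * genAbove d b T N) j := by
  induction hn : (∑ r ∈ Icc 1 (d + 1), N r).toNat using Nat.strong_induction_on
    generalizing N t b T j with
  | _ n ihn =>
  by_cases hneg : ∃ r, 1 ≤ r ∧ r ≤ d + 1 ∧ N r < 0
  · obtain ⟨r, h1, h2, h3⟩ := hneg
    rw [tailsAbove_of_neg h1 (by omega) h3]
    refine counts_of_empty (by simp) ?_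
    cases b <;> simp [genAbove, genOver_vanish h1 h2 h3, genPlain_vanish h1 h2 h3]
  push Not at hneg
  set S := ∑ r ∈ Icc 1 (d + 1), N r with hS
  have hS0 : 0 ≤ S := sum_nonneg fun x hx => hneg x (mem_Icc.1 hx).1 (mem_Icc.1 hx).2
  have hS1 : ∑ r ∈ Icc 1 (d + 1), (N - Pi.single 1 1 : ℕ → ℤ) r = S - 1 :=
    sum_sub_single (by simp) N
  have hzero : S = 0 → ∀ {t : ℕ} {b : Bool} {T : Finset ℕ} {j : ℤ},
      (∀ x ∈ (if b = true then T else eraseMin T), 2 ≤ x) →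
      Counts (tailsAbove (d + 3) t b T N) (qL ^ (t * S) * genAbove d b T N) j := by
    intro h0 t b T j hT
    have hN0 : ∀ r, 1 ≤ r → r ≤ d + 1 → N r = 0 := by
      intro r h1 h2
      exact (sum_eq_zero_iff_of_nonneg
        (fun x hx => hneg x (mem_Icc.1 hx).1 (mem_Icc.1 hx).2)).1 h0 r (mem_Icc.2 ⟨h1, h2⟩)
    rw [tailsAbove_zero (by omega) (fun r h1 h2 => ?_)]
    · refine (counts_nil j).congr ?_
      obtain ⟨T', h1, h2⟩ := exists_restrict d hT
      rw [h0, genAbove_congr (T' := T') (N' := N) (fun x _ h => h2 x h) (fun _ _ _ => rfl)]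
      have := gen_zero d hN0 h1
      cases b
      · simpa [genAbove] using this.1.symm
      · simpa [genAbove] using this.2.symm
    · rcases eq_or_lt_of_le (show r ≤ d + 2 by omega) with rfl | h3
      · exact hN
      · exact hN0 r h1 (by omega)
  rcases hS0.eq_or_lt with h0 | hpos
  · exact hzero h0.symm hT
  have hne : ∃ r, 1 ≤ r ∧ r ≤ d + 1 ∧ N r ≠ 0 := by
    by_contra hc
    push Not at hc
    exact hpos.ne' (sum_eq_zero fun x hx => hc x (mem_Icc.1 hx).1 (mem_Icc.1 hx).2)
  -- induction on `j - t`
  induction hm : (j - t).toNat using Nat.strong_induction_on generalizing t b T j with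
  | _ m ihm =>
  obtain ⟨T', hT'1, hT'2⟩ := exists_restrict d hT
  have hrec : genAbove d b T N = qL ^ S
      * (initSum (genAbove d true) d 2 (if b = true then T else eraseMin T) (N - Pi.single 1 1)
        + if b = true then initSum (genAbove d false) d 2 T N else genAbove d false ∅ N) := by
    rw [genAbove_congr (T' := T') (N' := N) (fun x _ h => hT'2 x h) (fun _ _ _ => rfl),
      positionRec_genAbove N hT'1, ← hS]
    congr 2
    · exact initSum_congr_set _ fun x hx => (hT'2 x (by omega)).symm
    · cases b
      · rfl
      · exact initSum_congr_set _ fun x hx => (hT'2 x (by omega)).symm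
  have hps : ∀ (b : Bool) (U : Finset ℕ) (M : ℕ → ℤ), (∀ x ∈ U, 2 ≤ x) →
      IsPowerSeries (initSum (genAbove d b) d 2 U M) := by
    intro b U M hU
    refine IsPowerSeries.initSum le_rfl hU (fun T N hT => isPowerSeries_genAbove N ?_) M
    intro x hx
    have : x ∈ T := by
      cases b
      · exact eraseMin_subset T hx
      · exact hx
    have := hT x this
    omega
  rw [hrec]
  -- For `j ≤ t` both sides vanish: a list contains a part greater than `t`, and the exponents of
  -- the series are at least `(t + 1) * S`, where `S > 0`.
  rcases le_or_gt j t with hjt | hjt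
  · refine counts_of_empty ?_ ?_
    · rintro (_ | ⟨p, ps⟩) hL
      · obtain ⟨r, h1, h2, h3⟩ := hne
        exact absurd (hL r h1 (by omega)) h3
      · have h1 := lt_of_mem_tailsAbove hL
        have h2 := partSum_nonneg ps
        rw [partSum_cons]
        omega
    · rw [coeff_qL_zpow_mul, coeff_qL_zpow_mul]
      refine IsPowerSeries.coeff_eq_zero ((hps true _ _ hT).add ?_) (by nlinarith)
      cases b
      · exact isPowerSeries_genAbove (b := false) (T := ∅) N (by simp)
      · exact hps false T N hT
  have hw : qL ^ ((t + 1 : ℕ) : ℤ) * qL ^ (((t + 1 : ℕ) : ℤ) * (S - 1)) = qL ^ (t * S) * qL ^ S := by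
    rw [← zpow_add₀ qL_ne_zero, ← zpow_add₀ qL_ne_zero]; congr 1; push_cast; ring
  have hw' : qL ^ (((t + 1 : ℕ) : ℤ) * S) = qL ^ (t * S) * qL ^ S := by
    rw [← zpow_add₀ qL_ne_zero]; congr 1; push_cast; ring
  have hover : ∀ U : Finset ℕ, (∀ x ∈ U, 2 ≤ x) → Counts ((((t + 1, true) : OPart) :: ·) ''
      tails (d + 3) (t + 1) true U ∅ (N - Pi.single 1 1))
      (qL ^ (t * S) * qL ^ S * initSum (genAbove d true) d 2 U (N - Pi.single 1 1)) j := by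
    intro U hU
    have h1 := counts_tails (d := d) (t := t + 1) (b := true) (j := j - (t + 1 : ℕ)) (g := genAbove d true)
      (e := d) (r := 2) (U := U) (T := ∅) (W := U) (N := N - Pi.single 1 1) le_rfl (by omega)
      (by simp [hN]) (by simp) (by omega) (fun _ _ => Iff.rfl)
      (fun x hx => by
        simp only [notMem_empty, iff_false]
        intro h
        have := hU x h
        omega) ?_
    · rw [hS1] at h1
      refine (Counts.cons ((t + 1, true) : OPart) h1).congr ?_
      rw [← hw]
      ring
    · intro T N' j' h1 h2 h3
      refine ihn _ ?_ h2 (b := true) (T := T) (fun x hx => (h1 x hx).1) rfl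
      rcases h3 with h3 | ⟨rfl, -⟩
      · rw [hS1] at h3; omega
      · rw [hS1]; omega
  rw [← mul_assoc, mul_add]
  cases b
  · rw [tailsAbove_false T (by simpa using hN)]
    refine Counts.union (hover _ hT) ?_ ?_
    -- An absent size uses up no part, so here only `j - t` decreases.
    · have h1 := ihm (j - (t + 1 : ℕ)).toNat (by omega) (t := t + 1) (b := false) (T := ∅) (j := j)
        (by simp) rfl
      rw [hw'] at h1
      exact h1
    · rintro L ⟨L, -, rfl⟩ h
      exact absurd (lt_of_mem_tailsAbove h) (by simp)
  · rw [tailsAbove_true]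
    refine Counts.union (hover _ hT) ?_ ?_
    · have h1 := counts_tails (d := d) (t := t + 1) (b := false) (j := j)
        (g := genAbove d false)
        (e := d) (r := 2) (U := T) (T := ∅) (W := T) (N := N) le_rfl (by omega)
        hN (by simp) (by omega) (fun _ _ => Iff.rfl)
        (fun x hx => by
          simp only [notMem_empty, iff_false]
          intro h
          have := hT x h
          omega) ?_
      · rw [← hS, hw'] at h1
        exact h1
      · intro T N' j' h1 h2 h3
        have h4 : ∀ x ∈ (if false = true then T else eraseMin T), 2 ≤ x :=
          fun x hx => (h1 x (eraseMin_subset T hx)).1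
        rcases h3 with h3 | ⟨rfl, rfl⟩
        · exact ihn _ (by omega) h2 h4 rfl
        · exact ihm (j' - (t + 1 : ℕ)).toNat (by omega) h4 rfl
    · rintro L ⟨L, -, rfl⟩ h
      rcases head_of_mem_tails h with h | h
      · simp at h
      · simp at h

/-! ### Lists with further `(k-1)`-marked parts. -/

/-- The lists in `s` are counted, according to their sum, by `f`. -/
def CountedBy (s : Set (List OPart)) (f : LaurentSeries ℚ) : Prop := ∀ j, Counts s f j

lemma CountedBy.congr {s : Set (List OPart)} {f f' : LaurentSeries ℚ} (h : CountedBy s f)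
    (hf : f = f') : CountedBy s f' := hf ▸ h

lemma CountedBy.cons {s : Set (List OPart)} {f : LaurentSeries ℚ} (p : OPart)
    (h : CountedBy s f) : CountedBy ((p :: ·) '' s) (qL ^ (p.1 : ℤ) * f) :=
  fun _ => Counts.cons p (h _)

lemma countedBy_empty : CountedBy ∅ 0 := fun _ => counts_of_empty (by simp) rfl

lemma countedBy_tailsAbove_true {k t : ℕ} {T : Finset ℕ} {N : ℕ → ℤ} {f f' : LaurentSeries ℚ}
    (h : CountedBy ((((t + 1, true) : OPart) :: ·) '' tails k (t + 1) true T ∅ (N - Pi.single 1 1)) f)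
    (h' : CountedBy (tails k (t + 1) false T ∅ N) f') :
    CountedBy (tailsAbove k t true T N) (f + f') := by
  intro j
  rw [tailsAbove_true]
  refine (h j).union (h' j) ?_
  rintro L ⟨L, -, rfl⟩ hL
  rcases head_of_mem_tails hL with h | h <;> simp at h

/-- The indicator function of `R`. -/
def ind (R : Finset ℕ) : ℕ → ℤ := fun x => if x ∈ R then 1 else 0

lemma sum_sub_ind {s R : Finset ℕ} (h : R ⊆ s) (N : ℕ → ℤ) :
    ∑ x ∈ s, (N - ind R : ℕ → ℤ) x = ∑ x ∈ s, N x - R.card := by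
  simp only [Pi.sub_apply, sum_sub_distrib, ind, sum_ite_mem, inter_eq_right.2 h]
  simp

/-- If `(k - 1)`-marked parts are still to come, then all the marks have to be used. -/
lemma countedBy_tails_of_ne {k t : ℕ} (hk : 2 ≤ k) {b : Bool} {U T R : Finset ℕ} {N : ℕ → ℤ}
    {f : LaurentSeries ℚ} (hR : R = Icc 2 (k - 1) \ (U ∪ T)) (hN : R.Nonempty → N (k - 1) ≠ 0)
    (h : CountedBy (tailsAbove k t b (T ∪ R) (N - ind R)) f) :
    CountedBy (tails k t b U T N) (qL ^ ((t : ℤ) * R.card) * f) := by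
  induction hc : R.card generalizing T N R with
  | zero =>
    obtain rfl := card_eq_zero.1 hc
    have h1 : Filled k (U ∪ T) := by
      intro x h1 h2
      by_contra h3
      have : x ∈ Icc 2 (k - 1) \ (U ∪ T) := mem_sdiff.2 ⟨mem_Icc.2 ⟨h1, h2⟩, h3⟩
      rw [← hR] at this
      simp at this
    have h2 : ind ∅ = 0 := by ext; simp [ind]
    rw [tails_of_filled h1]
    simpa [h2] using h
  | succ c ih =>
    have hne : R.Nonempty := card_pos.1 (by omega)
    rcases filled_or_isNext k (U ∪ T) with h1 | ⟨r, hr⟩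
    · obtain ⟨x, hx⟩ := hne
      rw [hR, mem_sdiff, mem_Icc] at hx
      exact absurd (h1 x hx.1.1 hx.1.2) hx.2
    · have hrR : r ∈ R := by
        rw [hR]; exact mem_sdiff.2 ⟨mem_Icc.2 ⟨hr.1, hr.2.1⟩, hr.2.2.1⟩
      rw [tails_of_isNext_of_ne hk hr (hN hne)]
      have h2 := ih (T := insert r T) (N := N - Pi.single r 1) (R := R.erase r) ?_ ?_ ?_ ?_
      · refine (CountedBy.cons ((t, false) : OPart) h2).congr ?_
        rw [← mul_assoc, ← zpow_add₀ qL_ne_zero]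
        congr 2
        push_cast
        ring
      · rw [hR]
        ext x
        simp only [mem_erase, mem_sdiff, mem_union, mem_insert]
        tauto
      · rintro ⟨x, hx⟩
        rw [mem_erase, hR, mem_sdiff, mem_Icc] at hx
        -- The mark `k - 1` is given out last, so `N (k - 1)` is unchanged while other marks remain.
        have h3 : r ≠ k - 1 := by
          rintro rfl
          exact hx.2.2 (hr.2.2.2 x hx.2.1.1 (by omega))
        simpa [Pi.single_eq_of_ne h3.symm] using hN hne
      · have h3 : insert r T ∪ R.erase r = T ∪ R := by
          ext x
          simp only [mem_union, mem_insert, mem_erase]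
          by_cases h : x = r
          · subst h; simp [hrR]
          · simp [h]
        have h4 : N - Pi.single r 1 - ind (R.erase r) = N - ind R := by
          ext x
          simp only [Pi.sub_apply, ind, mem_erase]
          by_cases h : x = r
          · subst h; simp [hrR]
          · simp [h]
        rw [h3, h4]
        exact h
      · rw [card_erase_of_mem hrR, hc]; rfl

lemma eraseMin_filter_le (W : Finset ℕ) (m : ℕ) :
    eraseMin (W.filter (· ≤ m)) = (eraseMin W).filter (· ≤ m) := by
  rcases W.eq_empty_or_nonempty with rfl | hW
  · simp
  obtain ⟨u, hu, hmin, he⟩ := exists_eraseMin hW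
  by_cases hum : u ≤ m
  · rw [he, eraseMin_eq (u := u) (mem_filter.2 ⟨hu, hum⟩) fun x hx => hmin x (mem_filter.1 hx).1,
      filter_erase]
  · have h1 : W.filter (· ≤ m) = ∅ := filter_eq_empty_iff.2 fun x hx h => hum ((hmin x hx).trans h)
    have h2 : (eraseMin W).filter (· ≤ m) = ∅ :=
      filter_eq_empty_iff.2 fun x hx h => hum ((hmin x (eraseMin_subset W hx)).trans h)
    rw [h1, h2, eraseMin_empty]

lemma card_eraseMin {W : Finset ℕ} (hW : W.Nonempty) : (eraseMin W).card + 1 = W.card := by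
  obtain ⟨u, hu, -, he⟩ := exists_eraseMin hW
  rw [he, card_erase_add_one hu]

/-- The blocked sets may now contain `d + 2`, which both functions ignore. -/
lemma genPlain_rec_of_two_le {d : ℕ} {W : Finset ℕ} (hW : ∀ x ∈ W, 2 ≤ x) (N : ℕ → ℤ) :
    genPlain qL d W N
      = qL ^ N 1 * (genOver qL d W (N - Pi.single 1 1) + genPlain qL d (eraseMin W) N) := by
  have h : ∀ W : Finset ℕ, ∀ x, 2 ≤ x → x ≤ d + 1 → (x ∈ W ↔ x ∈ W.filter (· ≤ d + 1)) :=
    fun W x _ h => by simp [h]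
  rw [genPlain_congr (h W) fun _ _ _ => rfl, genOver_congr (h W) fun _ _ _ => rfl,
    genPlain_congr (h (eraseMin W)) fun _ _ _ => rfl, ← eraseMin_filter_le]
  exact genPlain_rec qL_ne_zero qL_pow_ne_one
    (fun x hx => ⟨hW x (mem_filter.1 hx).1, (mem_filter.1 hx).2⟩) N

lemma genAbove_true (d : ℕ) (T : Finset ℕ) (N : ℕ → ℤ) : genAbove d true T N = genOver qL d T N :=
  if_pos rfl

lemma genAbove_false (d : ℕ) (T : Finset ℕ) (N : ℕ → ℤ) :
    genAbove d false T N = genPlain qL d (eraseMin T) N :=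
  if_neg Bool.false_ne_true

/-- The exponent of `q` for `n` parts of mark `d + 2`, when there are `s` parts in all and `a` of
mark `1`. -/
def fillExp (d : ℕ) (n s a w : ℤ) : ℤ :=
  2 * n * s - n * a + n - tri n - (d + 1) * n ^ 2 + n * w

lemma fillExp_succ (d : ℕ) (n s a w : ℤ) :
    fillExp d (n + 1) s a w
      = 2 * (n + 1) * s - (n + 1) * a - tri n - (d + 1) * (n + 1) ^ 2 + (n + 1) * w := by
  rw [fillExp, tri_add_one]; ring

set_option maxHeartbeats 400000 in
/-- The count when parts of mark `d + 2` are left. -/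
theorem countedBy_tailsAbove {d : ℕ} (n : ℕ) {t : ℕ} {b : Bool} {T W : Finset ℕ} {N : ℕ → ℤ}
    (hN : N (d + 2) = n) (hWT : W = if b = true then T else eraseMin T)
    (hW : W ⊆ Icc 2 (d + 2))
    (hb : d + 2 ∈ W ∨ b = false ∧ W = ∅ ∧ T.Nonempty) :
    CountedBy (tailsAbove (d + 3) t b T N)
      (qL ^ (t * ∑ x ∈ Icc 1 (d + 2), N x + fillExp d n (∑ x ∈ Icc 1 (d + 2), N x) (N 1) W.card)
        * genAbove d b T (fun x => N x - n)) := by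
  induction n generalizing t b T W N with
  | zero =>
    intro j
    refine (counts_tailsAbove hN fun x hx => ?_).congr ?_
    · exact (mem_Icc.1 (hW (hWT ▸ hx))).1
    · rw [sum_Icc_succ_top (by omega : 1 ≤ d + 1 + 1), show d + 1 + 1 = d + 2 from rfl, hN]
      simp [fillExp, tri_zero]
  | succ n ih =>
    have hk : 2 ≤ d + 3 := by omega
    set F := Icc 2 (d + 2) with hF
    set S := ∑ x ∈ Icc 1 (d + 2), N x with hS
    have h1I : (1 : ℕ) ∈ Icc 1 (d + 2) := by simp
    have hFI : F ⊆ Icc 1 (d + 2) := Icc_subset_Icc_left (by omega)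
    have hFc : F.card = d + 1 := by simp [hF]
    have hne : N (d + 3 - 1) ≠ 0 := by
      show N (d + 2) ≠ 0
      rw [hN]; push_cast; omega
    have fill : ∀ {t : ℕ} {b : Bool} {U R : Finset ℕ} {M : ℕ → ℤ} {f : LaurentSeries ℚ},
        R = F \ U → M (d + 2) ≠ 0 → CountedBy (tailsAbove (d + 3) t b R (M - ind R)) f →
        CountedBy (tails (d + 3) t b U ∅ M) (qL ^ ((t : ℤ) * R.card) * f) := by
      intro t b U R M f hR hM h
      exact countedBy_tails_of_ne hk (by rw [hR, union_empty]; rfl) (fun _ => hM)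
        (by rwa [empty_union])
    have hsd : ∀ {W : Finset ℕ}, W ⊆ F → W = F \ (F \ W) := fun h => (Finset.sdiff_sdiff_eq_self h).symm
    -- An overlined `t + 1` is followed by forced parts with the marks `F \ W`, and the size `t + 2`
    -- by the marks `W`: together with the overlined part every mark is used once. If `t + 2` is
    -- overlined as well (`A`) or not (`B`), the two terms of `genPlain_rec` arise.
    have step : ∀ {t : ℕ} {W : Finset ℕ}, W ⊆ F → d + 2 ∈ W →
        CountedBy ((((t + 1, true) : OPart) :: ·) ''
            tails (d + 3) (t + 1) true W ∅ (N - Pi.single 1 1))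
          (qL ^ (t * S + fillExp d (n + 1 : ℕ) S (N 1) W.card)
            * genPlain qL d W (fun x => N x - (n + 1 : ℕ))) := by
      intro t W hW hdW
      have hWne : W.Nonempty := ⟨_, hdW⟩
      have hcard : ((F \ W).card : ℤ) = d + 1 - W.card := by
        have := card_sdiff_add_card_eq_card hW
        omega
      have hM : (N - Pi.single 1 1 - ind (F \ W) : ℕ → ℤ) (d + 2) ≠ 0 := by
        simpa [ind, hdW, hN] using (by omega : (n : ℤ) + 1 ≠ 0)
      have e2 : ∀ x, 1 ≤ x → x ≤ d + 2 → (N - Pi.single 1 1 - ind (F \ W) - ind W : ℕ → ℤ) x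
          = N x - 1 := by
        intro x h1 h2
        by_cases hx : x = 1
        · have : (1 : ℕ) ∉ W := fun h => by have := mem_Icc.1 (hW h); omega
          subst hx; simp [ind, hF, this]
        · have hxF : x ∈ F := mem_Icc.2 ⟨by omega, h2⟩
          by_cases hxW : x ∈ W <;> simp [ind, hxW, hxF, Pi.single_eq_of_ne hx]
      have e1 : (N - Pi.single 1 1 - ind (F \ W) - Pi.single 1 1 - ind W : ℕ → ℤ)
          = N - Pi.single 1 1 - ind (F \ W) - ind W - Pi.single 1 1 := by abel
      have hdne : d + 2 ≠ 1 := by omega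
      have s2 : ∑ x ∈ Icc 1 (d + 2), (N - Pi.single 1 1 - ind (F \ W) - ind W : ℕ → ℤ) x
          = S - d - 2 := by
        rw [sum_sub_ind (hW.trans hFI), sum_sub_ind (sdiff_subset.trans hFI), sum_sub_single h1I,
          hcard]
        ring
      have A := ih (t := t + 2) (b := true) (T := W) (W := W)
        (N := N - Pi.single 1 1 - ind (F \ W) - Pi.single 1 1 - ind W) (by
          rw [e1, Pi.sub_apply, e2 _ (by omega) le_rfl, hN, Pi.single_eq_of_ne hdne]
          push_cast; ring) rfl hW (.inl hdW)
      have B := ih (t := t + 2) (b := false) (T := W) (W := eraseMin W)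
        (N := N - Pi.single 1 1 - ind (F \ W) - ind W) (by
          rw [e2 _ (by omega) le_rfl, hN]
          push_cast; ring) rfl ((eraseMin_subset W).trans hW) (by
          -- The mark `d + 2` is erased only from `W = {d + 2}`; this is why the second alternative
          -- of `hb` is needed.
          obtain ⟨u, hu, hmin, he⟩ := exists_eraseMin hWne
          rcases eq_or_ne u (d + 2) with rfl | h
          · refine .inr ⟨rfl, ?_, hWne⟩
            rw [he]
            refine eq_empty_of_forall_notMem fun x hx => ?_
            have h1 := mem_erase.1 hx
            have h2 := hmin x h1.2
            have h3 := (mem_Icc.1 (hW h1.2)).2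
            omega
          · left
            rw [he]
            exact mem_erase.2 ⟨h.symm, hdW⟩)
      have hcm : ((eraseMin W).card : ℤ) = W.card - 1 := by
        have := card_eraseMin hWne; omega
      rw [e1, sum_sub_single h1I, s2, Pi.sub_apply, e2 1 le_rfl (by omega), Pi.single_eq_same,
        ← e1] at A
      rw [s2, e2 1 le_rfl (by omega), hcm] at B
      have A' := CountedBy.cons ((t + 1 + 1, true) : OPart) (fill (hsd hW) (by
        simpa [Pi.single_eq_of_ne hdne] using hM) A)
      have B' := fill (hsd hW) hM B
      have C := CountedBy.cons ((t + 1, true) : OPart) (fill (U := W) rfl (by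
        simpa [Pi.single_eq_of_ne hdne] using hne) (countedBy_tailsAbove_true A' B'))
      refine C.congr ?_
      have g1 : genAbove d true W (fun x => (N - Pi.single 1 1 - ind (F \ W) - Pi.single 1 1
          - ind W : ℕ → ℤ) x - n)
          = genOver qL d W ((fun x => N x - ((n + 1 : ℕ) : ℤ)) - Pi.single 1 1) := by
        rw [genAbove_true]
        refine genOver_congr (fun _ _ _ => Iff.rfl) fun x h1 h2 => ?_
        rw [e1, Pi.sub_apply, e2 x h1 (by omega), Pi.sub_apply]
        push_cast; ring
      have g2 : genAbove d false W (fun x => (N - Pi.single 1 1 - ind (F \ W)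
          - ind W : ℕ → ℤ) x - n)
          = genPlain qL d (eraseMin W) (fun x => N x - ((n + 1 : ℕ) : ℤ)) := by
        rw [genAbove_false]
        refine genPlain_congr (fun _ _ _ => Iff.rfl) fun x h1 h2 => ?_
        rw [e2 x h1 (by omega)]
        push_cast; ring
      rw [g1, g2, genPlain_rec_of_two_le (fun x hx => (mem_Icc.1 (hW hx)).1), hcard]
      simp only [mul_add, ← mul_assoc, ← zpow_add₀ qL_ne_zero]
      congr 3
      · push_cast
        rw [fillExp_succ, fillExp]; ring
      · push_cast
        rw [fillExp_succ, fillExp]; ring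
    cases b with
    | false =>
      simp only [Bool.false_eq_true, if_false] at hWT
      have hT : T.Nonempty := by
        rcases hb with h | ⟨-, -, h⟩
        · exact ⟨_, eraseMin_subset T (hWT ▸ h)⟩
        · exact h
      rw [tailsAbove_false_of_ne hk hT hne, ← hWT]
      have hg : genAbove d false T (fun x => N x - ((n + 1 : ℕ) : ℤ))
          = genPlain qL d W (fun x => N x - ((n + 1 : ℕ) : ℤ)) := by simp [genAbove, hWT]
      rw [hg]
      rcases hb with h | ⟨-, rfl, -⟩
      · exact step hW h
      -- Nothing is blocked, so the size `t + 1` alone uses every mark once; then all marks from `2`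
      -- on are blocked, and `genPlain_full` returns to the empty set.
      · have hdne : d + 2 ≠ 1 := by omega
        have e2 : ∀ x, 1 ≤ x → x ≤ d + 2 → (N - Pi.single 1 1 - ind F : ℕ → ℤ) x = N x - 1 := by
          intro x h1 h2
          by_cases hx : x = 1
          · subst hx; simp [ind, hF]
          · have hxF : x ∈ F := mem_Icc.2 ⟨by omega, h2⟩
            simp [ind, hxF, Pi.single_eq_of_ne hx]
        have A := ih (t := t + 1) (b := true) (T := F) (W := F)
          (N := N - Pi.single 1 1 - ind F) (by
            rw [e2 _ (by omega) le_rfl, hN]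
            push_cast; ring) rfl subset_rfl (.inl (by simp [hF]))
        rw [sum_sub_ind hFI, sum_sub_single h1I, e2 1 le_rfl (by omega)] at A
        have C := CountedBy.cons ((t + 1, true) : OPart) (fill (U := ∅) (by simp) (by
          simpa [Pi.single_eq_of_ne hdne] using hne) A)
        refine C.congr ?_
        have g1 : genAbove d true F (fun x => (N - Pi.single 1 1 - ind F : ℕ → ℤ) x - n)
            = genPlain qL d F (fun x => N x - ((n + 1 : ℕ) : ℤ)) := by
          rw [← genOver_full qL_ne_zero qL_pow_ne_one fun x h1 h2 => mem_Icc.2 ⟨h1, by omega⟩,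
            genAbove_true]
          refine genOver_congr (fun _ _ _ => Iff.rfl) fun x h1 h2 => ?_
          rw [e2 x h1 (by omega)]
          push_cast; ring
        have hsum : ∑ r ∈ Icc 2 (d + 1), (N r - ((n + 1 : ℕ) : ℤ))
            = S - N 1 - (n + 1) - d * (n + 1) := by
          rw [sum_sub_distrib, hS, sum_Icc_succ_top (by omega : 1 ≤ d + 1 + 1),
            show d + 1 + 1 = d + 2 from rfl, hN, ← add_sum_Ioc_eq_sum_Icc (by omega : 1 ≤ d + 1)]
          have : Ioc 1 (d + 1) = Icc 2 (d + 1) := by ext; simp; omega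
          rw [this]
          simp
          ring
        rw [g1, genPlain_full qL_ne_zero qL_pow_ne_one fun x h1 h2 => mem_Icc.2 ⟨h1, by omega⟩,
          hsum, hFc, ← hS, card_empty]
        simp only [← mul_assoc, ← zpow_add₀ qL_ne_zero]
        congr 2
        push_cast
        rw [fillExp_succ, fillExp]; ring
    | true =>
      simp only [if_true] at hWT
      subst hWT
      have hdW : d + 2 ∈ W := hb.resolve_right (by simp)
      have hcard : ((F \ W).card : ℤ) = d + 1 - W.card := by
        have := card_sdiff_add_card_eq_card hW
        omega
      rw [genAbove_true]
      rcases (F \ W).eq_empty_or_nonempty with hR | hR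
      -- All marks are blocked, so without an overlined part the size `t + 1` would be absent, which
      -- is excluded.
      · have h1 : CountedBy (tails (d + 3) (t + 1) false W ∅ N)
            (qL ^ (((t + 1 : ℕ) : ℤ) * (F \ W).card) * 0) := by
          refine fill rfl hne ?_
          have h0 : ind ∅ = 0 := by ext; simp [ind]
          rw [hR, h0, sub_zero, tailsAbove_false_empty hk hne]
          exact countedBy_empty
        refine (countedBy_tailsAbove_true (step hW hdW) h1).congr ?_
        rw [genOver_full qL_ne_zero qL_pow_ne_one]
        · simp
        · intro x h1 h2
          exact sdiff_eq_empty_iff_subset.1 hR (mem_Icc.2 ⟨h1, by omega⟩)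
      -- If `t + 1` is not overlined, it carries the marks `F \ W`. Then `t + 2` has to be
      -- overlined, which releases the least mark `m` of `F \ W`, so the marks `insert m W` follow:
      -- the second term of `genOver_rec`.
      · obtain ⟨m, hm, hmin, he⟩ := exists_eraseMin hR
        obtain ⟨hmF, hmW⟩ := mem_sdiff.1 hm
        have hm2 := mem_Icc.1 hmF
        have hmd : m ≤ d + 1 := by
          by_contra h
          exact hmW (by rwa [show m = d + 2 by omega])
        have hdm : d + 2 ≠ m := by omega
        have hdne : d + 2 ≠ 1 := by omega
        have hiW : insert m W ⊆ F := insert_subset hmF hW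
        have hic : ((insert m W).card : ℤ) = W.card + 1 := by
          rw [card_insert_of_notMem hmW]; push_cast; ring
        have e2 : ∀ x, 1 ≤ x → x ≤ d + 2 →
            (N - ind (F \ W) - Pi.single 1 1 - ind (insert m W) : ℕ → ℤ) x
              = N x - 1 - (Pi.single m 1 : ℕ → ℤ) x := by
          intro x h1 h2
          by_cases hx : x = 1
          · have h3 : (1 : ℕ) ∉ insert m W := fun h => by have := mem_Icc.1 (hiW h); omega
            have h4 : (1 : ℕ) ≠ m := by omega
            subst hx; simp only [ind, h3, Pi.sub_apply, Pi.single_eq_of_ne h4]; simp [hF]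
          · have hxF : x ∈ F := mem_Icc.2 ⟨by omega, h2⟩
            by_cases hxm : x = m
            · subst hxm; simp [ind, hmW, hmF, Pi.single_eq_of_ne hx]
            · by_cases hxW : x ∈ W <;>
                simp [ind, hxW, hxF, Pi.single_eq_of_ne hx, hxm]
        have A := ih (t := t + 1 + 1) (b := true) (T := insert m W) (W := insert m W)
          (N := N - ind (F \ W) - Pi.single 1 1 - ind (insert m W)) (by
            rw [e2 _ (by omega) le_rfl, hN, Pi.single_eq_of_ne hdm]
            push_cast; ring) rfl hiW (.inl (mem_insert_of_mem hdW))
        rw [sum_sub_ind (hiW.trans hFI), sum_sub_single h1I, sum_sub_ind (sdiff_subset.trans hFI),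
          e2 1 le_rfl (by omega), Pi.single_eq_of_ne (by omega : 1 ≠ m)] at A
        have hM : (N - ind (F \ W) : ℕ → ℤ) (d + 2) ≠ 0 := by
          simpa [ind, hdW] using hne
        have A' := CountedBy.cons ((t + 1 + 1, true) : OPart) (fill (U := eraseMin (F \ W)) (by
          rw [he]
          ext x
          simp only [mem_insert, mem_sdiff, mem_erase]
          by_cases hxm : x = m
          · subst hxm; simp [hmF]
          · simp only [hxm, false_or, ne_eq, not_false_eq_true, true_and]
            constructor
            · exact fun h => ⟨hW h, fun h' => h'.2 h⟩
            · exact fun h => by_contra fun h' => h.2 ⟨h.1, h'⟩) (by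
          simpa [Pi.single_eq_of_ne hdne] using hM) A)
        rw [← tailsAbove_false_of_ne hk hR (by exact hM)] at A'
        have B := fill (U := W) rfl hne A'
        refine (countedBy_tailsAbove_true (step hW hdW) B).congr ?_
        have g1 : genAbove d true (insert m W) (fun x => (N - ind (F \ W) - Pi.single 1 1
            - ind (insert m W) : ℕ → ℤ) x - n)
            = genOver qL d (insert m W) ((fun x => N x - ((n + 1 : ℕ) : ℤ)) - Pi.single m 1) := by
          rw [genAbove_true]
          refine genOver_congr (fun _ _ _ => Iff.rfl) fun x h1 h2 => ?_
          rw [e2 x h1 (by omega), Pi.sub_apply]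
          push_cast; ring
        rw [g1, genOver_rec qL_ne_zero qL_pow_ne_one hmW hm2.1 hmd fun x h1 h2 => by
          by_contra h
          exact absurd (hmin x (mem_sdiff.2 ⟨mem_Icc.2 ⟨h1, by omega⟩, h⟩)) (by omega)]
        rw [hcard, hic]
        simp only [mul_add, ← mul_assoc, ← zpow_add₀ qL_ne_zero]
        congr 3
        push_cast
        rw [fillExp_succ, fillExp]; ring

/-- The count for `k = 2`, with an overlined part before. -/
lemma countedBy_tailsAbove_two_true (n : ℕ) {t : ℕ} {N : ℕ → ℤ} (hN : N 1 = n) :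
    CountedBy (tailsAbove 2 t true ∅ N) (qL ^ (t * n + tri n)) := by
  have hfill : ∀ W, Filled 2 W := fun W x h1 h2 => by omega
  induction n generalizing t N with
  | zero =>
    rw [tailsAbove_zero le_rfl fun r h1 h2 => by
      rw [show r = 1 by omega, hN]; rfl]
    intro j
    simpa [tri_zero] using counts_nil j
  | succ n ih =>
    have h1 : CountedBy (tails 2 (t + 1) false ∅ ∅ N) 0 := by
      rw [tails_of_filled (hfill _), tailsAbove_false_empty le_rfl (by
        show N 1 ≠ 0
        rw [hN]; push_cast; omega)]
      exact countedBy_empty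
    have h2 := ih (t := t + 1) (N := N - Pi.single 1 1) (by simp [hN])
    rw [← tails_of_filled (hfill (∅ ∪ ∅))] at h2
    refine (countedBy_tailsAbove_true (CountedBy.cons ((t + 1, true) : OPart) h2) h1).congr ?_
    rw [add_zero, ← zpow_add₀ qL_ne_zero]
    congr 1
    push_cast
    rw [tri_add_one]
    ring

/-- The count for `k = 2`. -/
lemma countedBy_tailsAbove_two (n : ℕ) {T : Finset ℕ} (hT : T.Nonempty) (hT' : eraseMin T = ∅)
    {N : ℕ → ℤ} (hN : N 1 = n) :
    CountedBy (tailsAbove 2 0 false T N) (qL ^ tri n) := by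
  cases n with
  | zero =>
    rw [tailsAbove_zero le_rfl fun r h1 h2 => by
      rw [show r = 1 by omega, hN]; rfl]
    intro j
    simpa [tri_zero] using counts_nil j
  | succ n =>
    rw [tailsAbove_false_of_ne le_rfl hT (by
      show N 1 ≠ 0
      rw [hN]; push_cast; omega), hT', tails_of_filled (fun x h1 h2 => by omega)]
    have h2 := countedBy_tailsAbove_two_true n (t := 0 + 1) (N := N - Pi.single 1 1) (by simp [hN])
    refine (CountedBy.cons ((0 + 1, true) : OPart) h2).congr ?_
    rw [← zpow_add₀ qL_ne_zero]
    congr 1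
    push_cast
    rw [tri_add_one]
    ring

/-! ### The Gordon marking as a scan from left to right. -/

open Overpartition

/-- The order in which the parts of an overpartition are listed. -/
def PartLE (p p' : OPart) : Prop := p.1 < p'.1 ∨ (p.1 = p'.1 ∧ p'.2 = false)

lemma leastMark_notMem (F : Finset ℕ) : leastMark F ∉ F := fun h =>
  Nat.find_spec (Infinite.exists_notMem_finset (insert 0 F)) (mem_insert_of_mem h)

lemma leastMark_pos (F : Finset ℕ) : 1 ≤ leastMark F := by
  rw [Nat.one_le_iff_ne_zero]
  intro h
  exact Nat.find_spec (Infinite.exists_notMem_finset (insert 0 F)) (mem_insert.2 (.inl h))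

lemma mem_of_lt_leastMark {F : Finset ℕ} {x : ℕ} (h1 : 1 ≤ x) (h2 : x < leastMark F) : x ∈ F := by
  have := Nat.find_min (Infinite.exists_notMem_finset (insert 0 F)) h2
  rw [not_not, mem_insert] at this
  exact this.resolve_left (by omega)

lemma leastMark_eq {F : Finset ℕ} {r : ℕ} (h1 : 1 ≤ r) (h2 : r ∉ F)
    (h3 : ∀ x, 1 ≤ x → x < r → x ∈ F) : leastMark F = r := by
  rcases lt_trichotomy (leastMark F) r with h | h | h
  · exact absurd (h3 _ (leastMark_pos F) h) (leastMark_notMem F)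
  · exact h
  · exact absurd (mem_of_lt_leastMark h1 h) h2

lemma leastMark_of_one_notMem {F : Finset ℕ} (h : 1 ∉ F) : leastMark F = 1 :=
  leastMark_eq le_rfl h fun x h1 h2 => by omega

/-- The Gordon marking of a list of parts that follows parts `t`; these have received the marks
`R` so far, and `V` is the set of the marks forbidden for them because of the parts `t - 1`. -/
def marking : List OPart → ℕ → Finset ℕ → Finset ℕ → List (OPart × ℕ)
  | [], _, _, _ => []
  | p :: ps, t, V, R =>
    if p.1 = t then (p, leastMark (R ∪ V)) :: marking ps t V (insert (leastMark (R ∪ V)) R)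
    else
      let V' := if p.1 = t + 1 then (if p.2 = true then eraseMin R else R) else ∅
      (p, leastMark V') :: marking ps p.1 V' {leastMark V'}

lemma marksAt_append (done : List (OPart × ℕ)) (p : OPart) (m j : ℕ) :
    marksAt (done ++ [(p, m)]) j = if p.1 = j then insert m (marksAt done j) else marksAt done j := by
  by_cases h : p.1 = j
  · ext x; simp [marksAt, List.filter_append, h]
  · simp [marksAt, List.filter_append, h]

lemma filter_nonempty_lt (S : Finset ℕ) :
    S.filter (fun m => (S.filter (fun m' => m' < m)).Nonempty) = eraseMin S := by
  rcases S.eq_empty_or_nonempty with rfl | hS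
  · simp
  obtain ⟨u, hu, hmin, he⟩ := exists_eraseMin hS
  rw [he]
  ext x
  simp only [mem_filter, mem_erase, Finset.Nonempty]
  constructor
  · rintro ⟨h1, y, h2, h3⟩
    exact ⟨by have := hmin y h2; omega, h1⟩
  · rintro ⟨h1, h2⟩
    exact ⟨h2, u, hu, lt_of_le_of_ne (hmin x h2) (Ne.symm h1)⟩

/-- The list is sorted, so only the marks at the current size and the one before are consulted, and
`R` and `V` carry this information. Since an overlined part stands first among the parts of its
size, whether a new size is overlined is seen from its first part. -/
lemma markFrom_eq {all : List OPart} {done : List (OPart × ℕ)} {rest : List OPart} {t : ℕ}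
    {V R : Finset ℕ} (hR : marksAt done t = R) (hempty : ∀ j, t < j → marksAt done j = ∅)
    (hV : V = if (t, true) ∈ all then eraseMin (marksAt done (t - 1)) else marksAt done (t - 1))
    (hrest : ∀ p ∈ rest, t ≤ p.1) (hpos : ∀ p ∈ rest, 0 < p.1) (hsort : rest.Pairwise PartLE)
    (hall : ∀ j, t < j → ((j, true) ∈ all ↔ (j, true) ∈ rest)) :
    markFrom all done rest = done ++ marking rest t V R := by
  induction rest generalizing done t V R with
  | nil => simp [markFrom, marking]
  | cons p ps ih =>
    have hforb : forbiddenMarks all done p = marksAt done p.1 ∪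
        if (p.1, true) ∈ all then eraseMin (marksAt done (p.1 - 1)) else marksAt done (p.1 - 1) := by
      rw [forbiddenMarks, filter_nonempty_lt]
    obtain ⟨hp, hps⟩ := List.pairwise_cons.1 hsort
    have hps' : ∀ q ∈ ps, p.1 ≤ q.1 := fun q hq => by
      rcases hp q hq with h | h <;> omega
    rw [markFrom, marking]
    by_cases hpt : p.1 = t
    · have hf : forbiddenMarks all done p = R ∪ V := by rw [hforb, hpt, hR, hV]
      rw [if_pos hpt, ih (t := t) (V := V) (R := insert (leastMark (R ∪ V)) R), hf]
      · simp
      · rw [marksAt_append, if_pos hpt, hR, hf]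
      · intro j hj
        rw [marksAt_append, if_neg (by omega), hempty j hj]
      · have := hpos p (by simp)
        simp only [marksAt_append, if_neg (show ¬ p.1 = t - 1 by omega)]
        exact hV
      · exact fun q hq => hrest q (List.mem_cons_of_mem _ hq)
      · exact fun q hq => hpos q (List.mem_cons_of_mem _ hq)
      · exact hps
      · intro j hj
        rw [hall j hj, List.mem_cons]
        refine or_iff_right fun h => ?_
        rw [← h] at hpt
        exact hj.ne' hpt
    · have hlt : t < p.1 := lt_of_le_of_ne (hrest p (by simp)) (Ne.symm hpt)
      have hb : (p.1, true) ∈ all ↔ p.2 = true := by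
        rw [hall _ hlt, List.mem_cons]
        constructor
        · rintro (h | h)
          · rw [← h]
          · rcases hp _ h with h | h <;> simp at h
        · intro h; left; rw [← h]
      have hf : forbiddenMarks all done p
          = if p.1 = t + 1 then (if p.2 = true then eraseMin R else R) else ∅ := by
        rw [hforb, hempty _ hlt, empty_union]
        simp only [hb]
        by_cases h1 : p.1 = t + 1
        · rw [if_pos h1, h1, Nat.add_sub_cancel, hR]
        · rw [if_neg h1, hempty _ (by omega)]; simp
      rw [if_neg hpt]
      simp only
      rw [← hf, ih (t := p.1) (V := forbiddenMarks all done p)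
        (R := {leastMark (forbiddenMarks all done p)})]
      · simp
      · rw [marksAt_append, if_pos rfl, hempty _ hlt]; rfl
      · intro j hj
        rw [marksAt_append, if_neg (by omega), hempty j (by omega)]
      · simp only [marksAt_append, if_neg (show ¬ p.1 = p.1 - 1 by omega)]
        rw [hforb, hempty _ hlt, empty_union]
      · exact hps'
      · exact fun q hq => hpos q (List.mem_cons_of_mem _ hq)
      · exact hps
      · intro j hj
        rw [hall j (by omega), List.mem_cons]
        refine or_iff_right fun h => ?_
        rw [← h] at hj
        exact lt_irrefl _ hj

lemma gordonMarking_eq (g : Overpartition) : g.gordonMarking = marking g.parts 0 ∅ ∅ := by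
  rw [gordonMarking, markFrom_eq (t := 0) (V := ∅) (R := ∅)]
  · simp
  · simp [marksAt]
  · simp [marksAt]
  · simp [marksAt]
  · simp
  · exact g.pos
  · exact g.sorted
  · simp

lemma marking_map_fst (L : List OPart) (t : ℕ) (V R : Finset ℕ) :
    (marking L t V R).map Prod.fst = L := by
  induction L generalizing t V R with
  | nil => rfl
  | cons p ps ih =>
    rw [marking]
    split_ifs <;> simp [ih]

lemma mem_of_mem_marking {L : List OPart} {t : ℕ} {V R : Finset ℕ} {pm : OPart × ℕ}
    (h : pm ∈ marking L t V R) : pm.1 ∈ L := by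
  rw [← marking_map_fst L t V R]
  exact List.mem_map_of_mem h

lemma marking_same (t : ℕ) (ps : List OPart) (V R : Finset ℕ) :
    marking ((t, false) :: ps) t V R
      = ((t, false), leastMark (R ∪ V)) :: marking ps t V (insert (leastMark (R ∪ V)) R) := by
  rw [marking, if_pos rfl]

lemma marking_over (t : ℕ) (ps : List OPart) (V R : Finset ℕ) :
    marking ((t + 1, true) :: ps) t V R
      = ((t + 1, true), leastMark (eraseMin R)) ::
        marking ps (t + 1) (eraseMin R) {leastMark (eraseMin R)} := by
  rw [marking, if_neg (by simp), if_pos rfl, if_pos rfl]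

lemma marking_plain (t : ℕ) (ps : List OPart) (V R : Finset ℕ) :
    marking ((t + 1, false) :: ps) t V R
      = ((t + 1, false), leastMark R) :: marking ps (t + 1) R {leastMark R} := by
  rw [marking, if_neg (by simp), if_pos rfl, if_neg (by simp)]

lemma marking_jump {t : ℕ} {p : OPart} (hp : t + 1 < p.1) (ps : List OPart) (V R : Finset ℕ) :
    marking (p :: ps) t V R = (p, 1) :: marking ps p.1 ∅ {1} := by
  have : leastMark ∅ = 1 := leastMark_of_one_notMem (by simp)
  rw [marking, if_neg (by omega), if_neg (by omega)]
  simp only [this]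

/-! ### The marking in terms of the automaton. -/

/-- The list `L` may follow, in an overpartition, when a part of size `t` has been read. -/
def IsTail (t : ℕ) (L : List OPart) : Prop :=
  L.Pairwise PartLE ∧ ∀ p ∈ L, p = (t, false) ∨ t < p.1

lemma IsTail.of_cons_same {t : ℕ} {ps : List OPart} (h : IsTail t ((t, false) :: ps)) :
    IsTail t ps :=
  ⟨(List.pairwise_cons.1 h.1).2, fun q hq => h.2 q (List.mem_cons_of_mem _ hq)⟩

lemma isTail_of_pairwise {p : OPart} {ps : List OPart} (h : (p :: ps).Pairwise PartLE) :
    IsTail p.1 ps := by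
  refine ⟨(List.pairwise_cons.1 h).2, fun q hq => ?_⟩
  rcases (List.pairwise_cons.1 h).1 q hq with h1 | ⟨h1, h2⟩
  · exact .inr h1
  · left; rw [h1, ← h2]

lemma IsTail.count_eq_zero {t j : ℕ} {L : List OPart} (h : IsTail t L) (hj : j < t) (c : Bool) :
    L.count (j, c) = 0 := by
  refine List.count_eq_zero.2 fun hm => ?_
  rcases h.2 _ hm with h1 | h1
  · simp only [Prod.mk.injEq] at h1; omega
  · simp only at h1; omega

lemma IsTail.count_true {t : ℕ} {L : List OPart} (h : IsTail t L) : L.count (t, true) = 0 := by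
  refine List.count_eq_zero.2 fun hm => ?_
  rcases h.2 _ hm with h1 | h1 <;> simp at h1

/-- All marks are less than `k`, the `1`-marked parts are overlined, and `N r` parts
have mark `r`. -/
def Good (k : ℕ) (M : List (OPart × ℕ)) (N : ℕ → ℤ) : Prop :=
  (∀ pm ∈ M, pm.2 ≤ k - 1 ∧ (pm.2 = 1 → pm.1.2 = true)) ∧
    ∀ r, 1 ≤ r → r ≤ k - 1 → (M.countP (fun pm => pm.2 = r) : ℤ) = N r

lemma good_cons {k : ℕ} {p : OPart} {m : ℕ} {M : List (OPart × ℕ)} {N : ℕ → ℤ} :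
    Good k ((p, m) :: M) N ↔
      m ≤ k - 1 ∧ (m = 1 → p.2 = true) ∧ Good k M (N - Pi.single m 1) := by
  have h : ∀ r, ((((p, m) :: M).countP (fun pm => pm.2 = r) : ℤ) = N r ↔
      (M.countP (fun pm => pm.2 = r) : ℤ) = (N - Pi.single m 1 : ℕ → ℤ) r) := by
    intro r
    rw [List.countP_cons, Pi.sub_apply]
    by_cases hr : m = r
    · subst hr
      simp only [decide_true, if_true, Pi.single_eq_same]
      push_cast
      constructor <;> intro h <;> linarith
    · simp [hr]
  simp only [Good, List.forall_mem_cons, h]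
  tauto

lemma Good.exists_iff {k : ℕ} (hk : 2 ≤ k) {M : List (OPart × ℕ)} {N : ℕ → ℤ} (h : Good k M N) :
    (∃ pm ∈ M, pm.2 = k - 1) ↔ N (k - 1) ≠ 0 := by
  rw [← h.2 (k - 1) (by omega) le_rfl, Nat.cast_ne_zero, ← Nat.pos_iff_ne_zero,
    List.countP_pos_iff]
  simp

/-- There is a `(k - 1)`-marked part greater than `t`. -/
def HasLarge (k : ℕ) (M : List (OPart × ℕ)) (t : ℕ) : Prop := ∃ pm ∈ M, pm.2 = k - 1 ∧ t < pm.1.1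

lemma HasLarge.cons {k t m : ℕ} {M : List (OPart × ℕ)} {p : OPart} (h : HasLarge k M t) :
    HasLarge k ((p, m) :: M) t := by
  obtain ⟨pm, h1, h2⟩ := h
  exact ⟨pm, List.mem_cons_of_mem _ h1, h2⟩

lemma HasLarge.of_cons {k t m : ℕ} {M : List (OPart × ℕ)} {p : OPart} (hp : p.1 ≤ t)
    (h : HasLarge k ((p, m) :: M) t) : HasLarge k M t := by
  obtain ⟨pm, h1, h2, h3⟩ := h
  rcases List.mem_cons.1 h1 with rfl | h1
  · exact absurd h3 (not_lt.2 hp)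
  · exact ⟨pm, h1, h2, h3⟩

/-- The meaning of acceptance in terms of the marking `M` of `L`. -/
structure Meaning (k t : ℕ) (b : Bool) (U T : Finset ℕ) (N : ℕ → ℤ) (L : List OPart)
    (M : List (OPart × ℕ)) : Prop where
  good : Good k M N
  here : (∃ pm ∈ M, pm.2 = k - 1) → T.card + U.card + L.count (t, false) = k - 2
  first : t = 1 → T.card + U.card + L.count (t, false) ≤ k - 2
  next : HasLarge k M t →
    T.card + L.count (t, false) + (if b = true then 1 else 0) + L.count (t + 1, false) = k - 1
  later : ∀ t', t < t' → HasLarge k M t' →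
    L.count (t', false) + L.count (t', true) + L.count (t' + 1, false) = k - 1

/-- The connection between the state of the automaton and the marking. -/
structure State (k i t : ℕ) (b : Bool) (U T V R : Finset ℕ) : Prop where
  pos : 1 ≤ t
  R_eq : R = if b = true then insert 1 T else T
  T_sub : T ⊆ Icc 2 (k - 1)
  U_sub : U ⊆ Icc 2 (k - 1)
  disj : Disjoint T U
  one_mem : 1 ∈ R ∪ V
  V_iff : t ≠ 1 → ∀ x, 2 ≤ x → (x ∈ V ↔ x ∈ U)
  V_one : t = 1 → V = ∅ ∧ U = Icc (i + 1) (k - 1)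
  ne : b = true ∨ T.Nonempty

lemma card_add_le {k : ℕ} {U T : Finset ℕ} (hT : T ⊆ Icc 2 (k - 1)) (hU : U ⊆ Icc 2 (k - 1))
    (h : Disjoint T U) : T.card + U.card ≤ k - 2 := by
  have := card_le_card (union_subset hT hU)
  rw [card_union_of_disjoint h, Nat.card_Icc] at this
  omega

lemma filled_iff {k : ℕ} {U T : Finset ℕ} (hT : T ⊆ Icc 2 (k - 1))
    (hU : U ⊆ Icc 2 (k - 1)) (h : Disjoint T U) :
    Filled k (U ∪ T) ↔ T.card + U.card = k - 2 := by
  have hc : (Icc 2 (k - 1)).card = k - 2 := by rw [Nat.card_Icc]; omega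
  rw [← card_union_of_disjoint h, ← hc]
  constructor
  · intro hf
    congr 1
    refine (union_subset hT hU).antisymm fun x hx => ?_
    rw [union_comm]
    exact hf x (mem_Icc.1 hx).1 (mem_Icc.1 hx).2
  · intro hf x h1 h2
    rw [union_comm, eq_of_subset_of_card_le (union_subset hT hU) hf.ge]
    exact mem_Icc.2 ⟨h1, h2⟩

namespace State

variable {k i t : ℕ} {b : Bool} {U T V R : Finset ℕ}

lemma mem_R (hs : State k i t b U T V R) {x : ℕ} (hx : 2 ≤ x) : x ∈ R ↔ x ∈ T := by
  rw [hs.R_eq]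
  split_ifs
  · rw [mem_insert]; exact or_iff_right (by omega)
  · rfl

lemma one_notMem (hs : State k i t b U T V R) : 1 ∉ T := fun h => by
  have := mem_Icc.1 (hs.T_sub h); omega

lemma two_le (hs : State k i t b U T V R) : ∀ x ∈ T, 2 ≤ x := fun _ hx =>
  (mem_Icc.1 (hs.T_sub hx)).1

lemma eraseMin_R (hs : State k i t b U T V R) :
    eraseMin R = if b = true then T else eraseMin T := by
  rw [hs.R_eq]
  split_ifs
  · exact eraseMin_insert fun x hx => hs.two_le x hx
  · rfl

lemma eraseMin_sub (hs : State k i t b U T V R) : eraseMin R ⊆ Icc 2 (k - 1) := by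
  rw [hs.eraseMin_R]
  split_ifs
  · exact hs.T_sub
  · exact (eraseMin_subset T).trans hs.T_sub

lemma leastMark_eraseMin (hs : State k i t b U T V R) : leastMark (eraseMin R) = 1 :=
  leastMark_of_one_notMem fun h => by have := mem_Icc.1 (hs.eraseMin_sub h); omega

lemma card_R (hs : State k i t b U T V R) : R.card = T.card + if b = true then 1 else 0 := by
  rw [hs.R_eq]
  split_ifs
  · rw [card_insert_of_notMem hs.one_notMem]
  · rfl

lemma R_nonempty (hs : State k i t b U T V R) : R.Nonempty := by
  rw [hs.R_eq]
  split_ifs with h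
  · exact insert_nonempty _ _
  · exact hs.ne.resolve_left h

lemma card_eraseMin_R (hs : State k i t b U T V R) :
    (eraseMin R).card + 1 = T.card + if b = true then 1 else 0 := by
  rw [card_eraseMin hs.R_nonempty, hs.card_R]

/-- For `t ≠ 1` the actual and the recorded blocked sets agree from `2` on, and `1` is taken. For `t
= 1` the marking blocks nothing, while the automaton blocks the marks above `i`; a mark allowed by
the automaton is at most `i`, where the two agree. -/
lemma leastMark_eq (hs : State k i t b U T V R) {r : ℕ} (hr : IsNext k (U ∪ T) r) :
    leastMark (R ∪ V) = r := by
  obtain ⟨h1, h2, h3, h4⟩ := hr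
  rw [mem_union, not_or] at h3
  by_cases ht : t = 1
  · obtain ⟨rfl, hU⟩ := hs.V_one ht
    have hri : r ≤ i := by
      by_contra h
      exact h3.1 (hU ▸ mem_Icc.2 ⟨by omega, h2⟩)
    refine GordonMarking.leastMark_eq (by omega) ?_ fun x h5 h6 => ?_
    · rw [union_empty, hs.mem_R h1]; exact h3.2
    · rcases eq_or_lt_of_le h5 with rfl | h5
      · exact hs.one_mem
      · rw [union_empty, hs.mem_R h5]
        rcases mem_union.1 (h4 x h5 h6) with h | h
        · rw [hU, mem_Icc] at h; omega
        · exact h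
  · have hm : ∀ x, 2 ≤ x → (x ∈ R ∪ V ↔ x ∈ U ∪ T) := fun x hx => by
      rw [mem_union, mem_union, hs.mem_R hx, hs.V_iff ht x hx, or_comm]
    refine GordonMarking.leastMark_eq (by omega) ?_ fun x h5 h6 => ?_
    · rw [hm r h1, mem_union, not_or]; exact h3
    · rcases eq_or_lt_of_le h5 with rfl | h5
      · exact hs.one_mem
      · rw [hm x h5]; exact h4 x h5 h6

/-- At `t = 1` the marking could give out a mark above `i`. Then all smaller marks from `2` on would
be in `T` and all larger ones in `U`, against the bound on the number of parts. -/
lemma isNext (hs : State k i t b U T V R) (h1 : leastMark (R ∪ V) ≤ k - 1)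
    (h2 : t = 1 → T.card + U.card < k - 2) : IsNext k (U ∪ T) (leastMark (R ∪ V)) := by
  set r := leastMark (R ∪ V) with hr
  have hr1 : r ≠ 1 := fun h => leastMark_notMem (R ∪ V) (by rw [← hr, h]; exact hs.one_mem)
  have hr2 : 2 ≤ r := by have := leastMark_pos (R ∪ V); omega
  by_cases ht : t = 1
  · obtain ⟨hV, hU⟩ := hs.V_one ht
    rw [hV, union_empty] at hr
    have h3 : r ∉ T := fun h => leastMark_notMem R (by rw [← hr, hs.mem_R hr2]; exact h)
    have h4 : ∀ x, 2 ≤ x → x < r → x ∈ T := fun x h5 h6 =>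
      (hs.mem_R h5).1 (mem_of_lt_leastMark (by omega) (hr ▸ h6))
    refine ⟨hr2, h1, ?_, fun x h5 h6 => mem_union_right _ (h4 x h5 h6)⟩
    rw [mem_union, not_or]
    refine ⟨fun h => ?_, h3⟩
    refine (h2 ht).ne ((filled_iff hs.T_sub hs.U_sub hs.disj).1 fun x h5 h6 => ?_)
    rw [hU, mem_Icc] at h
    by_cases hx : x < r
    · exact mem_union_right _ (h4 x h5 hx)
    · exact mem_union_left _ (hU ▸ mem_Icc.2 ⟨by omega, h6⟩)
  · have hm : ∀ x, 2 ≤ x → (x ∈ R ∪ V ↔ x ∈ U ∪ T) := fun x hx => by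
      rw [mem_union, mem_union, hs.mem_R hx, hs.V_iff ht x hx, or_comm]
    refine ⟨hr2, h1, fun h => leastMark_notMem (R ∪ V) (by rw [← hr, hm r hr2]; exact h),
      fun x h5 h6 => (hm x h5).1 (mem_of_lt_leastMark (by omega) (hr ▸ h6))⟩

lemma same (hs : State k i t b U T V R) {r : ℕ} (hr : IsNext k (U ∪ T) r) :
    State k i t b U (insert r T) V (insert r R) where
  pos := hs.pos
  R_eq := by
    rw [hs.R_eq]
    split_ifs
    · rw [insert_comm]
    · rfl
  T_sub := insert_subset (mem_Icc.2 ⟨hr.1, hr.2.1⟩) hs.T_sub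
  U_sub := hs.U_sub
  disj := disjoint_insert_left.2 ⟨fun h => hr.2.2.1 (mem_union_left _ h), hs.disj⟩
  one_mem := by rw [insert_union]; exact mem_insert_of_mem hs.one_mem
  V_iff := hs.V_iff
  V_one := hs.V_one
  ne := .inr (insert_nonempty _ _)

lemma overlined (hs : State k i t b U T V R) :
    State k i (t + 1) true (eraseMin R) ∅ (eraseMin R) {1} where
  pos := by omega
  R_eq := by simp
  T_sub := by simp
  U_sub := hs.eraseMin_sub
  disj := by simp
  one_mem := by simp
  V_iff := fun _ _ _ => Iff.rfl
  V_one := fun h => absurd h (by have := hs.pos; omega)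
  ne := .inl rfl

lemma plain (hs : State k i t b U T V R) {r : ℕ} (hr : IsNext k T r) (h1 : 1 ∈ R) :
    State k i (t + 1) false T {r} R {r} where
  pos := by omega
  R_eq := by simp
  T_sub := singleton_subset_iff.2 (mem_Icc.2 ⟨hr.1, hr.2.1⟩)
  U_sub := hs.T_sub
  disj := disjoint_singleton_left.2 hr.2.2.1
  one_mem := mem_union_right _ h1
  V_iff := fun _ _ h => hs.mem_R h
  V_one := fun h => absurd h (by have := hs.pos; omega)
  ne := .inr (singleton_nonempty _)

lemma jump {s : ℕ} (hs : 2 ≤ s) : State k i s true ∅ ∅ ∅ {1} where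
  pos := by omega
  R_eq := by simp
  T_sub := by simp
  U_sub := by simp
  disj := by simp
  one_mem := by simp
  V_iff := by simp
  V_one := fun h => absurd h (by omega)
  ne := .inl rfl

end State

lemma Accepts.isTail {k t : ℕ} {b a : Bool} {U T : Finset ℕ} {N : ℕ → ℤ} {L : List OPart}
    (h : Accepts k L t b a U T N) : IsTail t L := by
  induction L generalizing t b a U T N with
  | nil => exact ⟨List.Pairwise.nil, by simp⟩
  | cons p ps ih =>
    have key : ∀ s, p.1 = s → IsTail s ps → (p :: ps).Pairwise PartLE := by
      rintro s rfl h
      refine List.pairwise_cons.2 ⟨fun q hq => ?_, h.1⟩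
      rcases h.2 q hq with h1 | h1
      · right; rw [h1]; exact ⟨rfl, rfl⟩
      · exact .inl h1
    rcases h with (⟨rfl, -, s, -, h⟩ | ⟨-, ⟨rfl, -, h⟩ | ⟨rfl, -, s, -, h⟩ | ⟨hp, -, -, h⟩⟩)
    · refine ⟨key t rfl (ih h), fun q hq => ?_⟩
      rcases List.mem_cons.1 hq with rfl | hq
      · exact .inl rfl
      · exact (ih h).2 q hq
    all_goals
      refine ⟨key _ rfl (ih h), fun q hq => ?_⟩
      rcases List.mem_cons.1 hq with rfl | hq
      · right; first | exact Nat.lt_succ_self t | omega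
      · rcases (ih h).2 q hq with h1 | h1
        · right; rw [h1]; simp only; omega
        · right; omega

lemma Accepts.card_le {k t : ℕ} {b a : Bool} {U T : Finset ℕ} {N : ℕ → ℤ} {L : List OPart}
    (hT : T ⊆ Icc 2 (k - 1)) (hU : U ⊆ Icc 2 (k - 1)) (hd : Disjoint T U)
    (h : Accepts k L t b a U T N) : T.card + U.card + L.count (t, false) ≤ k - 2 := by
  induction L generalizing T N with
  | nil => simpa using card_add_le hT hU hd
  | cons p ps ih =>
    have ht := h.isTail
    rcases h with (⟨rfl, -, r, hr, h⟩ | ⟨-, h⟩)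
    · have hr' := hr.2.2.1
      rw [mem_union, not_or] at hr'
      have := ih (insert_subset (mem_Icc.2 ⟨hr.1, hr.2.1⟩) hT)
        (disjoint_insert_left.2 ⟨hr'.1, hd⟩) h
      rw [card_insert_of_notMem hr'.2] at this
      rw [List.count_cons_self]
      omega
    · have hp : t < p.1 := by
        rcases h with ⟨rfl, -⟩ | ⟨rfl, -⟩ | ⟨hp, -⟩
        all_goals first | exact Nat.lt_succ_self t | omega
      have h2 := (isTail_of_pairwise ht.1).count_eq_zero hp false
      rw [List.count_cons_of_ne (by rintro rfl; exact lt_irrefl _ hp), h2]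
      exact card_add_le hT hU hd

/-- Each further part `t` receives a new mark outside `R ∪ V`, and all these marks lie in `{1, …, k
- 1}`. -/
lemma marks_card_le {k t : ℕ} {V R : Finset ℕ} {L : List OPart} (hL : IsTail t L)
    (h : ∀ pm ∈ marking L t V R, pm.2 ≤ k - 1) (hRV : R ∪ V ⊆ Icc 1 (k - 1)) :
    (R ∪ V).card + L.count (t, false) ≤ k - 1 := by
  induction L generalizing R with
  | nil => simpa using card_le_card hRV
  | cons p ps ih =>
    rcases hL.2 p (by simp) with rfl | hp
    · rw [marking_same, List.forall_mem_cons] at h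
      have := ih hL.of_cons_same h.2 (by
        rw [insert_union]
        exact insert_subset (mem_Icc.2 ⟨leastMark_pos _, h.1⟩) hRV)
      rw [insert_union, card_insert_of_notMem (leastMark_notMem _)] at this
      rw [List.count_cons_self]
      omega
    · have h2 := (isTail_of_pairwise hL.1).count_eq_zero hp false
      rw [List.count_cons_of_ne (by rintro rfl; exact lt_irrefl _ hp), h2]
      simpa using card_le_card hRV

/-- After a step from `t` to `t + 1` the blocked set has one element fewer than there are parts `t`.
So `here` in the new state is the equation required by `next` in the old one, and `next` in the new
state supplies the first instance of `later`. -/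
lemma meaning_of_accepts {k i t : ℕ} (hk : 2 ≤ k) {b : Bool} {U T V R : Finset ℕ} {N : ℕ → ℤ}
    {L : List OPart} (hs : State k i t b U T V R) (h : Accepts k L t b true U T N) :
    Meaning k t b U T N L (marking L t V R) := by
  have hcard := card_add_le hs.T_sub hs.U_sub hs.disj
  induction L generalizing t b U T V R N with
  | nil =>
    refine ⟨⟨by simp [marking], fun r h1 h2 => ?_⟩, by simp [marking], fun _ => by simpa using hcard,
      ?_, ?_⟩
    · simpa [marking] using (h r h1 h2).symm
    · rintro ⟨pm, hpm, -⟩; simp [marking] at hpm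
    · rintro t' - ⟨pm, hpm, -⟩; simp [marking] at hpm
  | cons p ps ih =>
    have ht := h.isTail
    have hpos := hs.pos
    rcases h with (⟨rfl, -, r, hr, h⟩ | ⟨hfill, ⟨rfl, -, h⟩ | ⟨rfl, hb, r, hr, h⟩ | ⟨hp, hp2, hN, h⟩⟩)
    · have hs' := hs.same hr
      have hm := hs.leastMark_eq hr
      have ih := ih hs' h (card_add_le hs'.T_sub hs'.U_sub hs'.disj)
      have hle := h.card_le hs'.T_sub hs'.U_sub hs'.disj
      have hrT : r ∉ T := fun h => hr.2.2.1 (mem_union_right _ h)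
      rw [card_insert_of_notMem hrT] at hle
      have c1 : ((t, false) :: ps).count (t, false) = ps.count (t, false) + 1 :=
        List.count_cons_self
      have c2 : ∀ s c, t < s → ((t, false) :: ps).count (s, c) = ps.count (s, c) := fun s c h =>
        List.count_cons_of_ne (by simp only [ne_eq, Prod.mk.injEq]; omega)
      rw [marking_same, hm]
      refine ⟨good_cons.2 ⟨hr.2.1, fun h1 => absurd hr.1 (by omega), ih.good⟩, ?_, ?_, ?_, ?_⟩
      · rintro ⟨pm, h1, h2⟩
        rcases List.mem_cons.1 h1 with rfl | h1
        -- The part just read has the largest mark; being the least free one, it completes the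
        -- filling.
        · have hf : Filled k (U ∪ insert r T) := by
            intro x h3 h4
            rcases eq_or_ne x r with rfl | h5
            · simp
            · have := hr.2.2.2 x h3 (lt_of_le_of_ne (by simp only at h2; omega) h5)
              rw [mem_union] at this ⊢
              exact this.imp id (mem_insert_of_mem)
          have := (filled_iff hs'.T_sub hs'.U_sub hs'.disj).1 hf
          rw [card_insert_of_notMem hrT] at this
          omega
        · have := ih.here ⟨pm, h1, h2⟩
          rw [card_insert_of_notMem hrT] at this
          omega
      · intro _; omega
      · intro h1
        have := ih.next (h1.of_cons le_rfl)
        rw [card_insert_of_notMem hrT] at this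
        rw [c1, c2 _ _ (show t < t + 1 by omega)]
        omega
      · intro t' ht' h1
        rw [c2 _ _ ht', c2 _ _ ht', c2 _ _ (by omega)]
        exact ih.later t' ht' (h1.of_cons ht'.le)
    · have hs' := hs.overlined
      rw [← hs.eraseMin_R] at h
      have ih := ih hs' h (card_add_le hs'.T_sub hs'.U_sub hs'.disj)
      have hle := h.card_le hs'.T_sub hs'.U_sub hs'.disj
      have hc := hs.card_eraseMin_R
      have htail : IsTail (t + 1) ps := isTail_of_pairwise ht.1
      have c0 : ((t + 1, true) :: ps).count (t, false) = 0 := by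
        rw [List.count_cons_of_ne (by simp), htail.count_eq_zero (by omega)]
      have c1 : ((t + 1, true) :: ps).count (t + 1, true) = 1 := by
        rw [List.count_cons_self, htail.count_true]
      have c2 : ((t + 1, true) :: ps).count (t + 1, false) = ps.count (t + 1, false) :=
        List.count_cons_of_ne (by simp)
      have c3 : ∀ s c, t + 1 < s → ((t + 1, true) :: ps).count (s, c) = ps.count (s, c) :=
        fun s c h => List.count_cons_of_ne (by simp only [ne_eq, Prod.mk.injEq]; omega)
      have hgood : Good k (((t + 1, true), 1) :: marking ps (t + 1) (eraseMin R) {1}) N :=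
        good_cons.2 ⟨by omega, fun _ => rfl, ih.good⟩
      rw [card_empty] at hle
      rw [marking_over, hs.leastMark_eraseMin]
      refine ⟨hgood, ?_, ?_, ?_, ?_⟩
      · intro h1
        have := (filled_iff hs.T_sub hs.U_sub hs.disj).1 (hfill ((hgood.exists_iff hk).1 h1))
        omega
      · intro _; omega
      · rintro ⟨pm, h1, h2, -⟩
        rw [c0, c2]
        rcases List.mem_cons.1 h1 with rfl | h1
        · simp only at h2; omega
        · have := ih.here ⟨pm, h1, h2⟩
          rw [card_empty] at this
          omega
      · intro t' ht' h1
        rcases eq_or_lt_of_le (show t + 1 ≤ t' from ht') with rfl | h3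
        · have := ih.next (h1.of_cons le_rfl)
          rw [card_empty, if_pos rfl] at this
          rw [c1, c2, c3 _ _ (by omega)]
          omega
        · rw [c3 _ _ h3, c3 _ _ h3, c3 _ _ (by omega)]
          exact ih.later t' h3 (h1.of_cons h3.le)
    · subst hb
      have hR : R = insert 1 T := by simpa using hs.R_eq
      have h1R : 1 ∈ R := by rw [hR]; exact mem_insert_self _ _
      have hs' := hs.plain hr h1R
      have hm : leastMark R = r := by
        refine leastMark_eq (by have := hr.1; omega) (by rw [hs.mem_R hr.1]; exact hr.2.2.1) ?_
        intro x h3 h4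
        rcases eq_or_lt_of_le h3 with rfl | h3
        · exact h1R
        · rw [hs.mem_R h3]; exact hr.2.2.2 x h3 h4
      have ih := ih hs' h (card_add_le hs'.T_sub hs'.U_sub hs'.disj)
      have hle := h.card_le hs'.T_sub hs'.U_sub hs'.disj
      have htail : IsTail (t + 1) ps := isTail_of_pairwise ht.1
      have c0 : ((t + 1, false) :: ps).count (t, false) = 0 := by
        rw [List.count_cons_of_ne (by simp), htail.count_eq_zero (by omega)]
      have c1 : ((t + 1, false) :: ps).count (t + 1, true) = 0 := by
        rw [List.count_cons_of_ne (by simp), htail.count_true]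
      have c2 : ((t + 1, false) :: ps).count (t + 1, false) = ps.count (t + 1, false) + 1 :=
        List.count_cons_self
      have c3 : ∀ s c, t + 1 < s → ((t + 1, false) :: ps).count (s, c) = ps.count (s, c) :=
        fun s c h => List.count_cons_of_ne (by simp only [ne_eq, Prod.mk.injEq]; omega)
      have hgood : Good k (((t + 1, false), r) :: marking ps (t + 1) R {r}) N :=
        good_cons.2 ⟨hr.2.1, fun h => absurd hr.1 (by omega), ih.good⟩
      rw [card_singleton] at hle
      rw [marking_plain, hm]
      refine ⟨hgood, ?_, ?_, ?_, ?_⟩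
      · intro h1
        have := (filled_iff hs.T_sub hs.U_sub hs.disj).1 (hfill ((hgood.exists_iff hk).1 h1))
        omega
      · intro _; omega
      · rintro ⟨pm, h1, h2, -⟩
        rw [c0, c2, if_pos rfl]
        rcases List.mem_cons.1 h1 with rfl | h1
        · have hf : Filled k (T ∪ {r}) := by
            intro x h3 h4
            rcases eq_or_ne x r with rfl | h5
            · simp
            · exact mem_union_left _
                (hr.2.2.2 x h3 (lt_of_le_of_ne (by simp only at h2; omega) h5))
          have := (filled_iff hs'.T_sub hs'.U_sub hs'.disj).1 hf
          rw [card_singleton] at this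
          have := hr.1
          have := hr.2.1
          omega
        · have := ih.here ⟨pm, h1, h2⟩
          rw [card_singleton] at this
          have := hr.1
          have := hr.2.1
          omega
      · intro t' ht' h1
        rcases eq_or_lt_of_le (show t + 1 ≤ t' from ht') with rfl | h3
        · have := ih.next (h1.of_cons le_rfl)
          rw [card_singleton, if_neg (by simp)] at this
          rw [c1, c2, c3 _ _ (by omega)]
          omega
        · rw [c3 _ _ h3, c3 _ _ h3, c3 _ _ (by omega)]
          exact ih.later t' h3 (h1.of_cons h3.le)
    · have hs' : State k i p.1 true ∅ ∅ ∅ {1} := State.jump (by omega)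
      have ih := ih hs' h (by simp)
      have hgood : Good k ((p, 1) :: marking ps p.1 ∅ {1}) N :=
        good_cons.2 ⟨by omega, fun _ => hp2, ih.good⟩
      have hno : ¬ ∃ pm ∈ (p, 1) :: marking ps p.1 ∅ {1}, pm.2 = k - 1 := fun h =>
        (hgood.exists_iff hk).1 h hN
      have c0 : (p :: ps).count (t, false) = 0 := by
        rw [List.count_cons_of_ne (by rintro rfl; simp only at hp; omega),
          (isTail_of_pairwise ht.1).count_eq_zero (by omega)]
      rw [marking_jump hp]
      refine ⟨hgood, fun h => absurd h hno, fun _ => by omega, ?_, ?_⟩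
      · rintro ⟨pm, h1, h2, -⟩; exact absurd ⟨pm, h1, h2⟩ hno
      · rintro t' - ⟨pm, h1, h2, -⟩; exact absurd ⟨pm, h1, h2⟩ hno

/-- The equations are translated back in the same way, and the absence of non-overlined `1`-marked
parts determines the transition: a non-overlined `t + 1` requires an overlined `t`, and a part after
a gap is overlined. -/
lemma accepts_of_meaning {k i t : ℕ} (hk : 2 ≤ k) {b : Bool} {U T V R : Finset ℕ} {N : ℕ → ℤ}
    {L : List OPart} (hs : State k i t b U T V R) (hL : IsTail t L)
    (h : Meaning k t b U T N L (marking L t V R)) : Accepts k L t b true U T N := by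
  induction L generalizing t b U T V R N with
  | nil => exact fun r h1 h2 => by simpa [marking] using (h.good.2 r h1 h2).symm
  | cons p ps ih =>
    have hpos := hs.pos
    rcases hL.2 p (by simp) with rfl | hp
    · have c1 : ((t, false) :: ps).count (t, false) = ps.count (t, false) + 1 :=
        List.count_cons_self
      have c2 : ∀ s c, t < s → ((t, false) :: ps).count (s, c) = ps.count (s, c) := fun s c h =>
        List.count_cons_of_ne (by simp only [ne_eq, Prod.mk.injEq]; omega)
      rw [marking_same] at h
      obtain ⟨hg1, hg2, hg3⟩ := good_cons.1 h.good
      have hr := hs.isNext hg1 fun ht => by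
        have := h.first ht
        rw [c1] at this
        omega
      set r := leastMark (R ∪ V)
      have hrT : r ∉ T := fun h => hr.2.2.1 (mem_union_right _ h)
      refine .inl ⟨rfl, rfl, r, hr, ih (hs.same hr) hL.of_cons_same ⟨hg3, ?_, ?_, ?_, ?_⟩⟩
      · rintro ⟨pm, h1, h2⟩
        have := h.here ⟨pm, List.mem_cons_of_mem _ h1, h2⟩
        rw [card_insert_of_notMem hrT]
        omega
      · intro ht
        have := h.first ht
        rw [card_insert_of_notMem hrT]
        omega
      · intro h1
        have := h.next h1.cons
        rw [c1, c2 _ _ (by omega)] at this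
        rw [card_insert_of_notMem hrT]
        omega
      · intro t' ht' h1
        have := h.later t' ht' h1.cons
        rwa [c2 _ _ ht', c2 _ _ ht', c2 _ _ (by omega)] at this
    · right
      have htail : IsTail p.1 ps := isTail_of_pairwise hL.1
      have c0 : (p :: ps).count (t, false) = 0 := by
        rw [List.count_cons_of_ne (by rintro rfl; exact lt_irrefl _ hp), htail.count_eq_zero hp]
      refine ⟨fun hN => (filled_iff hs.T_sub hs.U_sub hs.disj).2 ?_, ?_⟩
      · have := h.here ((h.good.exists_iff hk).2 hN)
        omega
      have hlarge : ∀ {V' R' : Finset ℕ} {m t' : ℕ}, t' < p.1 →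
          (∃ pm ∈ (p, m) :: marking ps p.1 V' R', pm.2 = k - 1) →
          HasLarge k ((p, m) :: marking ps p.1 V' R') t' := by
        rintro V' R' m t' ht' ⟨pm, h1, h2⟩
        refine ⟨pm, h1, h2, ?_⟩
        rcases List.mem_cons.1 h1 with rfl | h1
        · exact ht'
        · rcases htail.2 _ (mem_of_mem_marking h1) with h3 | h3
          · rw [h3]; exact ht'
          · exact ht'.trans h3
      obtain ⟨s, c⟩ := p
      simp only at hp htail hlarge ⊢
      rcases eq_or_lt_of_le (show t + 1 ≤ s from hp) with rfl | hp1
      · have c3 : ∀ s c', t + 1 < s → ((t + 1, c) :: ps).count (s, c') = ps.count (s, c') :=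
          fun s c h => List.count_cons_of_ne (by simp only [ne_eq, Prod.mk.injEq]; omega)
        cases c with
        | true =>
          left
          have c1 : ((t + 1, true) :: ps).count (t + 1, true) = 1 := by
            rw [List.count_cons_self, htail.count_true]
          have c2 : ((t + 1, true) :: ps).count (t + 1, false) = ps.count (t + 1, false) :=
            List.count_cons_of_ne (by simp)
          rw [marking_over, hs.leastMark_eraseMin] at h
          obtain ⟨hg1, hg2, hg3⟩ := good_cons.1 h.good
          have hc := hs.card_eraseMin_R
          refine ⟨rfl, fun _ => hs.ne, ?_⟩
          rw [← hs.eraseMin_R]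
          refine ih hs.overlined htail ⟨hg3, ?_, fun h => by omega, ?_, ?_⟩
          · rintro ⟨pm, h1, h2⟩
            have := h.next (hlarge hp ⟨pm, List.mem_cons_of_mem _ h1, h2⟩)
            rw [c0, c2] at this
            rw [card_empty]
            omega
          · intro h1
            have := h.later _ hp h1.cons
            rw [c1, c2, c3 _ _ (by omega)] at this
            rw [card_empty, if_pos rfl]
            omega
          · intro t' ht' h1
            have := h.later t' (by omega) h1.cons
            rwa [c3 _ _ ht', c3 _ _ ht', c3 _ _ (by omega)] at this
        | false =>
          right; left
          have c1 : ((t + 1, false) :: ps).count (t + 1, true) = 0 := by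
            rw [List.count_cons_of_ne (by simp), htail.count_true]
          have c2 : ((t + 1, false) :: ps).count (t + 1, false) = ps.count (t + 1, false) + 1 :=
            List.count_cons_self
          rw [marking_plain] at h
          obtain ⟨hg1, hg2, hg3⟩ := good_cons.1 h.good
          set r := leastMark R with hr
          have hr1 : r ≠ 1 := fun h => by simpa using hg2 h
          have h1R : 1 ∈ R := by
            by_contra h
            exact hr1 (leastMark_of_one_notMem h)
          have hb : b = true := by
            by_contra hb
            rw [hs.R_eq, if_neg hb] at h1R
            exact hs.one_notMem h1R
          have hr2 : 2 ≤ r := by have := leastMark_pos R; omega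
          have hnext : IsNext k T r := by
            refine ⟨hr2, hg1, fun h => leastMark_notMem R (by rw [← hr, hs.mem_R hr2]; exact h), ?_⟩
            intro x h3 h4
            exact (hs.mem_R h3).1 (mem_of_lt_leastMark (by omega) (hr ▸ h4))
          refine ⟨rfl, hb, r, hnext, ih (hs.plain hnext h1R) htail
            ⟨hg3, ?_, fun h => by omega, ?_, ?_⟩⟩
          · rintro ⟨pm, h1, h2⟩
            have := h.next (hlarge hp ⟨pm, List.mem_cons_of_mem _ h1, h2⟩)
            rw [c0, c2, if_pos hb] at this
            rw [card_singleton]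
            omega
          · intro h1
            have := h.later _ hp h1.cons
            rw [c1, c2, c3 _ _ (by omega)] at this
            rw [card_singleton, if_neg (by simp)]
            omega
          · intro t' ht' h1
            have := h.later t' (by omega) h1.cons
            rwa [c3 _ _ ht', c3 _ _ ht', c3 _ _ (by omega)] at this
      · right; right
        rw [marking_jump (by exact hp1)] at h
        obtain ⟨hg1, hg2, hg3⟩ := good_cons.1 h.good
        obtain rfl : c = true := hg2 rfl
        -- If the size `t + 1` is absent, its equation demands `k - 1` non-overlined parts `t + 2`;
        -- but at most `k - 2` are possible, as an overlined one would hold the mark `1`.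
        have hN : N (k - 1) = 0 := by
          by_contra hN
          have h1 := h.later (t + 1) (by omega)
            (hlarge hp1 ((h.good.exists_iff hk).2 hN))
          have z : ∀ c', ((s, true) :: ps).count (t + 1, c') = 0 := fun c' => by
            rw [List.count_cons_of_ne (by simp only [ne_eq, Prod.mk.injEq]; omega),
              htail.count_eq_zero hp1]
          rw [z, z] at h1
          have h2 := marks_card_le (V := ∅) (R := {1}) htail (fun pm h => (hg3.1 pm h).1)
            (by simp; omega)
          rw [union_empty, card_singleton] at h2
          rcases eq_or_lt_of_le (show t + 1 + 1 ≤ s from hp1) with h3 | h3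
          · rw [← h3, List.count_cons_of_ne (by simp)] at h1
            rw [← h3] at h2
            omega
          · rw [List.count_cons_of_ne (by simp only [ne_eq, Prod.mk.injEq]; omega),
              htail.count_eq_zero h3] at h1
            omega
        have hno : ¬ ∃ pm ∈ marking ps s ∅ {1}, pm.2 = k - 1 := by
          rintro ⟨pm, h1, h2⟩
          exact (h.good.exists_iff hk).1 ⟨pm, List.mem_cons_of_mem _ h1, h2⟩ hN
        refine ⟨hp1, rfl, hN, ih (State.jump (by omega)) htail
          ⟨hg3, fun h => absurd h hno, fun h => by omega, ?_, ?_⟩⟩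
        · rintro ⟨pm, h1, h2, -⟩; exact absurd ⟨pm, h1, h2⟩ hno
        · rintro t' - ⟨pm, h1, h2, -⟩; exact absurd ⟨pm, h1, h2⟩ hno

/-! ### The difference condition follows from the bound on the marks. -/

/-- If all marks are less than `k`, then two consecutive sizes have few parts. -/
lemma counts_le {k t : ℕ} {V R : Finset ℕ} {L : List OPart} (hL : IsTail t L)
    (h : ∀ pm ∈ marking L t V R, pm.2 ≤ k - 1) (hRV : R ∪ V ⊆ Icc 1 (k - 1)) (hR : R.Nonempty) :
    R.card + L.count (t, false) + L.count (t + 1, false) ≤ k - 1 ∧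
      ∀ t', t < t' → L.count (t', false) + L.count (t', true) + L.count (t' + 1, false) ≤ k - 1 := by
  have hRk : R.card ≤ k - 1 := by
    simpa using card_le_card (subset_union_left.trans hRV)
  induction L generalizing t V R with
  | nil => exact ⟨by simpa using hRk, by simp⟩
  | cons p ps ih =>
    rcases hL.2 p (by simp) with rfl | hp
    · rw [marking_same, List.forall_mem_cons] at h
      have hm : leastMark (R ∪ V) ∉ R := fun h =>
        leastMark_notMem (R ∪ V) (mem_union_left _ h)
      have hsub : insert (leastMark (R ∪ V)) R ∪ V ⊆ Icc 1 (k - 1) := by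
        rw [insert_union]
        exact insert_subset (mem_Icc.2 ⟨leastMark_pos _, h.1⟩) hRV
      have h1 := ih hL.of_cons_same h.2 hsub (insert_nonempty _ _)
        (by simpa using card_le_card (subset_union_left.trans hsub))
      have c2 : ∀ s c, t < s → ((t, false) :: ps).count (s, c) = ps.count (s, c) := fun s c h =>
        List.count_cons_of_ne (by simp only [ne_eq, Prod.mk.injEq]; omega)
      rw [card_insert_of_notMem hm] at h1
      refine ⟨?_, fun t' ht' => ?_⟩
      · rw [List.count_cons_self, c2 _ _ (by omega)]; omega
      · rw [c2 _ _ ht', c2 _ _ ht', c2 _ _ (by omega)]; exact h1.2 t' ht'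
    · have htail : IsTail p.1 ps := isTail_of_pairwise hL.1
      have c0 : (p :: ps).count (t, false) = 0 := by
        rw [List.count_cons_of_ne (by rintro rfl; exact lt_irrefl _ hp), htail.count_eq_zero hp]
      obtain ⟨s, c⟩ := p
      simp only at hp htail
      have c3 : ∀ s' c', s < s' → ((s, c) :: ps).count (s', c') = ps.count (s', c') :=
        fun s' c' h => List.count_cons_of_ne (by simp only [ne_eq, Prod.mk.injEq]; omega)
      have c4 : ∀ s' c', s' < s → ((s, c) :: ps).count (s', c') = 0 := fun s' c' h => by
        rw [List.count_cons_of_ne (by simp only [ne_eq, Prod.mk.injEq]; omega),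
          htail.count_eq_zero h]
      have c5 : ((s, c) :: ps).count (s, false) + ((s, c) :: ps).count (s, true)
          = ps.count (s, false) + 1 := by
        have := htail.count_true
        cases c <;> simp [this]
      have c6 : ((s, c) :: ps).count (s, false) = ps.count (s, false) + if c = true then 0 else 1 := by
        cases c <;> simp
      -- The marks at the size `s` are distinct and avoid `V'`, which gives the bound. For `s = t +
      -- 1`, `V'` lacks a mark of `R` only if `s` is overlined, and then the overlined part is not
      -- counted in the claim.
      have key : ∀ V' : Finset ℕ, V' ⊆ Icc 1 (k - 1) →
          (∀ pm ∈ ((s, c), leastMark V') :: marking ps s V' {leastMark V'}, pm.2 ≤ k - 1) →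
          V'.card + 1 + ps.count (s, false) ≤ k - 1 ∧
          ∀ t', s ≤ t' → ((s, c) :: ps).count (t', false) + ((s, c) :: ps).count (t', true)
            + ((s, c) :: ps).count (t' + 1, false) ≤ k - 1 := by
        intro V' hV' h
        rw [List.forall_mem_cons] at h
        have hsub : {leastMark V'} ∪ V' ⊆ Icc 1 (k - 1) :=
          union_subset (singleton_subset_iff.2 (mem_Icc.2 ⟨leastMark_pos _, h.1⟩)) hV'
        have h1 := marks_card_le htail h.2 hsub
        have h2 := ih htail h.2 hsub (singleton_nonempty _)
          (by simpa using card_le_card (subset_union_left.trans hsub))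
        rw [← insert_eq, card_insert_of_notMem (leastMark_notMem _)] at h1
        rw [card_singleton] at h2
        refine ⟨by omega, fun t' ht' => ?_⟩
        rcases ht'.eq_or_lt with rfl | ht'
        · rw [c5, c3 _ _ (by omega)]
          omega
        · rw [c3 _ _ ht', c3 _ _ ht', c3 _ _ (by omega)]
          exact h2.2 t' ht'
      have hRsub := subset_union_left.trans hRV
      rcases eq_or_lt_of_le (show t + 1 ≤ s from hp) with h1 | h1
      · subst h1
        rw [c0, c6]
        cases c with
        | true =>
          rw [marking_over] at h
          have h2 := key _ ((eraseMin_subset R).trans hRsub) h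
          rw [card_eraseMin hR] at h2
          refine ⟨by simpa using h2.1, fun t' ht' => h2.2 t' ht'⟩
        | false =>
          rw [marking_plain] at h
          have h2 := key _ hRsub h
          refine ⟨by have := h2.1; simp; omega, fun t' ht' => h2.2 t' ht'⟩
      · rw [marking_jump (by exact h1)] at h
        have he : leastMark ∅ = 1 := leastMark_of_one_notMem (by simp)
        have h2 := key ∅ (by simp) (by rw [he]; exact h)
        rw [c0, c4 _ _ h1]
        refine ⟨by simpa using hRk, fun t' ht' => ?_⟩
        rcases le_or_gt s t' with h3 | h3
        · exact h2.2 t' h3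
        · rw [c4 _ _ h3, c4 _ _ h3]
          rcases (show t' + 1 ≤ s from h3).eq_or_lt with h4 | h4
          · have := h2.1
            rw [h4, c6]; split_ifs <;> simp at this ⊢ <;> omega
          · rw [c4 _ _ h4]; omega

lemma length_le_count {l : List OPart} {x y z : OPart} (h : ∀ e ∈ l, e = x ∨ e = y ∨ e = z) :
    l.length ≤ l.count x + l.count y + l.count z := by
  induction l with
  | nil => simp
  | cons a l ih =>
    rw [List.forall_mem_cons] at h
    have := ih h.2
    have hx : l.count x ≤ (a :: l).count x := List.count_le_count_cons
    have hy : l.count y ≤ (a :: l).count y := List.count_le_count_cons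
    have hz : l.count z ≤ (a :: l).count z := List.count_le_count_cons
    rw [List.length_cons]
    rcases h.1 with rfl | rfl | rfl
    all_goals rw [List.count_cons_self] at *; omega

/-- Bounds for the number of parts of two consecutive sizes imply the difference condition. -/
lemma difference_of_counts {k : ℕ} (hk : 2 ≤ k) {g : Overpartition}
    (h : ∀ t, 0 < t → g.f t + g.fbar t + g.f (t + 1) ≤ k - 1) (j : ℕ) (a b : OPart)
    (ha : g.decreasing[j]? = some a) (hb : g.decreasing[j + (k - 1)]? = some b) :
    b.1 + (if a.2 = true then 1 else 2) ≤ a.1 := by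
  set D := g.decreasing
  have hperm : D.Perm g.parts := List.mergeSort_perm _ _
  have hsort : D.Pairwise
      (fun p p' : OPart => p'.1 < p.1 ∨ (p'.1 = p.1 ∧ (p'.2 = true → p.2 = true))) := by
    have := List.pairwise_mergeSort
      (le := fun p p' : OPart => decide (p'.1 < p.1 ∨ (p'.1 = p.1 ∧ (p'.2 = true → p.2 = true))))
      (fun a b c => by
        simp only [decide_eq_true_eq]
        rintro (h | ⟨h, h'⟩) (h1 | ⟨h1, h1'⟩)
        · left; omega
        · left; omega
        · left; omega
        · exact .inr ⟨h1.trans h, fun x => h' (h1' x)⟩)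
      (fun a b => by
        simp only [Bool.or_eq_true, decide_eq_true_eq]
        rcases lt_trichotomy a.1 b.1 with h | h | h
        · exact .inr (.inl h)
        · cases h2 : a.2 <;> cases h3 : b.2 <;> simp [h]
        · exact .inl (.inl h)) g.parts
    exact this.imp (by simp)
  obtain ⟨hj, rfl⟩ := List.getElem?_eq_some_iff.1 ha
  obtain ⟨hjk, rfl⟩ := List.getElem?_eq_some_iff.1 hb
  rw [List.pairwise_iff_getElem] at hsort
  -- These `k` consecutive parts would, if the difference were too small, all be of three kinds that
  -- together occur at most `k - 1` times.
  set S := (D.drop j).take k with hS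
  have hlen : S.length = k := by rw [hS, List.length_take, List.length_drop]; omega
  have hcount : ∀ x, S.count x ≤ g.parts.count x := fun x => by
    rw [← hperm.count_eq]
    exact ((List.take_sublist _ _).trans (List.drop_sublist _ _)).count_le x
  have hmem : ∀ e ∈ S, e ∈ g.parts ∧ D[j + (k - 1)].1 ≤ e.1 ∧
      (e.1 < D[j].1 ∨ (e.1 = D[j].1 ∧ (e.2 = true → D[j].2 = true))) := by
    intro e he
    obtain ⟨m, hm, rfl⟩ := List.mem_iff_getElem.1 he
    have hmk : m < k := hlen ▸ hm
    have heq : S[m] = D[j + m] := by simp [hS]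
    refine ⟨hperm.subset (heq ▸ List.getElem_mem _), ?_, ?_⟩
    · rw [heq]
      rcases eq_or_lt_of_le (show j + m ≤ j + (k - 1) by omega) with h1 | h1
      · simp [h1]
      · have := hsort (j + m) (j + (k - 1)) (by omega) hjk h1
        omega
    · rw [heq]
      rcases Nat.eq_zero_or_pos m with rfl | h1
      · exact .inr ⟨rfl, id⟩
      · exact hsort j (j + m) hj (by omega) (by omega)
  generalize D[j] = a at *
  generalize D[j + (k - 1)] = b at *
  have hpos : 0 < a.1 := by
    by_contra h0
    have : S ≠ [] := fun h => by rw [h] at hlen; simp at hlen; omega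
    obtain ⟨e, he⟩ := List.exists_mem_of_ne_nil _ this
    obtain ⟨h1, -, h2⟩ := hmem e he
    have := g.pos e h1
    omega
  by_contra hcon
  have mk : ∀ (e : OPart) (t : ℕ) (c : Bool), e.1 = t → e.2 = c → e = (t, c) :=
    fun e t c h1 h2 => Prod.ext h1 h2
  by_cases ha2 : a.2 = true
  · rw [if_pos ha2] at hcon
    have h1 := length_le_count (l := S) (x := (a.1, false)) (y := (a.1, true))
      (z := (a.1 + 1, false)) fun e he => by
      obtain ⟨-, h1, h2⟩ := hmem e he
      have h3 : e.1 = a.1 := by omega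
      cases h4 : e.2
      · exact .inl (mk e _ _ h3 h4)
      · exact .inr (.inl (mk e _ _ h3 h4))
    have h2 := h a.1 hpos
    have := hcount (a.1, false)
    have := hcount (a.1, true)
    have := hcount (a.1 + 1, false)
    simp only [f, fbar] at h2
    omega
  · rw [if_neg ha2] at hcon
    rw [Bool.not_eq_true] at ha2
    have h5 : ∀ e ∈ S, e.1 = a.1 → e.2 = false := fun e he h6 => by
      obtain ⟨-, h1, h2⟩ := hmem e he
      by_contra h7
      rw [Bool.not_eq_false] at h7
      have := (h2.resolve_left (by omega)).2 h7
      rw [ha2] at this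
      cases this
    -- For a non-overlined `a` the relevant sizes are `a.1 - 1` and `a.1`; the hypothesis says
    -- nothing about size `0`, so for `a.1 = 1` it is used at the size `1`.
    by_cases ha1 : a.1 = 1
    · have h1 := length_le_count (l := S) (x := (1, false)) (y := (1, true))
        (z := (1 + 1, false)) fun e he => by
        obtain ⟨h0, h1, h2⟩ := hmem e he
        have h3 : e.1 = 1 := by have := g.pos e h0; omega
        exact .inl (mk e _ _ h3 (h5 e he (by omega)))
      have h2 := h 1 (by omega)
      have := hcount (1, false)
      have := hcount (1, true)
      have := hcount (1 + 1, false)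
      simp only [f, fbar] at h2
      omega
    · have h1 := length_le_count (l := S) (x := (a.1 - 1, false)) (y := (a.1 - 1, true))
        (z := (a.1 - 1 + 1, false)) fun e he => by
        obtain ⟨h0, h1, h2⟩ := hmem e he
        by_cases h3 : e.1 = a.1
        · exact .inr (.inr (mk e _ _ (by omega) (h5 e he h3)))
        · cases h4 : e.2
          · exact .inl (mk e _ _ (by omega) h4)
          · exact .inr (.inl (mk e _ _ (by omega) h4))
      have h2 := h (a.1 - 1) (by omega)
      have := hcount (a.1 - 1, false)
      have := hcount (a.1 - 1, true)
      have := hcount (a.1 - 1 + 1, false)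
      simp only [f, fbar] at h2
      omega

/-! ### The automaton recognizes `setQ`. -/

lemma sum_countP (s : Finset ℕ) (M : List (OPart × ℕ)) :
    ∑ r ∈ s, M.countP (fun pm => pm.2 = r) = M.countP (fun pm => pm.2 ∈ s) := by
  induction M with
  | nil => simp
  | cons a M ih =>
    simp only [List.countP_cons, sum_add_distrib, ih]
    congr 1
    simp

lemma one_le_mark {L : List OPart} {t : ℕ} {V R : Finset ℕ} {pm : OPart × ℕ}
    (h : pm ∈ marking L t V R) : 1 ≤ pm.2 := by
  induction L generalizing t V R with
  | nil => simp [marking] at h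
  | cons p ps ih =>
    rw [marking] at h
    split_ifs at h
    all_goals
      rcases List.mem_cons.1 h with rfl | h
      · exact leastMark_pos _
      · exact ih h

/-- The conditions on the marks in the definition of `setP`. -/
lemma good_gordonMarking_iff {k : ℕ} {g : Overpartition} {N : ℕ → ℕ} :
    Good k g.gordonMarking (fun r => (N r : ℤ)) ↔
      (g.length = ∑ r ∈ Icc 1 (k - 1), N r ∧ ∀ r ∈ Icc 1 (k - 1), g.numMarked r = N r) ∧
        ∀ pm ∈ g.gordonMarking, pm.2 = 1 → pm.1.2 = true := by
  have hlen : g.gordonMarking.length = g.length := by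
    rw [gordonMarking_eq, ← List.length_map (f := Prod.fst), marking_map_fst, Overpartition.length]
  have hsum : (∀ r ∈ Icc 1 (k - 1), g.numMarked r = N r) →
      g.gordonMarking.countP (fun pm => pm.2 ∈ Icc 1 (k - 1)) = ∑ r ∈ Icc 1 (k - 1), N r := by
    intro h
    rw [← sum_countP]
    exact sum_congr rfl h
  constructor
  · rintro ⟨h1, h2⟩
    have h3 : ∀ r ∈ Icc 1 (k - 1), g.numMarked r = N r := fun r hr => by
      have h : (g.numMarked r : ℤ) = N r := h2 r (mem_Icc.1 hr).1 (mem_Icc.1 hr).2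
      exact_mod_cast h
    refine ⟨⟨?_, h3⟩, fun pm h => (h1 pm h).2⟩
    rw [← hsum h3, ← hlen, eq_comm, List.countP_eq_length]
    intro pm hpm
    rw [decide_eq_true_eq, mem_Icc]
    exact ⟨one_le_mark (gordonMarking_eq g ▸ hpm), (h1 pm hpm).1⟩
  · rintro ⟨⟨h1, h2⟩, h3⟩
    -- The marks up to `k - 1` already account for all parts, so no larger mark occurs.
    have h4 := hsum h2
    rw [← h1, ← hlen, List.countP_eq_length] at h4
    refine ⟨fun pm h => ⟨?_, h3 pm h⟩, fun r h5 h6 => ?_⟩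
    · have := h4 pm h
      rw [decide_eq_true_eq, mem_Icc] at this
      exact this.2
    · show (g.numMarked r : ℤ) = N r
      exact_mod_cast h2 r (mem_Icc.2 ⟨h5, h6⟩)

lemma mem_setQ_iff_good {k i : ℕ} {N : ℕ → ℕ} {g : Overpartition} :
    g ∈ setQ k i N ↔ g ∈ setT k i ∧ (∀ p : OPart, g.parts.head? = some p → p.2 = true) ∧
      Good k g.gordonMarking (fun r => (N r : ℤ)) ∧
      (∀ t, 0 < t → HasLarge k g.gordonMarking t → g.f t + g.fbar t + g.f (t + 1) = k - 1) ∧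
      ((∃ pm ∈ g.gordonMarking, pm.2 = k - 1) → g.f 1 = min (i - 1) (k - 2)) := by
  rw [good_gordonMarking_iff]
  simp only [setQ, setP, setUN, setU, Set.mem_ofPred_eq, HasLarge]
  tauto

lemma marking_start {p : OPart} (hp : 0 < p.1) (ps : List OPart) :
    marking (p :: ps) 0 ∅ ∅ = (p, 1) :: marking ps p.1 ∅ {1} := by
  have h : leastMark ∅ = 1 := leastMark_of_one_notMem (by simp)
  rw [marking, if_neg (by omega)]
  simp [h]

/-- The first state after an overlined part `1`. -/
lemma State.start {k i : ℕ} (hi : 1 ≤ i) : State k i 1 true (Icc (i + 1) (k - 1)) ∅ ∅ {1} where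
  pos := le_rfl
  R_eq := by simp
  T_sub := by simp
  U_sub := Icc_subset_Icc_left (by omega)
  disj := by simp
  one_mem := by simp
  V_iff := fun h => absurd rfl h
  V_one := fun _ => ⟨rfl, rfl⟩
  ne := .inl rfl

/-- The automaton recognizes the overpartitions in `setQ k i N`. -/
theorem mem_setQ_iff {k i : ℕ} (hk : 2 ≤ k) (hi : 1 ≤ i) (hik : i ≤ k) (N : ℕ → ℕ)
    (g : Overpartition) :
    g ∈ setQ k i N ↔
      g.parts ∈ tailsAbove k 0 false (insert i (Icc (i + 1) (k - 1))) (fun r => (N r : ℤ)) := by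
  have hT0 : eraseMin (insert i (Icc (i + 1) (k - 1))) = Icc (i + 1) (k - 1) :=
    eraseMin_insert fun x hx => by have := mem_Icc.1 hx; omega
  have hcU : (Icc (i + 1) (k - 1)).card = k - 1 - i := by rw [Nat.card_Icc]; omega
  rw [mem_setQ_iff_good, gordonMarking_eq]
  rcases g with ⟨L, hpos, hsort⟩
  cases L with
  | nil =>
    have hM : marking ([] : List OPart) 0 ∅ ∅ = [] := rfl
    simp only [hM]
    constructor
    · rintro ⟨-, -, h, -⟩ r h1 h2
      exact (h.2 r h1 h2).symm
    · intro h
      refine ⟨⟨by simp [f], fun j a b h1 => ?_⟩, by simp,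
        ⟨by simp, fun r h1 h2 => (h r h1 h2).symm⟩, ?_, by simp⟩
      · simp [decreasing] at h1
      · rintro t - ⟨pm, h1, -⟩
        simp at h1
  | cons p ps =>
    have hp := hpos p (by simp)
    have htail : IsTail p.1 ps := isTail_of_pairwise hsort
    rw [marking_start hp]
    set g : Overpartition := ⟨p :: ps, hpos, hsort⟩ with hg
    set M := marking ps p.1 ∅ {1} with hM
    have hhead : (∀ q : OPart, g.parts.head? = some q → q.2 = true) ↔ p.2 = true := by
      simp [hg]
    have hdiff : p.2 = true → (∀ pm ∈ M, pm.2 ≤ k - 1) →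
        ∀ (j : ℕ) (a b : OPart), g.decreasing[j]? = some a →
          g.decreasing[j + (k - 1)]? = some b → b.1 + (if a.2 = true then 1 else 2) ≤ a.1 := by
      intro hp2 hm
      refine difference_of_counts hk fun t ht => ?_
      -- A fictitious part `0` with mark `1` satisfies the nonemptiness assumption; as the first
      -- part is overlined, it does not change the marking.
      refine (counts_le (k := k) (t := 0) (V := ∅) (R := {1}) (L := p :: ps)
        ⟨hsort, fun q hq => .inr (hpos q hq)⟩ ?_ (by simp; omega) (singleton_nonempty _)).2 t ht
      have h : marking (p :: ps) 0 ∅ {1} = (p, 1) :: M := by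
        have h1 : eraseMin {1} = ∅ := by
          rw [eraseMin_eq (u := 1) (by simp) (by simp)]; simp
        have h : leastMark ∅ = 1 := leastMark_of_one_notMem (by simp)
        rw [marking, if_neg (by omega)]
        simp [h, h1, hp2, hM]
      rw [h, List.forall_mem_cons]
      exact ⟨by simp only; omega, hm⟩
    rw [hhead]
    obtain ⟨s, c⟩ := p
    simp only at hp htail hM
    by_cases hc : c = true
    swap
    · refine iff_of_false (fun h => hc h.2.1) fun h => ?_
      rcases h with (⟨-, h, -⟩ | ⟨-, ⟨h, -⟩ | ⟨-, h, -⟩ | ⟨-, h, -⟩⟩)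
      · cases h
      · exact hc (Prod.ext_iff.1 h).2
      · cases h
      · exact hc h
    subst hc
    have hf : ∀ t, g.f t = ps.count (t, false) := fun t => List.count_cons_of_ne (by simp)
    -- If `1` is overlined, the blocked set has `k - 1 - i` elements (truncated), so a complete
    -- filling means `f 1 = min (i - 1) (k - 2)`.
    rcases eq_or_lt_of_le (show 1 ≤ s from hp) with rfl | hs1
    · have hfb : g.fbar 1 = 1 := by
        show List.count _ _ = _
        rw [List.count_cons_self, htail.count_true]
      have hfb' : ∀ t, 1 < t → g.fbar t = ps.count (t, true) := fun t ht =>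
        List.count_cons_of_ne (by simp; omega)
      have hst : State k i 1 true (Icc (i + 1) (k - 1)) ∅ ∅ {1} := State.start hi
      have hacc : g.parts ∈ tailsAbove k 0 false (insert i (Icc (i + 1) (k - 1)))
          (fun r => (N r : ℤ)) ↔ Accepts k ps 1 true true (Icc (i + 1) (k - 1)) ∅
            ((fun r => (N r : ℤ)) - Pi.single 1 1) := by
        simp [tailsAbove, Accepts, hg, filled_Icc_union, hT0, -union_insert]
      rw [hacc]
      constructor
      · rintro ⟨h1, -, h3, h4, h5⟩
        have h6 := (good_cons.1 h3).2.2
        have hle := marks_card_le (V := ∅) (R := {1}) htail (fun pm h => (h6.1 pm h).1)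
          (by simp; omega)
        rw [union_empty, card_singleton] at hle
        refine accepts_of_meaning hk hst htail ⟨h6, ?_, fun _ => ?_, fun h => ?_, fun t ht h => ?_⟩
        · rintro ⟨pm, h7, h8⟩
          have := h5 ⟨pm, List.mem_cons_of_mem _ h7, h8⟩
          rw [hf] at this
          rw [card_empty, hcU]
          omega
        · have := h1.1
          rw [hf] at this
          rw [card_empty, hcU]
          omega
        · have := h4 1 one_pos h.cons
          rw [hf, hf, hfb] at this
          rw [card_empty, if_pos rfl]
          omega
        · have := h4 t (by omega) h.cons
          rwa [hf, hf, hfb' t ht] at this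
      · intro h
        have h := meaning_of_accepts hk hst h
        have hfirst := h.first rfl
        rw [card_empty, hcU] at hfirst
        refine ⟨⟨?_, hdiff rfl fun pm h1 => (h.good.1 pm h1).1⟩, rfl,
          good_cons.2 ⟨by omega, fun _ => rfl, h.good⟩, fun t ht h1 => ?_, ?_⟩
        · rw [hf]; omega
        · have h1 := h1.of_cons (by exact ht)
          rcases eq_or_lt_of_le (show 1 ≤ t from ht) with rfl | ht
          · have := h.next h1
            rw [card_empty, if_pos rfl] at this
            rw [hf, hf, hfb]
            omega
          · rw [hf, hf, hfb' t ht]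
            exact h.later t ht h1
        · rintro ⟨pm, h1, h2⟩
          rw [hf]
          rcases List.mem_cons.1 h1 with rfl | h1
          · simp only at h2; omega
          · have := h.here ⟨pm, h1, h2⟩
            rw [card_empty, hcU] at this
            omega
    · have hst : State k i s true ∅ ∅ ∅ {1} := State.jump hs1
      have hacc : g.parts ∈ tailsAbove k 0 false (insert i (Icc (i + 1) (k - 1)))
          (fun r => (N r : ℤ)) ↔ N (k - 1) = 0 ∧ Accepts k ps s true true ∅ ∅
            ((fun r => (N r : ℤ)) - Pi.single 1 1) := by
        have : s ≠ 1 := by omega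
        simp [tailsAbove, Accepts, hg, filled_Icc_union, hs1, this, -union_insert]
      have hz : ∀ t, t < s → ps.count (t, false) = 0 := fun t ht => htail.count_eq_zero ht false
      rw [hacc]
      constructor
      · rintro ⟨-, -, h3, h4, -⟩
        have h6 := (good_cons.1 h3).2.2
        -- Without parts `1` the equation at `t = 1` would require `k - 1` non-overlined parts `2`,
        -- one more than possible.
        have hN : (N (k - 1) : ℤ) = 0 := by
          by_contra hN
          obtain ⟨pm, h1, h2⟩ := (h3.exists_iff hk).2 hN
          have h7 : s ≤ pm.1.1 := by
            rcases List.mem_cons.1 h1 with rfl | h1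
            · exact le_rfl
            · rcases htail.2 _ (mem_of_mem_marking h1) with h8 | h8
              · rw [h8]
              · exact h8.le
          have h8 := h4 1 one_pos ⟨pm, h1, h2, by omega⟩
          have hfb : g.fbar 1 = 0 := by
            show List.count _ _ = _
            rw [List.count_cons_of_ne (by simp; omega), htail.count_eq_zero hs1]
          have hle := marks_card_le (V := ∅) (R := {1}) htail (fun pm h => (h6.1 pm h).1)
            (by simp; omega)
          rw [union_empty, card_singleton] at hle
          rw [hf, hf, hfb, hz 1 hs1, show 1 + 1 = 2 from rfl] at h8
          rcases eq_or_lt_of_le (show 2 ≤ s from hs1) with rfl | hs2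
          · omega
          · rw [hz _ hs2] at h8; omega
        have hno : ¬ ∃ pm ∈ M, pm.2 = k - 1 := by
          rintro ⟨pm, h1, h2⟩
          exact (h3.exists_iff hk).1 ⟨pm, List.mem_cons_of_mem _ h1, h2⟩ hN
        refine ⟨by exact_mod_cast hN, accepts_of_meaning hk hst htail
          ⟨h6, fun h => absurd h hno, fun h => by omega, ?_, ?_⟩⟩
        · rintro ⟨pm, h1, h2, -⟩; exact absurd ⟨pm, h1, h2⟩ hno
        · rintro t' - ⟨pm, h1, h2, -⟩; exact absurd ⟨pm, h1, h2⟩ hno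
      · rintro ⟨hN, h⟩
        have h := meaning_of_accepts hk hst h
        have hgood : Good k (((s, true), 1) :: M) (fun r => (N r : ℤ)) :=
          good_cons.2 ⟨by omega, fun _ => rfl, h.good⟩
        have hno : ¬ ∃ pm ∈ (((s, true), 1) : OPart × ℕ) :: M, pm.2 = k - 1 := fun h =>
          (hgood.exists_iff hk).1 h (by simp [hN])
        refine ⟨⟨?_, hdiff rfl fun pm h1 => (h.good.1 pm h1).1⟩, rfl, hgood, ?_,
          fun h => absurd h hno⟩
        · rw [hf, hz 1 hs1]; omega
        · rintro t' - ⟨pm, h1, h2, -⟩; exact absurd ⟨pm, h1, h2⟩ hno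

lemma parts_of_mem_tailsAbove {k : ℕ} {T : Finset ℕ} {N : ℕ → ℤ} {L : List OPart}
    (h : L ∈ tailsAbove k 0 false T N) : ∃ g : Overpartition, g.parts = L := by
  have ht := Accepts.isTail h
  refine ⟨⟨L, fun p hp => ?_, ht.1⟩, rfl⟩
  cases L with
  | nil => simp at hp
  | cons q qs =>
    have hq := lt_of_mem_tailsAbove h
    rcases List.mem_cons.1 hp with rfl | hp
    · exact hq
    · rcases (List.pairwise_cons.1 ht.1).1 p hp with h1 | h1 <;> omega

/-! ### The exponent and the count of the recognized lists. -/

lemma tri_sub (a n : ℤ) : tri (a - n) = tri a - a * n + tri n - n := by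
  have h1 := two_mul_tri (a - n)
  have h2 := two_mul_tri a
  have h3 := two_mul_tri n
  have : 2 * tri (a - n) = 2 * (tri a - a * n + tri n - n) := by
    rw [h1]; linear_combination -h2 - h3
  omega

/-- The exponent in the generating function of `setQ k i N`. -/
def minSize (k i : ℕ) (N : ℕ → ℕ) : ℕ :=
  N 1 * (N 1 + 1) / 2 + ∑ r ∈ Icc 2 (k - 1), N r ^ 2 + ∑ r ∈ Icc (i + 1) (k - 1), N r

/-- Expanding the closed exponent at `N r - N (d + 2)` produces correction terms that `fillExp`
cancels. -/
lemma exponent_eq {d i : ℕ} (N : ℕ → ℕ) (hi : 1 ≤ i) :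
    fillExp d (N (d + 2)) (∑ x ∈ Icc 1 (d + 2), (N x : ℤ)) (N 1) (Icc (i + 1) (d + 2)).card
      + (tri ((N 1 : ℤ) - N (d + 2)) + ∑ r ∈ Ioc 1 (1 + d), ((N r : ℤ) - N (d + 2)) ^ 2
        + ∑ r ∈ Ioc 1 (1 + d) with i < r, ((N r : ℤ) - N (d + 2)))
      = minSize (d + 3) i N := by
  have h1 : Icc 1 (d + 2) = insert 1 (insert (d + 2) (Ioc 1 (1 + d))) := by
    ext x; simp; omega
  have h2 : Icc 2 (d + 2) = insert (d + 2) (Ioc 1 (1 + d)) := by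
    ext x; simp; omega
  have h3 : ∑ x ∈ Icc 1 (d + 2), (N x : ℤ) = N 1 + (N (d + 2) + ∑ x ∈ Ioc 1 (1 + d), (N x : ℤ)) := by
    rw [h1, sum_insert (by simp), sum_insert (by simp; omega)]
  have h4 : ∑ r ∈ Ioc 1 (1 + d), ((N r : ℤ) - N (d + 2)) ^ 2
      = ∑ r ∈ Ioc 1 (1 + d), (N r : ℤ) ^ 2 - 2 * N (d + 2) * ∑ r ∈ Ioc 1 (1 + d), (N r : ℤ)
        + d * (N (d + 2) : ℤ) ^ 2 := by
    simp only [sub_sq, sum_add_distrib, sum_sub_distrib, mul_sum, sum_const, Nat.card_Ioc,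
      nsmul_eq_mul]
    rw [show 1 + d - 1 = d by omega]
    congr 2
    exact sum_congr rfl fun x _ => by ring
  have h5 : ∑ r ∈ Icc 2 (d + 2), (N r : ℤ) ^ 2
      = (N (d + 2) : ℤ) ^ 2 + ∑ r ∈ Ioc 1 (1 + d), (N r : ℤ) ^ 2 := by
    rw [h2, sum_insert (by simp; omega)]
  have h6 : ∑ r ∈ Ioc 1 (1 + d) with i < r, ((N r : ℤ) - N (d + 2))
      = ∑ r ∈ Icc (i + 1) (d + 2), (N r : ℤ) - N (d + 2) * (Icc (i + 1) (d + 2)).card := by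
    have h7 : ∑ r ∈ Icc (i + 1) (d + 2), (N r : ℤ) - N (d + 2) * (Icc (i + 1) (d + 2)).card
        = ∑ r ∈ Icc (i + 1) (d + 2), ((N r : ℤ) - N (d + 2)) := by
      rw [sum_sub_distrib, sum_const, nsmul_eq_mul, mul_comm]
    rw [h7]
    -- The index `d + 2` can be added because its term is `0`.
    refine sum_subset (fun x hx => ?_) fun x hx hx' => ?_
    · simp only [mem_filter, mem_Ioc, mem_Icc] at hx ⊢; omega
    · simp only [mem_filter, mem_Ioc, mem_Icc] at hx hx'
      rw [show x = d + 2 by omega, sub_self]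
  rw [minSize, show d + 3 - 1 = d + 2 from rfl]
  push_cast
  have h8 := tri_natCast (N 1)
  push_cast at h8
  rw [h6, h4, h5, h3, tri_sub, fillExp, ← h8]
  ring

/-- The count of the lists recognized by the automaton. -/
theorem countedBy_recognized {k i : ℕ} (hk : 2 ≤ k) (hi : 1 ≤ i) (N : ℕ → ℕ) :
    CountedBy (tailsAbove k 0 false (insert i (Icc (i + 1) (k - 1))) (fun r => (N r : ℤ)))
      (qL ^ minSize k i N * ∏ r ∈ Icc 1 (k - 2), invQ qL ((N r : ℤ) - N (r + 1))) := by
  have hT0 : eraseMin (insert i (Icc (i + 1) (k - 1))) = Icc (i + 1) (k - 1) :=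
    eraseMin_insert fun x hx => by have := mem_Icc.1 hx; omega
  -- For `k = 2` the only mark is `1`, whereas the general count needs the two distinct marks `1`
  -- and `k - 1`.
  rcases hk.eq_or_lt with rfl | hk
  · have he : Icc (i + 1) (2 - 1) = ∅ := Icc_eq_empty (by omega)
    refine (countedBy_tailsAbove_two (N 1) (insert_nonempty _ _) (hT0.trans he) rfl).congr ?_
    rw [tri_natCast, zpow_natCast, minSize, he]
    simp
  · obtain ⟨d, rfl⟩ : ∃ d, k = d + 3 := ⟨k - 3, by omega⟩
    refine (countedBy_tailsAbove (d := d) (t := 0) (b := false) (W := Icc (i + 1) (d + 2))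
      (N (d + 2)) rfl ?_ ?_ ?_).congr ?_
    · simpa using hT0.symm
    · exact Icc_subset_Icc_left (by omega)
    · by_cases h : i ≤ d + 1
      · exact .inl (mem_Icc.2 ⟨by omega, le_rfl⟩)
      · exact .inr ⟨rfl, Icc_eq_empty (by omega), insert_nonempty _ _⟩
    · rw [genAbove_false, hT0, genPlain, layer_fst_closed qL qL_ne_zero qL_pow_ne_one (i := i)
        (fun x h1 h2 => by rw [mem_Icc]; omega), ← mul_assoc, ← zpow_add₀ qL_ne_zero,
        Nat.cast_zero, zero_mul, zero_add, exponent_eq N hi, zpow_natCast]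
      congr 1
      have h : Icc 1 (d + 3 - 2) = insert (1 + d) (Ico 1 (1 + d)) := by
        ext x; simp; omega
      rw [h, prod_insert (by simp), mul_comm, add_comm 1 d]
      simp

/-! ### Passage to power series in two variables. -/

/-- The substitution of `q` for the variable of a power series. -/
noncomputable def substQ : PowerSeries ℚ →ₐ[ℚ] MvPowerSeries (Fin 2) ℚ :=
  MvPowerSeries.rename (fun _ : Unit => (1 : Fin 2))

lemma substQ_X : substQ PowerSeries.X = qVar := MvPowerSeries.rename_X _ _

lemma coeff_substQ (p : PowerSeries ℚ) (m : Fin 2 →₀ ℕ) :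
    MvPowerSeries.coeff m (substQ p) = if m 0 = 0 then PowerSeries.coeff (m 1) p else 0 := by
  set e : Unit ↪ Fin 2 := ⟨fun _ => 1, fun _ _ _ => rfl⟩
  have h1 : ∀ j : ℕ, (Finsupp.single () j).embDomain e = Finsupp.single (1 : Fin 2) j := fun j =>
    Finsupp.embDomain_single _ _ _
  split_ifs with h
  · have h2 : m = (Finsupp.single () (m 1)).embDomain e := by
      rw [h1]
      ext x
      fin_cases x
      · simpa using h
      · simp
    conv_lhs => rw [h2]
    exact MvPowerSeries.coeff_embDomain_rename e p _
  · refine MvPowerSeries.coeff_rename_eq_zero _ p ?_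
    rintro ⟨y, rfl⟩
    apply h
    rw [Finsupp.mapDomain, Finsupp.sum_apply]
    simp

lemma coeff_substQ_mul (p : PowerSeries ℚ) (n : ℕ) (m : Fin 2 →₀ ℕ) :
    MvPowerSeries.coeff m (substQ p * xVar ^ n)
      = if m 0 = n then PowerSeries.coeff (m 1) p else 0 := by
  rw [xVar, MvPowerSeries.X_pow_eq, MvPowerSeries.coeff_mul_monomial, mul_one, coeff_substQ]
  have h : Finsupp.single 0 n ≤ m ↔ n ≤ m 0 := by simp
  have h1 : (Finsupp.single (0 : Fin 2) n) 1 = 0 := Finsupp.single_eq_of_ne (by simp)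
  simp only [h, Finsupp.tsub_apply, Finsupp.single_eq_same, h1, Nat.sub_zero]
  split_ifs <;> first | rfl | omega

lemma coeff_xVar_mul_qVar (a b : ℕ) (m : Fin 2 →₀ ℕ) :
    MvPowerSeries.coeff m (xVar ^ a * qVar ^ b) = if m 0 = a ∧ m 1 = b then (1 : ℚ) else 0 := by
  have h : xVar ^ a * qVar ^ b = substQ (PowerSeries.X ^ b) * xVar ^ a := by
    rw [map_pow, substQ_X, mul_comm]
  rw [h, coeff_substQ_mul, PowerSeries.coeff_X_pow, ite_and]

lemma substQ_prod (n : ℕ) :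
    substQ (∏ j ∈ Icc 1 n, (1 - PowerSeries.X ^ j)) = qFactorial n := by
  rw [map_prod, qFactorial]
  simp [substQ_X]

lemma constantCoeff_qFactorial (n : ℕ) : MvPowerSeries.constantCoeff (qFactorial n) = 1 := by
  rw [qFactorial, map_prod]
  refine prod_eq_one fun j hj => ?_
  have : j ≠ 0 := by have := mem_Icc.1 hj; omega
  simp [qVar, this]

lemma invQ_mul_prod (n : ℕ) :
    invQ qL n * HahnSeries.ofPowerSeries ℤ ℚ (∏ j ∈ Icc 1 n, (1 - PowerSeries.X ^ j)) = 1 := by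
  have h1 : HahnSeries.ofPowerSeries ℤ ℚ (∏ j ∈ Icc 1 n, (1 - PowerSeries.X ^ j))
      = ∏ j ∈ range n, (1 - qL ^ (j + 1)) := by
    rw [map_prod, range_eq_Ico, prod_Ico_add' (fun j => 1 - qL ^ j) 0 n 1]
    refine prod_congr rfl fun j _ => ?_
    simp [qL_eq_coe]
  rw [h1, invQ, if_pos (Int.natCast_nonneg n), Int.toNat_natCast]
  refine inv_mul_cancel₀ (prod_ne_zero_iff.2 fun j _ => ?_)
  exact sub_ne_zero.2 (qL_pow_ne_one _ (Nat.succ_pos j)).symm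

/-- The generating function of `setQ k i N` as a power series in `q`. -/
lemma exists_powerSeries {k i : ℕ} (hk : 2 ≤ k) (hi : 1 ≤ i) {N : ℕ → ℕ}
    (hN : ∀ r : ℕ, 1 ≤ r → r + 1 ≤ k - 1 → N (r + 1) ≤ N r) :
    ∃ p : PowerSeries ℚ, substQ p * ∏ r ∈ Icc 1 (k - 2), qFactorial (N r - N (r + 1))
        = qVar ^ minSize k i N ∧
      ∀ j : ℕ, Counts (tailsAbove k 0 false (insert i (Icc (i + 1) (k - 1)))
        (fun r => (N r : ℤ))) (HahnSeries.ofPowerSeries ℤ ℚ p) j := by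
  have h := countedBy_recognized hk hi N
  have hps : IsPowerSeries
      (qL ^ minSize k i N * ∏ r ∈ Icc 1 (k - 2), invQ qL ((N r : ℤ) - N (r + 1))) := by
    refine IsPowerSeries.mul ?_ (prod_mem fun r _ => isPowerSeries_invQ _)
    have := isPowerSeries_zpow (z := minSize k i N) (Int.natCast_nonneg _)
    rwa [zpow_natCast] at this
  obtain ⟨p, hp⟩ := hps
  rw [← hp] at h
  refine ⟨p, ?_, fun j => h j⟩
  -- With the denominators cleared, the identity passes from Laurent series to power series and
  -- through `substQ` without inverses.
  have key : p * ∏ r ∈ Icc 1 (k - 2), ∏ j ∈ Icc 1 (N r - N (r + 1)), (1 - PowerSeries.X ^ j)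
      = PowerSeries.X ^ minSize k i N := by
    apply HahnSeries.ofPowerSeries_injective (Γ := ℤ)
    rw [map_mul, hp, map_prod, mul_assoc, ← prod_mul_distrib, map_pow, ← qL_eq_coe]
    rw [prod_eq_one, mul_one]
    intro r hr
    have hr := mem_Icc.1 hr
    rw [← Nat.cast_sub (hN r hr.1 (by omega))]
    exact invQ_mul_prod _
  have := congrArg substQ key
  rw [map_mul, map_prod, map_pow, substQ_X] at this
  simpa only [substQ_prod] using this

/-- The generating function of `setQ k i N` in the two variables. -/
theorem hasSum_setQ (k i : ℕ) (hk : 2 ≤ k) (hi : 1 ≤ i) (hik : i ≤ k) (N : ℕ → ℕ)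
    (hN : ∀ r : ℕ, 1 ≤ r → r + 1 ≤ k - 1 → N (r + 1) ≤ N r) :
    HasSum (fun g : setQ k i N => xVar ^ g.1.length * qVar ^ g.1.size)
      (qVar ^ (N 1 * (N 1 + 1) / 2 + ∑ r ∈ Finset.Icc 2 (k - 1), N r ^ 2
            + ∑ r ∈ Finset.Icc (i + 1) (k - 1), N r)
          * xVar ^ (∑ r ∈ Finset.Icc 1 (k - 1), N r)
        * (∏ r ∈ Finset.Icc 1 (k - 2), qFactorial (N r - N (r + 1)))⁻¹) := by
  obtain ⟨p, hp, hcount⟩ := exists_powerSeries hk hi hN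
  have hD : MvPowerSeries.constantCoeff
      (∏ r ∈ Finset.Icc 1 (k - 2), qFactorial (N r - N (r + 1))) ≠ 0 := by
    rw [map_prod]
    simp [constantCoeff_qFactorial]
  have hRHS : qVar ^ (N 1 * (N 1 + 1) / 2 + ∑ r ∈ Finset.Icc 2 (k - 1), N r ^ 2
            + ∑ r ∈ Finset.Icc (i + 1) (k - 1), N r)
          * xVar ^ (∑ r ∈ Finset.Icc 1 (k - 1), N r)
        * (∏ r ∈ Finset.Icc 1 (k - 2), qFactorial (N r - N (r + 1)))⁻¹
      = substQ p * xVar ^ (∑ r ∈ Finset.Icc 1 (k - 1), N r) := by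
    rw [← minSize, ← hp, mul_right_comm, mul_assoc (substQ p),
      MvPowerSeries.mul_inv_cancel _ hD, mul_one]
  rw [hRHS, MvPowerSeries.WithPiTopology.hasSum_iff_hasSum_coeff]
  intro m
  have hlen : ∀ g : setQ k i N, g.1.length = ∑ r ∈ Finset.Icc 1 (k - 1), N r := fun g =>
    g.2.1.1.2.1
  rw [coeff_substQ_mul]
  simp only [coeff_xVar_mul_qVar, hlen]
  by_cases hm : m 0 = ∑ r ∈ Finset.Icc 1 (k - 1), N r
  swap
  · simp only [hm, false_and, if_false]
    exact hasSum_zero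
  simp only [hm, true_and, if_true]
  obtain ⟨hfin, hcard⟩ := hcount (m 1)
  -- At a fixed monomial exactly the overpartitions of one size contribute, each with `1`; they are
  -- finitely many, so the coefficient sum is their number.
  set A : Set (setQ k i N) := {g | m 1 = g.1.size}
  have hinj : Function.Injective fun g : setQ k i N => g.1.parts := fun g g' h =>
    Subtype.ext (Overpartition.ext h)
  have himage : (fun g : setQ k i N => g.1.parts) '' A
      = {L | L ∈ tailsAbove k 0 false (insert i (Finset.Icc (i + 1) (k - 1)))
          (fun r => (N r : ℤ)) ∧ partSum L = (m 1 : ℕ)} := by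
    ext L
    constructor
    · rintro ⟨g, hg, rfl⟩
      exact ⟨(mem_setQ_iff hk hi hik N g.1).1 g.2, congrArg Nat.cast (Eq.symm hg)⟩
    · rintro ⟨hL, hs⟩
      obtain ⟨g, rfl⟩ := parts_of_mem_tailsAbove hL
      exact ⟨⟨g, (mem_setQ_iff hk hi hik N g).2 hL⟩, Eq.symm (Nat.cast_injective (R := ℤ) hs), rfl⟩
  rw [← himage] at hfin hcard
  have hA' : A.Finite := hfin.of_finite_image hinj.injOn
  rw [Set.ncard_image_of_injective _ hinj, HahnSeries.ofPowerSeries_apply_coeff] at hcard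
  rw [← hcard, Set.ncard_eq_toFinset_card A hA']
  have hsum : (hA'.toFinset.card : ℚ) = ∑ g ∈ hA'.toFinset, if m 1 = g.1.size then (1 : ℚ) else 0 := by
    have h1 : ∀ g ∈ hA'.toFinset, (if m 1 = g.1.size then (1 : ℚ) else 0) = 1 := fun g hg =>
      if_pos (hA'.mem_toFinset.1 hg)
    rw [Finset.sum_congr rfl h1]
    simp
  rw [hsum]
  exact hasSum_sum_of_ne_finset_zero fun g hg => if_neg fun h => hg (hA'.mem_toFinset.2 h)

end GordonMarking

/-- The inverse on the right is that of a formal power series with constant term `1`. -/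
theorem theorem6p1 (k i : ℕ) (hk : 2 ≤ k) (hi : 1 ≤ i) (hik : i ≤ k) (N : ℕ → ℕ)
    (hN : ∀ r : ℕ, 1 ≤ r → r + 1 ≤ k - 1 → N (r + 1) ≤ N r) :
    HasSum (fun g : setQ k i N => xVar ^ g.1.length * qVar ^ g.1.size)
      (qVar ^ (N 1 * (N 1 + 1) / 2 + ∑ r ∈ Finset.Icc 2 (k - 1), N r ^ 2
            + ∑ r ∈ Finset.Icc (i + 1) (k - 1), N r)
          * xVar ^ (∑ r ∈ Finset.Icc 1 (k - 1), N r)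
        * (∏ r ∈ Finset.Icc 1 (k - 2), qFactorial (N r - N (r + 1)))⁻¹) :=
  GordonMarking.hasSum_setQ k i hk hi hik N hN
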